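/- Let $b$ be a prime, let $\alpha,\beta\in\mathbb N$ and $t\in\mathbb N_0$ with $\alpha\ge 2$ and $\beta\ge 2\alpha$. Definitions. For $s\in\mathbb N$ and non-negative weights $\gamma=(\gamma_u)_{u\subseteq\{1,\dots,s\}}$, let $\mathcal H_{\alpha,\gamma}$ be the reproducing kernel Hilbert space of functions on $[0,1)^s$ with reproducing kernel $$\mathcal K_{\alpha,\gamma}(x,y)=\sum_{u\subseteq\{1,\dots,s\}}\gamma_u\prod_{j\in u}\Bigl\{\sum_{r=1}^{\alpha}\frac{B_r(x_j)B_r(y_j)}{(r!)^2}+(-1)^{\alpha+1}\frac{B_{2\alpha}(|x_j-y_j|)}{(2\alpha)!}\Bigr\},$$ where $B_r$ is the Bernoulli polynomial of degree $r$. The worst-case error of a finite point multiset $P\subset[0,1)^s$ in $\mathcal H_{\alpha,\gamma}$ is $e^{\mathrm{wor}}(\mathcal H_{\alpha,\gamma};P)=\sup_{\|f\|\le 1}\bigl|\frac1{|P|}\sum_{x\in P}f(x)-\int_{[0,1)^s}f(x)\,dx\bigr|$. For $m,n\in\mathbb N$ and matrices $C_1,\dots,C_s\in\mathbb F_b^{n\times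 m}$, the digital net generated by them consists of the points $x_h$, $0\le h<b^m$, whose $j$-th coordinate is $\sum_{i=1}^n\xi_ib^{-i}$ with $(\xi_1,\dots,\xi_n)^\top=C_j(\eta_0,\dots,\eta_{m-1})^\top$ and $h=\sum_{i=0}^{m-1}\eta_ib^i$, $\eta_i\in\{0,\dots,b-1\}$. It is an order $\beta$ digital $(t,m,s)$-net if $n\ge\beta m$, $0\le t\le\beta m$, and, whenever rows with numbers $1\le i_{j,v_j}<\dots<i_{j,1}\le n$ of $C_j$ ($v_j\ge 0$, $1\le j\le s$) satisfy $\sum_{j=1}^s\sum_{l=1}^{\min(\beta,v_j)}i_{j,l}\le\beta m-t$, all these rows together are linearly independent over $\mathbb F_b$. The shifted net $P\oplus\sigma$, $\sigma\in[0,1)^s$, arises from $P$ by adding $\sigma$ to every point componentwise and digitwise modulo $b$, using $b$-adic expansions that do not end in infinitely many digits $b-1$. Statement. There are constants $C_{\alpha,\beta,b,t,u}>0$, depending only on $\alpha,\beta,b,t$ and on $u$ (in fact only on $|u|$), such that for all $s,m\in\mathbb N$, every order $\beta$ digital $(t,m,s)$-net $P$ over $\mathbb F_b$ and all non-negative weights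 $\gamma$ there is a shift $\sigma\in[0,1)^s$ with $$e^{\mathrm{wor}}(\mathcal H_{\alpha,\gamma};P\oplus\sigma)\le\frac1{N^\alpha}\sum_{\emptyset\ne u\subseteq\{1,\dots,s\}}\gamma_u^{1/2}\,C_{\alpha,\beta,b,t,u}\,(\log N)^{(|u|-1)/2},\qquad N=|P|=b^m .$$ In particular, for all $s\in\mathbb N$ and all non-negative weights $\gamma$ there is a constant $c>0$, depending only on $\alpha,\beta,b,t,s,\gamma$, such that for every $m\in\mathbb N$ and every order $\beta$ digital $(t,m,s)$-net $P$ over $\mathbb F_b$ there is a shift $\sigma\in[0,1)^s$ with $$e^{\mathrm{wor}}(\mathcal H_{\alpha,\gamma};P\oplus\sigma)\le c\,N^{-\alpha}(\log N)^{(s-1)/2}.$$ -/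

import Mathlib

open MeasureTheory Matrix
open scoped NNReal ENNReal BigOperators

namespace QMC

/-! ### The half-open unit cube and quasi-Monte Carlo integration -/

/-- The half-open unit cube `[0,1)^s`. -/
abbrev UnitCube (s : ℕ) : Type := Set.pi Set.univ fun _ : Fin s => Set.Ico (0 : ℝ) 1

theorem UnitCube.coord_mem {s : ℕ} (x : UnitCube s) (j : Fin s) : x.1 j ∈ Set.Ico (0 : ℝ) 1 :=
  Set.mem_univ_pi.1 x.2 j

/-- The Lebesgue measure of `ℝ^s` on the subtype `[0,1)^s`. -/
noncomputable def cubeMeasure (s : ℕ) : Measure (UnitCube s) :=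
  (volume : Measure (Fin s → ℝ)).comap Subtype.val

/-- The QMC rule `I(f; P)`: the equal weight average of `f` over a finite point (multi)set,
given as a finite family, so that points are counted with multiplicity. -/
noncomputable def qmcRule {s : ℕ} {ι : Type*} [Fintype ι] (P : ι → UnitCube s)
    (f : UnitCube s → ℝ) : ℝ :=
  (Fintype.card ι : ℝ)⁻¹ * ∑ h, f (P h)

/-- The worst-case error of QMC integration over `P` in a reproducing kernel Hilbert space `H`
of real functions on `[0,1)^s`: the supremum of `|I(f; P) - I(f)|` over the unit ball of `H`. It
takes values in `[0,∞]`, so that the supremum always has its usual meaning. -/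
noncomputable def worstCaseError {s : ℕ} {ι : Type*} [Fintype ι] (H : Type*)
    [NormedAddCommGroup H] [InnerProductSpace ℝ H] [RKHS ℝ H (UnitCube s) ℝ]
    (P : ι → UnitCube s) : ℝ≥0∞ :=
  ⨆ (f : H) (_ : ‖f‖ ≤ 1), ENNReal.ofReal |qmcRule P f - ∫ x, f x ∂cubeMeasure s|

/-! ### The weighted Sobolev space -/

/-- The one-dimensional kernel without its constant term,
`∑_{r=1}^α B_r(x) B_r(y) / (r!)^2 + (-1)^(α+1) B_{2α}(|x-y|) / (2α)!`. -/
noncomputable def sobolevKernelOne (α : ℕ) (x y : ℝ) : ℝ :=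
  ∑ r ∈ Finset.Icc 1 α, bernoulliFun r x * bernoulliFun r y / ((r.factorial : ℝ)) ^ 2
    + (-1) ^ (α + 1) * bernoulliFun (2 * α) |x - y| / ((2 * α).factorial : ℝ)

/-- The reproducing kernel of the weighted Sobolev space of smoothness `α` on `[0,1)^s`. -/
noncomputable def sobolevKernel {s : ℕ} (α : ℕ) (γ : Finset (Fin s) → ℝ≥0)
    (x y : UnitCube s) : ℝ :=
  ∑ u : Finset (Fin s), (γ u : ℝ) * ∏ j ∈ u, sobolevKernelOne α (x.1 j) (y.1 j)

theorem posSemidef_rankOne {X : Type*} (f : X → ℝ) :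
    (Matrix.of fun x y => f x * f y : Matrix X X ℝ).PosSemidef := by
  refine ⟨?_, fun v => ?_⟩
  · ext x y
    simp [mul_comm]
  · have h : (v.sum fun i xi => v.sum fun j xj =>
        star xi * (Matrix.of fun x y => f x * f y : Matrix X X ℝ) i j * xj)
        = (v.sum fun i xi => xi * f i) ^ 2 := by
      simp only [Finsupp.sum, sq, Finset.sum_mul_sum, Matrix.of_apply, star_trivial]
      refine Finset.sum_congr rfl fun i _ => Finset.sum_congr rfl fun j _ => ?_
      ring
    rw [h]
    positivity

theorem hasSum_of_eq {f g : ℕ → ℝ} {a c : ℝ} (h : HasSum f a) (hf : ∀ n, g n = f n) (ha : c = a) :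
    HasSum g c := by
  rw [ha, funext hf]
  exact h

theorem posSemidef_of_hasSum {X : Type*} {M : ℕ → Matrix X X ℝ} {K : Matrix X X ℝ}
    (hM : ∀ n, (M n).PosSemidef) (hK : ∀ x y, HasSum (fun n => M n x y) (K x y)) :
    K.PosSemidef := by
  refine ⟨?_, fun v => ?_⟩
  · ext x y
    refine (hK y x).unique ?_
    simpa using hasSum_of_eq (hK x y) (fun n => by simpa using (hM n).isHermitian.apply x y) rfl
  · have h : HasSum (fun n => v.sum fun i xi => v.sum fun j xj => star xi * M n i j * xj)
        (v.sum fun i xi => v.sum fun j xj => star xi * K i j * xj) := by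
      simp only [Finsupp.sum]
      exact hasSum_sum fun i _ => hasSum_sum fun j _ => ((hK i j).mul_left _).mul_right _
    exact h.nonneg fun n => (hM n).2 v

theorem posSemidef_prod {X ι : Type*} (u : Finset ι) (M : ι → Matrix X X ℝ)
    (hM : ∀ j, (M j).PosSemidef) :
    (Matrix.of fun x y => ∏ j ∈ u, M j x y : Matrix X X ℝ).PosSemidef := by
  classical
  induction u using Finset.induction_on with
  | empty => simpa using posSemidef_rankOne (fun _ : X => (1 : ℝ))
  | insert a u ha ih =>
    have h := (hM a).hadamard ih
    have he : (Matrix.of fun x y => ∏ j ∈ insert a u, M j x y : Matrix X X ℝ)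
        = M a ⊙ Matrix.of fun x y => ∏ j ∈ u, M j x y := by
      ext x y
      simp [Finset.prod_insert ha, Matrix.hadamard_apply]
    rw [he]
    exact h

theorem posSemidef_sobolevKernelOne {α : ℕ} (hα : 1 ≤ α) :
    (Matrix.of fun x y => sobolevKernelOne α x.1 y.1 :
      Matrix (Set.Ico (0 : ℝ) 1) (Set.Ico (0 : ℝ) 1) ℝ).PosSemidef := by
  have h1 : (∑ r ∈ Finset.Icc 1 α, Matrix.of fun x y => (bernoulliFun r x.1 / r.factorial) *
      (bernoulliFun r y.1 / r.factorial) :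
      Matrix (Set.Ico (0 : ℝ) 1) (Set.Ico (0 : ℝ) 1) ℝ).PosSemidef :=
    posSemidef_sum _ fun r _ => posSemidef_rankOne fun x : Set.Ico (0 : ℝ) 1 =>
      bernoulliFun r x.1 / r.factorial
  have h2 : (Matrix.of fun x y =>
      (-1) ^ (α + 1) * bernoulliFun (2 * α) |x.1 - y.1| / ((2 * α).factorial : ℝ) :
      Matrix (Set.Ico (0 : ℝ) 1) (Set.Ico (0 : ℝ) 1) ℝ).PosSemidef := by
    have hc : (0 : ℝ) ≤ 2 / (2 * Real.pi) ^ (2 * α) := by positivity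
    refine posSemidef_of_hasSum
      (M := fun n => (2 / (2 * Real.pi) ^ (2 * α) * (1 / (n : ℝ) ^ (2 * α))) •
        ((Matrix.of fun x y => Real.cos (2 * Real.pi * n * x.1) * Real.cos (2 * Real.pi * n * y.1))
        + Matrix.of fun x y =>
          Real.sin (2 * Real.pi * n * x.1) * Real.sin (2 * Real.pi * n * y.1))) ?_ ?_
    · intro n
      exact ((posSemidef_rankOne fun x : Set.Ico (0 : ℝ) 1 =>
        Real.cos (2 * Real.pi * n * x.1)).add (posSemidef_rankOne fun x : Set.Ico (0 : ℝ) 1 =>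
        Real.sin (2 * Real.pi * n * x.1))).smul (by positivity)
    · intro x y
      have hxy : |x.1 - y.1| ∈ Set.Icc (0 : ℝ) 1 := by
        refine ⟨abs_nonneg _, abs_le.2 ⟨?_, ?_⟩⟩ <;>
        linarith [x.2.1, x.2.2, y.2.1, y.2.2]
      have h := (hasSum_one_div_nat_pow_mul_cos (k := α) (by omega) hxy).mul_left
        (2 / (2 * Real.pi) ^ (2 * α))
      refine hasSum_of_eq h ?_ ?_
      · intro n
        have hcos : Real.cos (2 * Real.pi * n * |x.1 - y.1|)
            = Real.cos (2 * Real.pi * n * x.1 - 2 * Real.pi * n * y.1) := by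
          rw [← Real.cos_abs (2 * Real.pi * n * x.1 - 2 * Real.pi * n * y.1), ← mul_sub, abs_mul,
            abs_of_nonneg (by positivity : (0 : ℝ) ≤ 2 * Real.pi * n)]
        rw [hcos, Real.cos_sub]
        simp only [Matrix.smul_apply, Matrix.add_apply, Matrix.of_apply, smul_eq_mul]
        ring
      · have hpi : (2 * Real.pi) ^ (2 * α) ≠ 0 := by positivity
        simp only [Matrix.of_apply, bernoulliFun]
        field_simp
  convert h1.add h2 using 1
  ext x y
  simp only [Matrix.of_apply, sobolevKernelOne, Matrix.add_apply, Matrix.sum_apply]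
  congr 1
  refine Finset.sum_congr rfl fun r _ => ?_
  ring

theorem posSemidef_sobolevKernel {s α : ℕ} (hα : 1 ≤ α) (γ : Finset (Fin s) → ℝ≥0) :
    (Matrix.of (sobolevKernel α γ)).PosSemidef := by
  have h : (∑ u : Finset (Fin s), (γ u : ℝ) • (Matrix.of fun x y : UnitCube s =>
      ∏ j ∈ u, sobolevKernelOne α (x.1 j) (y.1 j))).PosSemidef := by
    refine posSemidef_sum _ fun u _ => Matrix.PosSemidef.smul ?_ (γ u).2
    exact posSemidef_prod u
      (fun j => Matrix.of fun x y : UnitCube s => sobolevKernelOne α (x.1 j) (y.1 j))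
      fun j => (posSemidef_sobolevKernelOne hα).submatrix
        fun x : UnitCube s => (⟨x.1 j, x.coord_mem j⟩ : Set.Ico (0 : ℝ) 1)
  convert h using 1
  ext x y
  simp [sobolevKernel, Matrix.sum_apply]

/-- The kernel as an operator valued matrix (its entries act on the value space `ℝ` by
multiplication), the form in which reproducing kernel Hilbert spaces take their kernels. -/
noncomputable def sobolevKernelMatrix {s : ℕ} (α : ℕ) (γ : Finset (Fin s) → ℝ≥0) :
    Matrix (UnitCube s) (UnitCube s) (ℝ →L[ℝ] ℝ) :=
  Matrix.of fun x y => sobolevKernel α γ x y • ContinuousLinearMap.id ℝ ℝ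

theorem posSemidef_sobolevKernelMatrix {s α : ℕ} (hα : 1 ≤ α) (γ : Finset (Fin s) → ℝ≥0) :
    (sobolevKernelMatrix α γ).PosSemidef := by
  have h := posSemidef_sobolevKernel hα γ
  have hs : ∀ x y, sobolevKernel α γ x y = sobolevKernel α γ y x := fun x y =>
    by simpa using (h.isHermitian.apply x y).symm
  have key := (RKHS.posSemidef_tfae (𝕜 := ℝ) (K := sobolevKernelMatrix α γ)).out 0 2
  refine key.2 ⟨?_, fun v => ?_⟩
  · ext x y
    simp [sobolevKernelMatrix, hs x y, ContinuousLinearMap.star_eq_adjoint,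
      ContinuousLinearMap.adjoint_id]
  · have h2 := h.2 v
    refine h2.trans_eq ?_
    rw [RCLike.re_to_real]
    refine Finsupp.sum_congr fun x _ => Finsupp.sum_congr fun y _ => ?_
    simp [sobolevKernelMatrix, hs y x]
    ring

instance fact_posSemidef_sobolevKernelMatrix {s α : ℕ} [hα : Fact (2 ≤ α)]
    (γ : Finset (Fin s) → ℝ≥0) : Fact (sobolevKernelMatrix α γ).PosSemidef :=
  ⟨posSemidef_sobolevKernelMatrix (one_le_two.trans hα.out) γ⟩

/-- The weighted Sobolev space of smoothness `α ≥ 2` on `[0,1)^s`: the reproducing kernel Hilbert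
space of functions on `[0,1)^s` whose reproducing kernel is `sobolevKernel α γ`. -/
abbrev WeightedSobolev {s : ℕ} (α : ℕ) [Fact (2 ≤ α)] (γ : Finset (Fin s) → ℝ≥0) : Type :=
  RKHS.OfKernel (sobolevKernelMatrix α γ)

theorem continuous_sobolevKernel_left {s α : ℕ} (γ : Finset (Fin s) → ℝ≥0) (y : UnitCube s) :
    Continuous fun x => sobolevKernel α γ x y := by
  have hB : ∀ k, Continuous (bernoulliFun k) := fun _ => _root_.continuous_bernoulliFun _
  have h1 : ∀ j, Continuous fun x : UnitCube s => sobolevKernelOne α (x.1 j) (y.1 j) := fun j => by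
    have h0 : Continuous fun x : ℝ => sobolevKernelOne α x (y.1 j) := by
      unfold sobolevKernelOne
      fun_prop
    exact h0.comp ((continuous_apply j).comp continuous_subtype_val)
  exact continuous_finsetSum _ fun u _ => continuous_const.mul
    (continuous_finsetProd _ fun j _ => h1 j)

theorem exists_sobolevKernel_diag_le {s α : ℕ} (γ : Finset (Fin s) → ℝ≥0) :
    ∃ M : ℝ, ∀ x : UnitCube s, |sobolevKernel α γ x x| ≤ M := by
  have hB : ∀ k, Continuous (bernoulliFun k) := fun _ => _root_.continuous_bernoulliFun _
  have hc : Continuous fun x : Fin s → ℝ =>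
      ∑ u : Finset (Fin s), (γ u : ℝ) * ∏ j ∈ u, sobolevKernelOne α (x j) (x j) := by
    unfold sobolevKernelOne
    fun_prop
  obtain ⟨M, hM⟩ := (isCompact_Icc (a := (0 : Fin s → ℝ)) (b := 1)).exists_bound_of_continuousOn
    hc.continuousOn
  exact ⟨M, fun x => hM x.1 ⟨fun j => (x.coord_mem j).1, fun j => (x.coord_mem j).2.le⟩⟩

/-- The functions in the weighted Sobolev space are continuous. -/
theorem continuous_coe {s α : ℕ} [Fact (2 ≤ α)] {γ : Finset (Fin s) → ℝ≥0}
    (f : WeightedSobolev α γ) : Continuous (f : UnitCube s → ℝ) := by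
  obtain ⟨M, hM⟩ := exists_sobolevKernel_diag_le (α := α) γ
  have hb : ∀ x ∈ (Set.univ : Set (UnitCube s)),
      ‖RKHS.kerFun (WeightedSobolev α γ) x‖ ≤ √M := fun x _ => by
    rw [RKHS.norm_kerFun_eq_sqrt_norm_kernel, RKHS.OfKernel.kernel_ofKernel]
    refine Real.sqrt_le_sqrt ?_
    simpa [sobolevKernelMatrix, norm_smul] using hM x
  have hf : f ∈ closure (Submodule.span ℝ
      {RKHS.kerFun (WeightedSobolev α γ) x v | (x) (v)} : Set (WeightedSobolev α γ)) := by
    rw [← Submodule.topologicalClosure_coe, RKHS.kerFun_dense]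
    trivial
  obtain ⟨F, hF, hlim⟩ := mem_closure_iff_seq_limit.1 hf
  have hu := RKHS.tendstoUniformlyOn_of_norm_kerFun_le hb hlim
  rw [tendstoUniformlyOn_univ] at hu
  refine hu.continuous (Filter.Frequently.of_forall fun n => ?_)
  refine Submodule.span_induction (p := fun (g : WeightedSobolev α γ) _ => Continuous (g : UnitCube s → ℝ))
    ?_ ?_ ?_ ?_ (hF n)
  · rintro _ ⟨y, v, rfl⟩
    have : (RKHS.kerFun (WeightedSobolev α γ) y v : UnitCube s → ℝ)
        = fun x => sobolevKernel α γ x y * v := by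
      funext x
      rw [RKHS.kerFun_apply, RKHS.OfKernel.kernel_ofKernel]
      simp [sobolevKernelMatrix]
    rw [this]
    exact (continuous_sobolevKernel_left γ y).mul continuous_const
  · rw [RKHS.coe_zero]
    exact continuous_const
  · intro g h _ _ hg hh
    rw [RKHS.coe_add]
    exact hg.add hh
  · intro c g _ hg
    rw [RKHS.coe_smul]
    exact hg.const_smul c

theorem cubeMeasure_univ (s : ℕ) : cubeMeasure s Set.univ = 1 := by
  have hm : MeasurableSet (Set.pi Set.univ fun _ : Fin s => Set.Ico (0 : ℝ) 1) :=
    MeasurableSet.univ_pi fun _ => measurableSet_Ico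
  rw [cubeMeasure, (MeasurableEmbedding.subtype_coe hm).comap_apply, Set.image_univ,
    Subtype.range_coe, Real.volume_pi_Ico]
  simp

/-- The functions in the weighted Sobolev space are integrable over `[0,1)^s`, so the integral in
the worst-case error is a genuine one. -/
theorem integrable_coe {s α : ℕ} [Fact (2 ≤ α)] {γ : Finset (Fin s) → ℝ≥0}
    (f : WeightedSobolev α γ) : Integrable (f : UnitCube s → ℝ) (cubeMeasure s) := by
  have : IsFiniteMeasure (cubeMeasure s) := ⟨by rw [cubeMeasure_univ]; exact ENNReal.one_lt_top⟩
  obtain ⟨M, hM⟩ := exists_sobolevKernel_diag_le (α := α) γ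
  refine Integrable.of_bound (continuous_coe f).aestronglyMeasurable (‖f‖ * √M)
    (Filter.Eventually.of_forall fun x => ?_)
  refine (RKHS.norm_apply_le f x).trans (mul_le_mul_of_nonneg_left ?_ (norm_nonneg _))
  rw [RKHS.OfKernel.kernel_ofKernel]
  refine Real.sqrt_le_sqrt ?_
  simpa [sobolevKernelMatrix, norm_smul] using hM x

/-! ### Digital shifts -/

/-- Digitwise addition modulo `b` of two numbers in `[0,1)`, through their unique `b`-adic
expansions (`Fin b` carries addition modulo `b`). -/
noncomputable def digitAdd (b : ℕ) [NeZero b] (x y : ℝ) : ℝ :=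
  Real.ofDigits fun i => Real.digits x b i + Real.digits y b i

/-- `x` can be written in a finite `b`-adic expansion, i.e. `x = k / b ^ n`. -/
def HasFiniteExpansion (b : ℕ) (x : ℝ) : Prop := ∃ n k : ℕ, x = (k : ℝ) / (b : ℝ) ^ n

theorem sum_ofDigitsTerm_le {b : ℕ} (hb : 1 < b) (a : ℕ → Fin b) (n : ℕ) :
    ∑ i ∈ Finset.range n, Real.ofDigitsTerm a i ≤ 1 - ((b : ℝ) ^ n)⁻¹ := by
  let a' : ℕ → Fin b := fun i => if i < n then a i else ⟨b - 1, Nat.sub_one_lt_of_lt hb⟩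
  have h1 := Real.ofDigits_le_one a'
  rw [Real.ofDigits_eq_sum_add_ofDigits a' n] at h1
  have h2 : (fun i => a' (i + n)) = fun _ => (⟨b - 1, Nat.sub_one_lt_of_lt hb⟩ : Fin b) := by
    funext i
    simp [a']
  have h3 : ∑ i ∈ Finset.range n, Real.ofDigitsTerm a' i
      = ∑ i ∈ Finset.range n, Real.ofDigitsTerm a i :=
    Finset.sum_congr rfl fun i hi => by simp [Real.ofDigitsTerm, a', Finset.mem_range.1 hi]
  rw [h2, h3, Real.ofDigits_const_last_eq_one' hb] at h1
  linarith

theorem digits_eq_zero {b : ℕ} [NeZero b] {n k i : ℕ} (hi : n ≤ i) :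
    Real.digits ((k : ℝ) / (b : ℝ) ^ n) b i = 0 := by
  have hb : (b : ℝ) ≠ 0 := by exact_mod_cast NeZero.ne b
  have h : (k : ℝ) / (b : ℝ) ^ n * (b : ℝ) ^ (i + 1) = ((k * b ^ (i - n) * b : ℕ) : ℝ) := by
    obtain ⟨d, rfl⟩ := Nat.exists_eq_add_of_le hi
    have : n + d - n = d := by omega
    rw [this]
    push_cast
    field_simp
    ring
  rw [Real.digits, h, Nat.floor_natCast]
  ext
  simp

theorem digits_add_eq {b : ℕ} [NeZero b] {y : ℝ} (hy : 0 ≤ y) (n i : ℕ) :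
    Real.digits y b (i + n) = Real.digits (Int.fract (y * (b : ℝ) ^ n)) b i := by
  have h0 : 0 ≤ y * (b : ℝ) ^ n := by positivity
  have h : y * (b : ℝ) ^ (i + n + 1) = Int.fract (y * (b : ℝ) ^ n) * (b : ℝ) ^ (i + 1)
      + ((⌊y * (b : ℝ) ^ n⌋₊ * b ^ i * b : ℕ) : ℝ) := by
    have h1 : Int.fract (y * (b : ℝ) ^ n) = y * (b : ℝ) ^ n - ⌊y * (b : ℝ) ^ n⌋₊ := by
      rw [Int.fract, natCast_floor_eq_intCast_floor h0]
    rw [h1]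
    push_cast
    ring
  have h2 : 0 ≤ Int.fract (y * (b : ℝ) ^ n) * (b : ℝ) ^ (i + 1) :=
    mul_nonneg (Int.fract_nonneg _) (by positivity)
  rw [Real.digits, Real.digits, h, Nat.floor_add_natCast h2]
  ext
  simp

/-- If `x` has a finite `b`-adic expansion then `x ⊕ y` stays in `[0,1)`. -/
theorem digitAdd_mem_Ico {b : ℕ} [NeZero b] (hb : 1 < b) {x y : ℝ} (hx : HasFiniteExpansion b x)
    (hy : y ∈ Set.Ico (0 : ℝ) 1) : digitAdd b x y ∈ Set.Ico (0 : ℝ) 1 := by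
  refine ⟨Real.ofDigits_nonneg _, ?_⟩
  obtain ⟨n, k, rfl⟩ := hx
  have ht : (fun i => Real.digits ((k : ℝ) / (b : ℝ) ^ n) b (i + n) + Real.digits y b (i + n))
      = Real.digits (Int.fract (y * (b : ℝ) ^ n)) b := by
    funext i
    rw [digits_eq_zero (by omega), zero_add, digits_add_eq hy.1]
  have hpos : (0 : ℝ) < ((b : ℝ) ^ n)⁻¹ := by
    have : (0 : ℝ) < b := by exact_mod_cast NeZero.pos b
    positivity
  rw [digitAdd, Real.ofDigits_eq_sum_add_ofDigits _ n, ht,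
    Real.ofDigits_digits hb ⟨Int.fract_nonneg _, Int.fract_lt_one _⟩]
  have h1 := sum_ofDigitsTerm_le hb
    (fun i => Real.digits ((k : ℝ) / (b : ℝ) ^ n) b i + Real.digits y b i) n
  have h2 := mul_lt_mul_of_pos_left (Int.fract_lt_one (y * (b : ℝ) ^ n)) hpos
  linarith

/-- The digitally shifted point set `P ⊕ σ` (componentwise digitwise addition), for a point set
whose coordinates have finite `b`-adic expansions. -/
noncomputable def digitalShift {s b : ℕ} [hb : Fact b.Prime] {ι : Type*} (P : ι → UnitCube s)
    (hP : ∀ h j, HasFiniteExpansion b ((P h).1 j)) (σ : UnitCube s) : ι → UnitCube s :=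
  fun h => ⟨fun j => digitAdd b ((P h).1 j) (σ.1 j),
    Set.mem_univ_pi.2 fun j => digitAdd_mem_Ico hb.out.one_lt (hP h j) (σ.coord_mem j)⟩

/-! ### Digital nets -/

/-- The digit vector `(η_0, …, η_{m-1})` over `ℤ/b` of `h = ∑ η_i b^i`. -/
def digitVector (b m h : ℕ) : Fin m → ZMod b := fun i => ((h / b ^ (i : ℕ) : ℕ) : ZMod b)

/-- The coordinate `ξ_1 / b + ⋯ + ξ_n / b^n` with `(ξ_1, …, ξ_n)ᵀ = C (η_0, …, η_{m-1})ᵀ`. -/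
noncomputable def netCoord {b m n : ℕ} (C : Matrix (Fin n) (Fin m) (ZMod b)) (h : ℕ) : ℝ :=
  ∑ i : Fin n, (((C *ᵥ digitVector b m h) i).val : ℝ) / (b : ℝ) ^ ((i : ℕ) + 1)

theorem sum_digit_finite {b : ℕ} [hb : Fact b.Prime] : ∀ (n : ℕ) (ξ : Fin n → ZMod b),
    ∃ k : ℕ, k < b ^ n ∧
      ∑ i : Fin n, ((ξ i).val : ℝ) / (b : ℝ) ^ ((i : ℕ) + 1) = (k : ℝ) / (b : ℝ) ^ n
  | 0, _ => ⟨0, by simp, by simp⟩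
  | n + 1, ξ => by
    obtain ⟨k, hk, h⟩ := sum_digit_finite n (fun i => ξ i.castSucc)
    have hb0 : (b : ℝ) ≠ 0 := by exact_mod_cast hb.out.ne_zero
    have : NeZero b := ⟨hb.out.ne_zero⟩
    have hv := ZMod.val_lt (ξ (Fin.last n))
    refine ⟨k * b + (ξ (Fin.last n)).val, ?_, ?_⟩
    · calc k * b + (ξ (Fin.last n)).val < k * b + b := by omega
        _ = (k + 1) * b := by ring
        _ ≤ b ^ n * b := Nat.mul_le_mul_right _ hk
        _ = b ^ (n + 1) := by ring
    · rw [Fin.sum_univ_castSucc]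
      simp only [Fin.val_castSucc, Fin.val_last]
      rw [h]
      push_cast
      field_simp
      ring

theorem netCoord_mem_Ico {b m n : ℕ} [hb : Fact b.Prime] (C : Matrix (Fin n) (Fin m) (ZMod b))
    (h : ℕ) : netCoord C h ∈ Set.Ico (0 : ℝ) 1 := by
  obtain ⟨k, hk, he⟩ := sum_digit_finite n (C *ᵥ digitVector b m h)
  have hpos : (0 : ℝ) < (b : ℝ) ^ n := by
    have : (0 : ℝ) < b := by exact_mod_cast hb.out.pos
    positivity
  rw [netCoord, he]
  refine ⟨by positivity, (div_lt_one hpos).2 (by exact_mod_cast hk)⟩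

/-- The digital net over `𝔽_b` with generating matrices `C_1, …, C_s`: the `b^m` points
`x_0, …, x_{b^m - 1}`, as a family. -/
noncomputable def digitalNet {s b m n : ℕ} [Fact b.Prime]
    (C : Fin s → Matrix (Fin n) (Fin m) (ZMod b)) : Fin (b ^ m) → UnitCube s :=
  fun h => ⟨fun j => netCoord (C j) h, Set.mem_univ_pi.2 fun j => netCoord_mem_Ico (C j) h⟩

theorem digitalNet_finite {s b m n : ℕ} [Fact b.Prime]
    (C : Fin s → Matrix (Fin n) (Fin m) (ZMod b)) (h : Fin (b ^ m)) (j : Fin s) :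
    HasFiniteExpansion b ((digitalNet C h).1 j) := by
  obtain ⟨k, -, he⟩ := sum_digit_finite n (C j *ᵥ digitVector b m h)
  exact ⟨n, k, he⟩

/-- The digital net with generating matrices `C_1, …, C_s ∈ 𝔽_b^{n × m}` is an order `β` digital
`(t,m,s)`-net over `𝔽_b`: `n ≥ β m`, `0 ≤ t ≤ β m`, and for every choice of rows
`n ≥ i_{j,1} > ⋯ > i_{j,v_j} ≥ 1` of each `C_j` (possibly none, `v_j = 0`) with
`∑_j ∑_{l ≤ min(β, v_j)} i_{j,l} ≤ β m - t`, all the chosen rows are linearly independent.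
Rows are indexed from `0` in Lean, whence `i j l + 1`; the index `l` starts at `0` as well. -/
def IsOrderDigitalNet {s b m n : ℕ} (β t : ℕ)
    (C : Fin s → Matrix (Fin n) (Fin m) (ZMod b)) : Prop :=
  β * m ≤ n ∧ t ≤ β * m ∧
    ∀ (v : Fin s → ℕ) (i : (j : Fin s) → Fin (v j) → Fin n), (∀ j, StrictAnti (i j)) →
      ∑ j, ∑ l : Fin (v j), (if (l : ℕ) < β then (i j l : ℕ) + 1 else 0) ≤ β * m - t →
      LinearIndependent (ZMod b) fun p : (j : Fin s) × Fin (v j) => (C p.1).row (i p.1 p.2)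

end QMC

namespace QMC

/-! The squared worst-case error is controlled by a double mean of the kernel minus `γ ∅`
(`worstCaseError_le`). It suffices to average over the finitely many shifts with `n` digits: the net
lies on the grid of mesh `b^{-n}`, so shifting is addition in a finite group and finite Fourier
analysis applies. The averaged kernel has only diagonal Walsh coefficients, and summing over the net
keeps exactly the frequencies of the dual net (`sum_prod_eq_sum_dual`). Hence some shift has squared
error at most the weighted sum over nonempty `u` of the absolute products of coefficients over the
dual (`exists_shift_error_le`).

Two estimates bound this sum. The first is decay: up to a constant, a coefficient is at most `b` to
minus twice the sum of the `α` largest positions of nonzero digits (`exists_walshCoeff_le_topSum`).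
Summing one digit against its nontrivial character is a first difference whose step is the weight of
that digit. The smooth terms of the kernel lose one derivative per digit and variable. The term in
`|x - y|` permits `2α - 2` derivatives, ending in a multiple of `B_2(|t|)`; the last two differences
are of second order except near its kink, which few pairs of grid points approach.

The second is the geometry of the dual. Monotonicity of the positions bounds the top `α` sum below
by a combination of the largest position and the top `β` sum (`topSum_interpolation`). The order `β`
property makes the top `β` sum larger than `β m - t`. What remains is a geometric series in the
largest positions, with ratio below `1/b` because `β ≥ 2α`. It beats the number of dual points in a
box (`card_topPosition_le`), and the choice of the positions contributes the factor `m^{|u|-1}`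
(`sum_pow_topPosition_le`).

Averaging over grid shifts alone leaves the zero-frequency coefficient nonzero, but it is a Riemann
sum error `O(b^{-n})`, and `n ≥ β m ≥ 2 α m` makes this `O(N^{-2α})`. Taking square roots term by
term gives the claim. -/

/-! ### Kernel integrals and the worst-case error -/

theorem integral_bernoulliFun_abs_sub {k : ℕ} (hk : Even k) (hk0 : k ≠ 0) {x : ℝ}
    (hx : x ∈ Set.Ico (0 : ℝ) 1) :
    ∫ y in (0 : ℝ)..1, bernoulliFun k |x - y| = 0 := by
  have hc : Continuous fun y => bernoulliFun k |x - y| := by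
    have := _root_.continuous_bernoulliFun k
    fun_prop
  rw [← intervalIntegral.integral_add_adjacent_intervals (hc.intervalIntegrable 0 x)
    (hc.intervalIntegrable x 1)]
  have h1 : ∫ y in (0 : ℝ)..x, bernoulliFun k |x - y| = ∫ y in (0 : ℝ)..x, bernoulliFun k y := by
    have h0 := intervalIntegral.integral_comp_sub_left (fun y => bernoulliFun k y) x
      (a := 0) (b := x)
    rw [sub_self, sub_zero] at h0
    rw [← h0]
    refine intervalIntegral.integral_congr fun y hy => ?_
    rw [Set.uIcc_of_le hx.1] at hy
    rw [abs_of_nonneg (by linarith [hy.2])]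
  have h2 : ∫ y in x..1, bernoulliFun k |x - y| = ∫ y in x..1, bernoulliFun k y := by
    -- The symmetry `B_k(1 - t) = B_k(t)` for even `k` is used here because `y ↦ 1 + x - y` maps
    -- `[x, 1]` onto itself.
    have h3 : ∫ y in x..1, bernoulliFun k |x - y| = ∫ y in x..1, bernoulliFun k (1 + x - y) := by
      refine intervalIntegral.integral_congr fun y hy => ?_
      rw [Set.uIcc_of_le hx.2.le] at hy
      rw [abs_of_nonpos (by linarith [hy.1])]
      have := bernoulliFun_eval_one_sub (k := k) (x := y - x)
      rw [hk.neg_one_pow, one_mul] at this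
      rw [neg_sub, ← this]
      congr 1
      ring
    rw [h3, intervalIntegral.integral_comp_sub_left (fun y => bernoulliFun k y) (1 + x)]
    congr 1 <;> ring
  rw [h1, h2, intervalIntegral.integral_add_adjacent_intervals
    ((_root_.continuous_bernoulliFun k).intervalIntegrable _ _)
    ((_root_.continuous_bernoulliFun k).intervalIntegrable _ _)]
  exact integral_bernoulliFun_eq_zero hk0

theorem continuous_sobolevKernelOne (α : ℕ) :
    Continuous fun p : ℝ × ℝ => sobolevKernelOne α p.1 p.2 := by
  have hB : ∀ k, Continuous (bernoulliFun k) := fun _ => _root_.continuous_bernoulliFun _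
  unfold sobolevKernelOne
  fun_prop

theorem integral_sobolevKernelOne {α : ℕ} (hα : 1 ≤ α) {x : ℝ} (hx : x ∈ Set.Ico (0 : ℝ) 1) :
    ∫ y in (0 : ℝ)..1, sobolevKernelOne α x y = 0 := by
  have hB : ∀ k, Continuous (bernoulliFun k) := fun _ => _root_.continuous_bernoulliFun _
  unfold sobolevKernelOne
  rw [intervalIntegral.integral_add, intervalIntegral.integral_finsetSum]
  · have h1 : ∀ r ∈ Finset.Icc 1 α, ∫ y in (0 : ℝ)..1,
        bernoulliFun r x * bernoulliFun r y / ((r.factorial : ℝ)) ^ 2 = 0 := fun r hr => by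
      rw [intervalIntegral.integral_div, intervalIntegral.integral_const_mul,
        integral_bernoulliFun_eq_zero (by grind)]
      simp
    rw [Finset.sum_eq_zero h1, intervalIntegral.integral_div, intervalIntegral.integral_const_mul,
      integral_bernoulliFun_abs_sub (by simp) (by omega) hx]
    simp
  · intro r _
    apply Continuous.intervalIntegrable
    fun_prop
  · apply Continuous.intervalIntegrable
    fun_prop
  · apply Continuous.intervalIntegrable
    fun_prop

theorem integral_cubeMeasure_prod {s : ℕ} (f : Fin s → ℝ → ℝ) :
    ∫ y : UnitCube s, ∏ j, f j (y.1 j) ∂cubeMeasure s = ∏ j, ∫ y in (0 : ℝ)..1, f j y := by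
  have hm : MeasurableSet (Set.pi Set.univ fun _ : Fin s => Set.Ico (0 : ℝ) 1) :=
    MeasurableSet.univ_pi fun _ => measurableSet_Ico
  rw [cubeMeasure, integral_subtype_comap hm (fun y : Fin s → ℝ => ∏ j, f j (y j)),
    volume_pi, Measure.restrict_pi_pi, integral_fintype_prod_eq_prod]
  refine Finset.prod_congr rfl fun j _ => ?_
  rw [intervalIntegral.integral_of_le zero_le_one, integral_Ico_eq_integral_Ioo,
    integral_Ioc_eq_integral_Ioo]

theorem cubeMeasure_isProbabilityMeasure (s : ℕ) : IsProbabilityMeasure (cubeMeasure s) :=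
  ⟨cubeMeasure_univ s⟩

theorem integral_prod_sobolevKernelOne {s α : ℕ} (hα : 1 ≤ α) (x : UnitCube s)
    (u : Finset (Fin s)) :
    ∫ y : UnitCube s, ∏ j ∈ u, sobolevKernelOne α (x.1 j) (y.1 j) ∂cubeMeasure s
      = if u = ∅ then 1 else 0 := by
  have h := integral_cubeMeasure_prod
    (fun j y => if j ∈ u then sobolevKernelOne α (x.1 j) y else 1)
  have h1 : ∀ y : UnitCube s, ∏ j, (if j ∈ u then sobolevKernelOne α (x.1 j) (y.1 j) else 1)
      = ∏ j ∈ u, sobolevKernelOne α (x.1 j) (y.1 j) := fun y => by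
    rw [Finset.prod_ite_mem, Finset.univ_inter]
  simp only [h1] at h
  rw [h]
  split_ifs with hu
  · simp [hu]
  · obtain ⟨j, hj⟩ := Finset.nonempty_iff_ne_empty.2 hu
    refine Finset.prod_eq_zero (Finset.mem_univ j) ?_
    simp only [hj, if_true]
    exact integral_sobolevKernelOne hα (x.coord_mem j)

/-- Only `u = ∅` survives, since every one-dimensional factor has mean zero. Consequently the
representer of integration is a constant function. -/
theorem integral_sobolevKernel {s α : ℕ} (hα : 1 ≤ α) (γ : Finset (Fin s) → ℝ≥0)
    (x : UnitCube s) : ∫ y, sobolevKernel α γ x y ∂cubeMeasure s = γ ∅ := by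
  have := cubeMeasure_isProbabilityMeasure s
  unfold sobolevKernel
  rw [integral_finsetSum]
  · simp [integral_const_mul, integral_prod_sobolevKernelOne hα]
  · intro u _
    refine Integrable.const_mul ?_ _
    have hc : Continuous fun y : Fin s → ℝ => ∏ j ∈ u, sobolevKernelOne α (x.1 j) (y j) :=
      continuous_finsetProd _ fun j _ =>
        (continuous_sobolevKernelOne α).comp (continuous_const.prodMk (continuous_apply j))
    obtain ⟨M, hM⟩ := (isCompact_Icc (a := (0 : Fin s → ℝ)) (b := 1)).exists_bound_of_continuousOn
      hc.continuousOn
    exact Integrable.of_bound (hc.comp continuous_subtype_val).aestronglyMeasurable M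
      (Filter.Eventually.of_forall fun y =>
        hM y.1 ⟨fun j => (y.coord_mem j).1, fun j => (y.coord_mem j).2.le⟩)

theorem sobolevKernel_comm {s α : ℕ} (γ : Finset (Fin s) → ℝ≥0) (x y : UnitCube s) :
    sobolevKernel α γ x y = sobolevKernel α γ y x := by
  simp only [sobolevKernel, sobolevKernelOne, abs_sub_comm, mul_comm]

theorem kerFun_weightedSobolev {s α : ℕ} [Fact (2 ≤ α)] (γ : Finset (Fin s) → ℝ≥0)
    (x y : UnitCube s) :
    (RKHS.kerFun (WeightedSobolev α γ) y 1 : WeightedSobolev α γ) x = sobolevKernel α γ x y := by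
  rw [RKHS.kerFun_apply, RKHS.OfKernel.kernel_ofKernel]
  simp [sobolevKernelMatrix]

theorem inner_kerFun_weightedSobolev {s α : ℕ} [Fact (2 ≤ α)] (γ : Finset (Fin s) → ℝ≥0)
    (y : UnitCube s) (f : WeightedSobolev α γ) :
    inner ℝ (RKHS.kerFun (WeightedSobolev α γ) y 1) f = f y := by
  rw [RKHS.kerFun_inner]
  simp

/-- The Riesz representer of integration over the unit cube. -/
theorem exists_integral_representer {s α : ℕ} [Fact (2 ≤ α)] (γ : Finset (Fin s) → ℝ≥0) :
    ∃ R : WeightedSobolev α γ, ∀ f : WeightedSobolev α γ,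
      inner ℝ R f = ∫ x, f x ∂cubeMeasure s := by
  have := cubeMeasure_isProbabilityMeasure s
  obtain ⟨M, hM⟩ := exists_sobolevKernel_diag_le (α := α) γ
  let L : WeightedSobolev α γ →ₗ[ℝ] ℝ :=
    { toFun := fun f => ∫ x, f x ∂cubeMeasure s
      map_add' := fun f g => by
        rw [RKHS.coe_add]
        exact integral_add (integrable_coe f) (integrable_coe g)
      map_smul' := fun c f => by
        rw [RKHS.coe_smul]
        exact integral_smul c _ }
  let L' : WeightedSobolev α γ →L[ℝ] ℝ := L.mkContinuous (√M) fun f => by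
    have h : ∀ x, ‖f x‖ ≤ √M * ‖f‖ := fun x => by
      rw [mul_comm]
      refine (RKHS.norm_apply_le f x).trans (mul_le_mul_of_nonneg_left ?_ (norm_nonneg _))
      rw [RKHS.OfKernel.kernel_ofKernel]
      refine Real.sqrt_le_sqrt ?_
      simpa [sobolevKernelMatrix, norm_smul] using hM x
    have := norm_integral_le_of_norm_le_const (μ := cubeMeasure s)
      (Filter.Eventually.of_forall h)
    simpa [L] using this
  refine ⟨(InnerProductSpace.toDual ℝ _).symm L', fun f => ?_⟩
  rw [InnerProductSpace.toDual_symm_apply]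
  rfl

/-- The error functional is the inner product with `ζ - R`, the difference of the representers of
the rule and of the integral, so Cauchy–Schwarz bounds it by `‖ζ - R‖`. As `R` is the constant `γ
∅`, both `⟨ζ, R⟩` and `⟨R, R⟩` equal `γ ∅`. -/
theorem worstCaseError_le {s α : ℕ} [hα : Fact (2 ≤ α)] (γ : Finset (Fin s) → ℝ≥0) {ι : Type*}
    [Fintype ι] [Nonempty ι] (P : ι → UnitCube s) :
    worstCaseError (WeightedSobolev α γ) P ≤ ENNReal.ofReal
      (√(((Fintype.card ι : ℝ)⁻¹) ^ 2 * ∑ h, ∑ g, sobolevKernel α γ (P h) (P g) - γ ∅)) := by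
  obtain ⟨R, hR⟩ := exists_integral_representer (α := α) γ
  set N : ℝ := (Fintype.card ι : ℝ) with hN
  have hN0 : N ≠ 0 := by
    rw [hN]
    exact_mod_cast Fintype.card_ne_zero
  let ζ : WeightedSobolev α γ := N⁻¹ • ∑ h, RKHS.kerFun (WeightedSobolev α γ) (P h) 1
  have hζ : ∀ f : WeightedSobolev α γ, inner ℝ ζ f = qmcRule P f := fun f => by
    simp only [ζ, qmcRule, inner_smul_left, sum_inner, inner_kerFun_weightedSobolev]
    simp [hN]
  have hRx : ∀ x, R x = γ ∅ := fun x => by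
    rw [← inner_kerFun_weightedSobolev, real_inner_comm, hR,
      ← integral_sobolevKernel (one_le_two.trans hα.out) γ x]
    refine integral_congr_ae (Filter.Eventually.of_forall fun y => ?_)
    rw [kerFun_weightedSobolev, sobolevKernel_comm]
  have hnorm : ‖ζ - R‖ ^ 2 = (N⁻¹) ^ 2 * ∑ h, ∑ g, sobolevKernel α γ (P h) (P g) - γ ∅ := by
    have := cubeMeasure_isProbabilityMeasure s
    have h1 : inner ℝ ζ R = (γ ∅ : ℝ) := by
      rw [hζ, qmcRule]
      simp only [hRx, Finset.sum_const, Finset.card_univ, nsmul_eq_mul, ← hN]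
      field_simp
    have h2 : inner ℝ R R = (γ ∅ : ℝ) := by
      rw [hR]
      simp [hRx]
    have h3 : inner ℝ ζ ζ = (N⁻¹) ^ 2 * ∑ h, ∑ g, sobolevKernel α γ (P h) (P g) := by
      rw [hζ, qmcRule, ← hN, sq, mul_assoc]
      congr 1
      rw [Finset.mul_sum]
      refine Finset.sum_congr rfl fun h _ => ?_
      rw [← inner_kerFun_weightedSobolev]
      simp only [ζ, inner_smul_right, inner_sum, inner_kerFun_weightedSobolev]
      simp only [kerFun_weightedSobolev]
    rw [@norm_sub_sq_real, ← real_inner_self_eq_norm_sq, ← real_inner_self_eq_norm_sq, h1, h2, h3]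
    ring
  refine iSup₂_le fun f hf => ENNReal.ofReal_le_ofReal ?_
  rw [← hnorm, Real.sqrt_sq (norm_nonneg _), ← hζ, ← hR, ← inner_sub_left]
  refine (abs_real_inner_le_norm _ _).trans ?_
  exact mul_le_of_le_one_right (norm_nonneg _) hf

/-! ### Grid points and digit vectors -/

/-- The point `∑ ξ_i b^{-(i+1)}` of `[0,1)` with digit vector `ξ`. -/
noncomputable def gridPoint {b n : ℕ} (ξ : Fin n → ZMod b) : ℝ :=
  ∑ i : Fin n, ((ξ i).val : ℝ) / (b : ℝ) ^ ((i : ℕ) + 1)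

theorem digitVector_injective {b : ℕ} (m : ℕ) :
    Function.Injective fun h : Fin (b ^ m) => digitVector b m (h : ℕ) := by
  intro h g hhg
  have hd : ∀ i < m, (h : ℕ) / b ^ i % b = (g : ℕ) / b ^ i % b := fun i hi => by
    have := congrFun hhg ⟨i, hi⟩
    simpa [digitVector, ZMod.natCast_eq_natCast_iff'] using this
  have key : ∀ k ≤ m, (h : ℕ) % b ^ k = (g : ℕ) % b ^ k := by
    intro k
    induction k with
    | zero => simp [Nat.mod_one]
    | succ k ih =>
      intro hk
      rw [Nat.mod_pow_succ, Nat.mod_pow_succ, ih (by omega), hd k (by omega)]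
  have := key m le_rfl
  rw [Nat.mod_eq_of_lt h.2, Nat.mod_eq_of_lt g.2] at this
  exact Fin.ext this

section Grid

variable {b n : ℕ} [hb : Fact b.Prime]

theorem gridPoint_mem_Ico (ξ : Fin n → ZMod b) : gridPoint ξ ∈ Set.Ico (0 : ℝ) 1 := by
  obtain ⟨k, hk, he⟩ := sum_digit_finite n ξ
  have hpos : (0 : ℝ) < (b : ℝ) ^ n := by
    have : (0 : ℝ) < b := by exact_mod_cast hb.out.pos
    positivity
  rw [gridPoint, he]
  exact ⟨by positivity, (div_lt_one hpos).2 (by exact_mod_cast hk)⟩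

theorem gridPoint_succ (ξ : Fin (n + 1) → ZMod b) :
    gridPoint ξ = ((ξ 0).val + gridPoint (fun i : Fin n => ξ i.succ)) / b := by
  have hb0 : (b : ℝ) ≠ 0 := by exact_mod_cast hb.out.ne_zero
  rw [gridPoint, gridPoint, Fin.sum_univ_succ, add_div, Finset.sum_div]
  congr 1
  · simp
  · refine Finset.sum_congr rfl fun i _ => ?_
    rw [Fin.val_succ, pow_succ, div_div]

theorem digits_gridPoint : ∀ (n : ℕ) (ξ : Fin n → ZMod b) (i : ℕ),
    ((Real.digits (gridPoint ξ) b i : Fin b) : ℕ) = if h : i < n then (ξ ⟨i, h⟩).val else 0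
  | 0, ξ, i => by simp [gridPoint, Real.digits]
  | n + 1, ξ, i => by
    have hb0 : (b : ℝ) ≠ 0 := by exact_mod_cast hb.out.ne_zero
    have hmul : gridPoint ξ * b = (ξ 0).val + gridPoint (fun i : Fin n => ξ i.succ) := by
      rw [gridPoint_succ]
      field_simp
    have hg := gridPoint_mem_Ico (fun i : Fin n => ξ i.succ)
    cases i with
    | zero =>
      have hf : ⌊gridPoint ξ * (b : ℝ) ^ (0 + 1)⌋₊ = (ξ 0).val := by
        rw [zero_add, pow_one, hmul, add_comm, Nat.floor_add_natCast hg.1,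
          Nat.floor_eq_zero.2 hg.2, zero_add]
      rw [Real.digits, hf]
      simp [Fin.ofNat, Nat.mod_eq_of_lt (ZMod.val_lt (ξ 0))]
    | succ i =>
      have hf : Int.fract (gridPoint ξ * (b : ℝ) ^ 1) = gridPoint (fun i : Fin n => ξ i.succ) := by
        rw [pow_one, hmul, Int.fract_natCast_add, Int.fract_eq_self.2 ⟨hg.1, hg.2⟩]
      rw [digits_add_eq (gridPoint_mem_Ico ξ).1 1 i, hf, digits_gridPoint n _ i]
      simp [Fin.succ]

/-- Digitwise addition has no carries and both expansions vanish beyond position `n`. This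
identifies shifting on the grid with addition in the group of digit vectors. -/
theorem digitAdd_gridPoint (ξ η : Fin n → ZMod b) :
    digitAdd b (gridPoint ξ) (gridPoint η) = gridPoint (ξ + η) := by
  have hval : ∀ i, ((Real.digits (gridPoint ξ) b i + Real.digits (gridPoint η) b i : Fin b) : ℕ)
      = if h : i < n then ((ξ + η) ⟨i, h⟩).val else 0 := fun i => by
    rw [Fin.val_add, digits_gridPoint, digits_gridPoint]
    split_ifs
    · rw [Pi.add_apply, ZMod.val_add]
    · simp
  have htail : (fun i => Real.digits (gridPoint ξ) b (i + n) + Real.digits (gridPoint η) b (i + n))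
      = fun _ => (0 : Fin b) := by
    funext i
    ext
    rw [hval]
    simp
  rw [digitAdd, Real.ofDigits_eq_sum_add_ofDigits _ n, htail]
  have h0 : Real.ofDigits (fun _ => (0 : Fin b)) = 0 := by
    simp [Real.ofDigits, Real.ofDigitsTerm]
  rw [h0, mul_zero, add_zero, Finset.sum_range]
  conv_rhs => rw [gridPoint]
  refine Finset.sum_congr rfl fun i _ => ?_
  rw [Real.ofDigitsTerm, hval]
  simp [div_eq_mul_inv]

theorem sum_digitVector {m : ℕ} {M : Type*} [AddCommMonoid M] (F : (Fin m → ZMod b) → M) :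
    ∑ h : Fin (b ^ m), F (digitVector b m (h : ℕ)) = ∑ η, F η := by
  refine Fintype.sum_bijective (fun h : Fin (b ^ m) => digitVector b m (h : ℕ)) ?_ _ _
    fun _ => rfl
  rw [Fintype.bijective_iff_injective_and_card]
  exact ⟨digitVector_injective m, by simp [ZMod.card]⟩

/-! ### Characters of the group of digit vectors -/

theorem map_stdAddChar_sum {ι : Type*} (t : Finset ι) (f : ι → ZMod b) :
    (ZMod.stdAddChar (∑ i ∈ t, f i) : ℂ) = ∏ i ∈ t, ZMod.stdAddChar (f i) := by
  classical
  induction t using Finset.induction_on with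
  | empty => simp
  | insert a t ha ih => rw [Finset.sum_insert ha, Finset.prod_insert ha, AddChar.map_add_eq_mul, ih]

/-- The character of the group of digit vectors with frequency `k`. -/
noncomputable def walsh (k x : Fin n → ZMod b) : ℂ := ZMod.stdAddChar (k ⬝ᵥ x)

theorem norm_walsh (k x : Fin n → ZMod b) : ‖walsh k x‖ = 1 := by
  rw [walsh]
  exact AddChar.norm_apply _ _

theorem walsh_add_right (k x y : Fin n → ZMod b) : walsh k (x + y) = walsh k x * walsh k y := by
  rw [walsh, dotProduct_add, AddChar.map_add_eq_mul]
  rfl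

theorem sum_walsh (w : Fin n → ZMod b) : ∑ x, walsh w x = if w = 0 then (b : ℂ) ^ n else 0 := by
  have h1 : ∀ x, walsh w x = ∏ i, ZMod.stdAddChar (w i * x i) := fun x => by
    rw [walsh, dotProduct, map_stdAddChar_sum]
  simp only [h1]
  rw [← Fintype.prod_sum (fun i x => (ZMod.stdAddChar (w i * x) : ℂ))]
  have h2 : ∀ i, ∑ x : ZMod b, (ZMod.stdAddChar (w i * x) : ℂ) = if w i = 0 then (b : ℂ) else 0 := by
    intro i
    have := AddChar.sum_mulShift (w i) (ZMod.isPrimitive_stdAddChar b)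
    simp only [mul_comm (w i)]
    rw [this, ZMod.card]
    split_ifs <;> simp
  simp only [h2]
  split_ifs with hw
  · simp [hw]
  · obtain ⟨i, hi⟩ := Function.ne_iff.1 hw
    exact Finset.prod_eq_zero (Finset.mem_univ i) (if_neg (by simpa using hi))

theorem walsh_comm (k x : Fin n → ZMod b) : walsh k x = walsh x k := by
  rw [walsh, walsh, dotProduct_comm]

/-- The double Walsh coefficient of `K` over the grid of resolution `b^{-n}`. -/
noncomputable def walshCoeff (K : ℝ → ℝ → ℝ) (k : Fin n → ZMod b) : ℂ :=
  (((b : ℂ) ^ n)⁻¹) ^ 2 * ∑ x, ∑ y, (K (gridPoint x) (gridPoint y) : ℂ) * walsh (-k) x * walsh k y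

/-- The average of the kernel `K` over the digital shifts on the grid of resolution `b^{-n}`. -/
noncomputable def shiftAverage (K : ℝ → ℝ → ℝ) (z : Fin n → ZMod b) : ℝ :=
  ((b : ℝ) ^ n)⁻¹ * ∑ τ : Fin n → ZMod b, K (gridPoint (z + τ)) (gridPoint τ)

/-- Summing the three characters over all `k` detects `x = z + y`. Thus averaging over shifts
retains only the diagonal of the double Walsh expansion. -/
theorem shiftAverage_eq_sum (K : ℝ → ℝ → ℝ) (z : Fin n → ZMod b) :
    (shiftAverage K z : ℂ) = ∑ k, walshCoeff K k * walsh k z := by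
  have hb0 : (b : ℂ) ^ n ≠ 0 := pow_ne_zero _ (by exact_mod_cast hb.out.ne_zero)
  have h1 : ∀ x y : Fin n → ZMod b, ∑ k, walsh (-k) x * walsh k y * walsh k z
      = if x = z + y then (b : ℂ) ^ n else 0 := fun x y => by
    have h2 : ∀ k, walsh (-k) x * walsh k y * walsh k z = walsh (z + y - x) k := fun k => by
      rw [walsh_comm _ k]
      simp only [walsh, ← AddChar.map_add_eq_mul]
      congr 1
      simp only [neg_dotProduct, dotProduct_sub, dotProduct_add]
      ring
    simp only [h2, sum_walsh]
    refine if_congr ?_ rfl rfl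
    rw [sub_eq_zero, eq_comm]
  calc (shiftAverage K z : ℂ)
      = ((b : ℂ) ^ n)⁻¹ * ∑ y : Fin n → ZMod b, (K (gridPoint (z + y)) (gridPoint y) : ℂ) := by
        simp [shiftAverage]
    _ = (((b : ℂ) ^ n)⁻¹) ^ 2 * ∑ x, ∑ y : Fin n → ZMod b,
          (K (gridPoint x) (gridPoint y) : ℂ) * if x = z + y then (b : ℂ) ^ n else 0 := by
        rw [Finset.sum_comm]
        simp only [mul_ite, mul_zero, Finset.sum_ite_eq', Finset.mem_univ, if_true,
          ← Finset.sum_mul]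
        field_simp
    _ = _ := by
        simp only [← h1, walshCoeff, Finset.mul_sum, Finset.sum_mul]
        conv_rhs => rw [Finset.sum_comm]
        refine Finset.sum_congr rfl fun x _ => ?_
        conv_rhs => rw [Finset.sum_comm]
        refine Finset.sum_congr rfl fun y _ => Finset.sum_congr rfl fun k _ => ?_
        ring

/-- This is Poisson summation: along the net a product of characters is the single character of `η`
with frequency `∑ j, k j ᵥ* C j`, and its mean over `η` is one or zero. -/
theorem sum_prod_eq_sum_dual {m : ℕ} {ι : Type*} [Fintype ι] [DecidableEq ι]
    (C : ι → Matrix (Fin n) (Fin m) (ZMod b)) (K : ℝ → ℝ → ℝ) :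
    ((((b : ℝ) ^ m)⁻¹ * ∑ η, ∏ j, shiftAverage K (C j *ᵥ η) : ℝ) : ℂ)
      = ∑ k : ι → Fin n → ZMod b with ∑ j, k j ᵥ* C j = 0, ∏ j, walshCoeff K (k j) := by
  have hb0 : (b : ℂ) ^ m ≠ 0 := pow_ne_zero _ (by exact_mod_cast hb.out.ne_zero)
  have h1 : ∀ η, ∏ j, (shiftAverage K (C j *ᵥ η) : ℂ)
      = ∑ k : ι → Fin n → ZMod b, (∏ j, walshCoeff K (k j)) * walsh (∑ j, k j ᵥ* C j) η := by
    intro η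
    simp only [shiftAverage_eq_sum]
    rw [Fintype.prod_sum]
    refine Finset.sum_congr rfl fun k _ => ?_
    rw [Finset.prod_mul_distrib]
    congr 1
    rw [walsh, sum_dotProduct, map_stdAddChar_sum]
    refine Finset.prod_congr rfl fun j _ => ?_
    rw [walsh, dotProduct_mulVec]
  push_cast
  simp only [h1]
  rw [Finset.sum_comm]
  simp only [← Finset.mul_sum, sum_walsh]
  rw [Finset.sum_filter, Finset.mul_sum]
  refine Finset.sum_congr rfl fun k _ => ?_
  split_ifs
  · field_simp
  · simp

/-! ### Averaging over the digital shifts on the grid -/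

/-- The point of the unit cube with given digit vectors. -/
noncomputable def gridShift {s : ℕ} (τ : Fin s → Fin n → ZMod b) : UnitCube s :=
  ⟨fun j => gridPoint (τ j), Set.mem_univ_pi.2 fun j => gridPoint_mem_Ico (τ j)⟩

theorem digitalShift_gridShift {s m : ℕ} (C : Fin s → Matrix (Fin n) (Fin m) (ZMod b))
    (τ : Fin s → Fin n → ZMod b) (h : Fin (b ^ m)) (j : Fin s) :
    (digitalShift (digitalNet C) (digitalNet_finite C) (gridShift τ) h).1 j
      = gridPoint (C j *ᵥ digitVector b m h + τ j) := by
  rw [← digitAdd_gridPoint]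
  rfl

/-- The coordinates of a uniform shift are independent, and translating by `y j` leaves only the
difference `x j - y j`. -/
theorem sum_shift_prod {s : ℕ} (u : Finset (Fin s)) (K : ℝ → ℝ → ℝ) (x y : Fin s → Fin n → ZMod b) :
    ((((b : ℝ) ^ n) ^ s)⁻¹) * ∑ τ : Fin s → Fin n → ZMod b,
      ∏ j ∈ u, K (gridPoint (x j + τ j)) (gridPoint (y j + τ j))
      = ∏ j ∈ u, shiftAverage K (x j - y j) := by
  have hb0 : (b : ℝ) ^ n ≠ 0 := pow_ne_zero _ (by exact_mod_cast hb.out.ne_zero)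
  have h1 : ∀ τ : Fin s → Fin n → ZMod b,
      ∏ j ∈ u, K (gridPoint (x j + τ j)) (gridPoint (y j + τ j))
      = ∏ j, if j ∈ u then K (gridPoint (x j + τ j)) (gridPoint (y j + τ j)) else 1 := fun τ => by
    rw [Finset.prod_ite_mem, Finset.univ_inter]
  have h2 : ∏ j ∈ u, shiftAverage K (x j - y j)
      = ∏ j, if j ∈ u then shiftAverage K (x j - y j) else 1 := by
    rw [Finset.prod_ite_mem, Finset.univ_inter]
  have h3 : (((b : ℝ) ^ n) ^ s)⁻¹ = ∏ _j : Fin s, ((b : ℝ) ^ n)⁻¹ := by simp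
  simp only [h1]
  rw [h2, h3, ← Fintype.prod_sum (fun j (τ : Fin n → ZMod b) =>
    if j ∈ u then K (gridPoint (x j + τ)) (gridPoint (y j + τ)) else 1),
    ← Finset.prod_mul_distrib]
  refine Finset.prod_congr rfl fun j _ => ?_
  split_ifs
  · rw [shiftAverage]
    congr 1
    refine Fintype.sum_equiv (Equiv.addLeft (y j)) _ _ fun τ => ?_
    simp only [Equiv.coe_addLeft]
    congr 2
    abel
  · simp [ZMod.card, hb0]

/-- The mean of the left side over all grid shifts is at most the right side, so some grid shift
does no worse than the mean. -/
theorem exists_shift_error_le {s m : ℕ} (α : ℕ) (C : Fin s → Matrix (Fin n) (Fin m) (ZMod b))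
    (γ : Finset (Fin s) → ℝ≥0) : ∃ σ : UnitCube s,
      ((Fintype.card (Fin (b ^ m)) : ℝ)⁻¹) ^ 2 * ∑ h, ∑ g, sobolevKernel α γ
        (digitalShift (digitalNet C) (digitalNet_finite C) σ h)
        (digitalShift (digitalNet C) (digitalNet_finite C) σ g) - γ ∅
      ≤ ∑ u : Finset (Fin s) with u.Nonempty, (γ u : ℝ) *
        ∑ k : u → Fin n → ZMod b with ∑ j : u, k j ᵥ* C j = 0,
          ∏ j, ‖walshCoeff (sobolevKernelOne α) (k j)‖ := by
  have hb0 : (b : ℝ) ^ m ≠ 0 := pow_ne_zero _ (by exact_mod_cast hb.out.ne_zero)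
  have hbs : ((b : ℝ) ^ n) ^ s ≠ 0 :=
    pow_ne_zero _ (pow_ne_zero _ (by exact_mod_cast hb.out.ne_zero))
  set K := sobolevKernelOne α
  set E : (Fin s → Fin n → ZMod b) → ℝ := fun τ =>
    ((Fintype.card (Fin (b ^ m)) : ℝ)⁻¹) ^ 2 * ∑ h, ∑ g, sobolevKernel α γ
        (digitalShift (digitalNet C) (digitalNet_finite C) (gridShift τ) h)
        (digitalShift (digitalNet C) (digitalNet_finite C) (gridShift τ) g) - γ ∅ with hE
  set B := ∑ u : Finset (Fin s) with u.Nonempty, (γ u : ℝ) *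
        ∑ k : u → Fin n → ZMod b with ∑ j : u, k j ᵥ* C j = 0, ∏ j, ‖walshCoeff K (k j)‖ with hB
  -- The generating matrices act linearly, so the double sum depends only on `η - θ` and collapses
  -- to a single sum.
  have hnet : ∀ u : Finset (Fin s), (((b : ℝ) ^ m)⁻¹) ^ 2 *
      ∑ η : Fin m → ZMod b, ∑ θ : Fin m → ZMod b, ∏ j ∈ u, shiftAverage K (C j *ᵥ η - C j *ᵥ θ)
      = ((b : ℝ) ^ m)⁻¹ * ∑ η, ∏ j : u, shiftAverage K (C j *ᵥ η) := fun u => by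
    have h1 : ∀ θ : Fin m → ZMod b, ∑ η : Fin m → ZMod b,
        ∏ j ∈ u, shiftAverage K (C j *ᵥ η - C j *ᵥ θ)
        = ∑ η, ∏ j : u, shiftAverage K (C j *ᵥ η) := fun θ => by
      refine Fintype.sum_equiv (Equiv.subRight θ) _ _ fun η => ?_
      rw [← Finset.prod_coe_sort u]
      simp only [Equiv.subRight_apply, mulVec_sub]
    rw [Finset.sum_comm]
    simp only [h1, Finset.sum_const, Finset.card_univ, Fintype.card_pi, ZMod.card,
      Finset.prod_const, Fintype.card_fin, nsmul_eq_mul]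
    push_cast
    field_simp
  have havg : (((b : ℝ) ^ n) ^ s)⁻¹ * ∑ τ, E τ
      = ∑ u : Finset (Fin s) with u.Nonempty, (γ u : ℝ) *
        (((b : ℝ) ^ m)⁻¹ * ∑ η, ∏ j : u, shiftAverage K (C j *ᵥ η)) := by
    have h1 : ∀ τ, E τ = ∑ u : Finset (Fin s), (γ u : ℝ) * ((((b : ℝ) ^ m)⁻¹) ^ 2 *
        ∑ η : Fin m → ZMod b, ∑ θ : Fin m → ZMod b,
          ∏ j ∈ u, K (gridPoint (C j *ᵥ η + τ j)) (gridPoint (C j *ᵥ θ + τ j))) - γ ∅ := by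
      intro τ
      simp only [hE, sobolevKernel, digitalShift_gridShift, Fintype.card_fin]
      congr 1
      push_cast
      have h2 : ∀ h : Fin (b ^ m), ∑ g : Fin (b ^ m), ∑ u : Finset (Fin s), (γ u : ℝ) *
          ∏ j ∈ u, sobolevKernelOne α (gridPoint (C j *ᵥ digitVector b m h + τ j))
            (gridPoint (C j *ᵥ digitVector b m g + τ j))
          = ∑ θ, ∑ u : Finset (Fin s), (γ u : ℝ) *
          ∏ j ∈ u, sobolevKernelOne α (gridPoint (C j *ᵥ digitVector b m h + τ j))
            (gridPoint (C j *ᵥ θ + τ j)) := fun h =>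
        sum_digitVector fun θ => ∑ u : Finset (Fin s), (γ u : ℝ) *
          ∏ j ∈ u, sobolevKernelOne α (gridPoint (C j *ᵥ digitVector b m h + τ j))
            (gridPoint (C j *ᵥ θ + τ j))
      simp only [h2]
      rw [sum_digitVector fun η => ∑ θ, ∑ u : Finset (Fin s), (γ u : ℝ) *
          ∏ j ∈ u, sobolevKernelOne α (gridPoint (C j *ᵥ η + τ j)) (gridPoint (C j *ᵥ θ + τ j))]
      have h3 : ∀ η : Fin m → ZMod b, ∑ θ : Fin m → ZMod b, ∑ u : Finset (Fin s), (γ u : ℝ) *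
          ∏ j ∈ u, sobolevKernelOne α (gridPoint (C j *ᵥ η + τ j)) (gridPoint (C j *ᵥ θ + τ j))
          = ∑ u : Finset (Fin s), ∑ θ : Fin m → ZMod b, (γ u : ℝ) *
          ∏ j ∈ u, sobolevKernelOne α (gridPoint (C j *ᵥ η + τ j)) (gridPoint (C j *ᵥ θ + τ j)) :=
        fun η => Finset.sum_comm
      simp only [h3]
      rw [Finset.sum_comm, Finset.mul_sum]
      refine Finset.sum_congr rfl fun u _ => ?_
      simp only [← Finset.mul_sum]
      ring
    have h4 : ∀ u : Finset (Fin s), (((b : ℝ) ^ n) ^ s)⁻¹ * ∑ τ : Fin s → Fin n → ZMod b,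
        (γ u : ℝ) * ((((b : ℝ) ^ m)⁻¹) ^ 2 *
        ∑ η : Fin m → ZMod b, ∑ θ : Fin m → ZMod b,
          ∏ j ∈ u, K (gridPoint (C j *ᵥ η + τ j)) (gridPoint (C j *ᵥ θ + τ j)))
        = (γ u : ℝ) * (((b : ℝ) ^ m)⁻¹ * ∑ η, ∏ j : u, shiftAverage K (C j *ᵥ η)) := fun u => by
      rw [← hnet u]
      simp only [← sum_shift_prod, ← Finset.mul_sum]
      rw [Finset.sum_comm]
      have h5 : ∀ η : Fin m → ZMod b, ∑ τ : Fin s → Fin n → ZMod b, ∑ θ : Fin m → ZMod b,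
          ∏ j ∈ u, K (gridPoint (C j *ᵥ η + τ j)) (gridPoint (C j *ᵥ θ + τ j))
          = ∑ θ : Fin m → ZMod b, ∑ τ : Fin s → Fin n → ZMod b,
          ∏ j ∈ u, K (gridPoint (C j *ᵥ η + τ j)) (gridPoint (C j *ᵥ θ + τ j)) :=
        fun η => Finset.sum_comm
      simp only [h5]
      ring
    simp only [h1, Finset.sum_sub_distrib, mul_sub]
    rw [Finset.sum_comm, Finset.mul_sum]
    simp only [h4]
    -- The term `u = ∅` contributes exactly `γ ∅`, which cancels the subtracted constant.
    have h6 : (Finset.univ : Finset (Finset (Fin s))).filter (fun u => u.Nonempty)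
        = Finset.univ.erase ∅ := by
      ext u
      simp [Finset.nonempty_iff_ne_empty]
    rw [h6, Finset.sum_erase_eq_sub (Finset.mem_univ _)]
    congr 1
    simp only [Finset.sum_const, Finset.card_univ, Fintype.card_pi, ZMod.card,
      Finset.prod_const, Fintype.card_fin, nsmul_eq_mul, Finset.univ_eq_empty, Finset.prod_empty]
    push_cast
    field_simp
  have hle : (((b : ℝ) ^ n) ^ s)⁻¹ * ∑ τ, E τ ≤ B := by
    rw [havg]
    refine Finset.sum_le_sum fun u _ => mul_le_mul_of_nonneg_left ?_ (γ u).2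
    refine (le_abs_self _).trans ?_
    rw [← Real.norm_eq_abs, ← Complex.norm_real, sum_prod_eq_sum_dual (fun j : u => C j) K]
    refine (norm_sum_le _ _).trans (Finset.sum_le_sum fun k _ => ?_)
    rw [norm_prod]
  have : ∃ τ ∈ (Finset.univ : Finset (Fin s → Fin n → ZMod b)), E τ ≤ B := by
    refine Finset.exists_le_of_sum_le Finset.univ_nonempty ?_
    rw [Finset.sum_const, Finset.card_univ]
    simp only [Fintype.card_pi, ZMod.card, Finset.prod_const, Finset.card_univ, Fintype.card_fin,
      nsmul_eq_mul]
    push_cast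
    have hpos : 0 < ((b : ℝ) ^ n) ^ s := lt_of_le_of_ne (by positivity) hbs.symm
    rwa [inv_mul_le_iff₀ hpos] at hle
  obtain ⟨τ, -, hτ⟩ := this
  exact ⟨gridShift τ, hτ⟩

end Grid

/-! ### Weighted difference operators -/

section DiffOp

variable {b : ℕ}

/-- The weighted average `b⁻¹ ∑_ξ c(ξ) f(t + ξ h)` over the digits `ξ`, for `d = (c, h)`. -/
noncomputable def diffOp [NeZero b] (d : (ZMod b → ℂ) × ℝ) (f : ℝ → ℂ) (t : ℝ) : ℂ :=
  (b : ℂ)⁻¹ * ∑ ξ, d.1 ξ * f (t + ξ.val * d.2)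

/-- The composition of the operators `diffOp d` over a list. -/
noncomputable def diffOps [NeZero b] (L : List ((ZMod b → ℂ) × ℝ)) (f : ℝ → ℂ) : ℝ → ℂ :=
  L.foldr diffOp f

/-- The weights have mean zero and are bounded by one, so that `diffOp d` is a first difference. -/
def IsDifference [NeZero b] (d : (ZMod b → ℂ) × ℝ) : Prop :=
  ∑ ξ, d.1 ξ = 0 ∧ ∀ ξ, ‖d.1 ξ‖ ≤ 1

variable [NeZero b]

theorem diffOps_cons (d : (ZMod b → ℂ) × ℝ) (L : List ((ZMod b → ℂ) × ℝ)) (f : ℝ → ℂ) :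
    diffOps (d :: L) f = diffOp d (diffOps L f) := rfl

theorem diffOps_append (L L' : List ((ZMod b → ℂ) × ℝ)) (f : ℝ → ℂ) :
    diffOps (L ++ L') f = diffOps L (diffOps L' f) := by
  simp [diffOps]

theorem diffOp_comm (d d' : (ZMod b → ℂ) × ℝ) (f : ℝ → ℂ) :
    diffOp d (diffOp d' f) = diffOp d' (diffOp d f) := by
  funext t
  simp only [diffOp, Finset.mul_sum]
  rw [Finset.sum_comm]
  refine Finset.sum_congr rfl fun ξ _ => Finset.sum_congr rfl fun η _ => ?_
  rw [add_right_comm]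
  ring

theorem diffOps_perm {L L' : List ((ZMod b → ℂ) × ℝ)} (h : L.Perm L') (f : ℝ → ℂ) :
    diffOps L f = diffOps L' f := by
  induction h with
  | nil => rfl
  | cons d _ ih => rw [diffOps_cons, diffOps_cons, ih]
  | swap d d' L => simp only [diffOps_cons, diffOp_comm]
  | trans _ _ h1 h2 => rw [h1, h2]

theorem diffOps_comp_sub (L : List ((ZMod b → ℂ) × ℝ)) (f : ℝ → ℂ) (a : ℝ) :
    diffOps L (fun t => f (t - a)) = fun t => diffOps L f (t - a) := by
  induction L with
  | nil => rfl
  | cons d L ih =>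
    funext t
    rw [diffOps_cons, diffOps_cons, ih, diffOp, diffOp]
    congr 1
    refine Finset.sum_congr rfl fun ξ _ => ?_
    simp only [add_sub_right_comm]

theorem diffOps_comp_const_sub (L : List ((ZMod b → ℂ) × ℝ)) (f : ℝ → ℂ) (a : ℝ) :
    diffOps L (fun t => f (a - t))
      = fun t => diffOps (L.map fun d => (d.1, -d.2)) f (a - t) := by
  induction L with
  | nil => rfl
  | cons d L ih =>
    funext t
    rw [diffOps_cons, List.map_cons, diffOps_cons, ih, diffOp, diffOp]
    congr 1
    refine Finset.sum_congr rfl fun ξ _ => ?_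
    simp only [sub_add_eq_sub_sub, mul_neg, ← sub_eq_add_neg]

theorem hasDerivAt_diffOps (L : List ((ZMod b → ℂ) × ℝ)) {f f' : ℝ → ℂ}
    (h : ∀ t, HasDerivAt f (f' t) t) (t : ℝ) :
    HasDerivAt (diffOps L f) (diffOps L f' t) t := by
  induction L generalizing t with
  | nil => exact h t
  | cons d L ih =>
    refine HasDerivAt.const_mul _ (HasDerivAt.fun_sum fun ξ _ => ?_)
    exact ((ih (t + ξ.val * d.2)).comp_add_const t (ξ.val * d.2)).const_mul _

/-- Since the weights have mean zero, `f t` may be subtracted from every value of `f`. -/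
theorem norm_diffOp_le {d : (ZMod b → ℂ) × ℝ} (hd : IsDifference d) {f : ℝ → ℂ} {t M : ℝ}
    (h : ∀ ξ : ZMod b, ‖f (t + ξ.val * d.2) - f t‖ ≤ M) : ‖diffOp d f t‖ ≤ M := by
  have hb0 : (b : ℂ) ≠ 0 := by exact_mod_cast NeZero.ne b
  have h1 : diffOp d f t = (b : ℂ)⁻¹ * ∑ ξ, d.1 ξ * (f (t + ξ.val * d.2) - f t) := by
    simp only [mul_sub, Finset.sum_sub_distrib, ← Finset.sum_mul, hd.1, zero_mul, sub_zero]
    rfl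
  rw [h1, norm_mul, norm_inv, Complex.norm_natCast,
    inv_mul_le_iff₀ (by exact_mod_cast NeZero.pos b)]
  refine (norm_sum_le _ _).trans ((Finset.sum_le_card_nsmul _ _ M fun ξ _ => ?_).trans ?_)
  · rw [norm_mul]
    exact (mul_le_of_le_one_left (norm_nonneg _) (hd.2 ξ)).trans (h ξ)
  · simp [ZMod.card]

theorem norm_diffOp_le_of_norm_le {d : (ZMod b → ℂ) × ℝ} (hd : IsDifference d) {f : ℝ → ℂ}
    {t M : ℝ} (h : ∀ ξ : ZMod b, ‖f (t + ξ.val * d.2)‖ ≤ M) : ‖diffOp d f t‖ ≤ M := by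
  rw [diffOp, norm_mul, norm_inv, Complex.norm_natCast,
    inv_mul_le_iff₀ (by exact_mod_cast NeZero.pos b)]
  refine (norm_sum_le _ _).trans ((Finset.sum_le_card_nsmul _ _ M fun ξ _ => ?_).trans ?_)
  · rw [norm_mul]
    exact (mul_le_of_le_one_left (norm_nonneg _) (hd.2 ξ)).trans (h ξ)
  · simp [ZMod.card]

theorem val_mul_abs_le (ξ : ZMod b) (h : ℝ) : |(ξ.val : ℝ) * h| ≤ b * |h| := by
  rw [abs_mul, Nat.abs_cast]
  exact mul_le_mul_of_nonneg_right (by exact_mod_cast (ZMod.val_lt ξ).le) (abs_nonneg h)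

/-- A composition of `w` differences is bounded by the product of the step sizes and a bound for
the `w`-th derivative. -/
theorem norm_diffOps_le (L : List ((ZMod b → ℂ) × ℝ)) (hL : ∀ d ∈ L, IsDifference d)
    (F : ℕ → ℝ → ℂ) (hF : ∀ j < L.length, ∀ t, HasDerivAt (F j) (F (j + 1) t) t) {t M : ℝ}
    (hM : ∀ r, |r - t| ≤ (L.map fun d => (b : ℝ) * |d.2|).sum → ‖F L.length r‖ ≤ M) :
    ‖diffOps L (F 0) t‖ ≤ (L.map fun d => (b : ℝ) * |d.2|).prod * M := by
  induction L generalizing F t with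
  | nil => simpa [diffOps] using hM t (by simp)
  | cons d L ih =>
    have h0 : 0 ≤ (L.map fun d => (b : ℝ) * |d.2|).prod * M := by
      refine mul_nonneg (List.prod_nonneg ?_) ((norm_nonneg _).trans (hM t ?_))
      · simp only [List.mem_map]
        rintro _ ⟨d, _, rfl⟩
        positivity
      · rw [sub_self, abs_zero]
        refine List.sum_nonneg ?_
        simp only [List.mem_map]
        rintro _ ⟨d, _, rfl⟩
        positivity
    have hder : ∀ r, |r - t| ≤ b * |d.2| →
        ‖diffOps L (F 1) r‖ ≤ (L.map fun d => (b : ℝ) * |d.2|).prod * M := fun r hr => by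
      refine ih (fun d hd => hL d (List.mem_cons_of_mem _ hd)) (fun j => F (j + 1))
        (fun j hj => hF (j + 1) (by simpa using hj)) fun r' hr' => hM r' ?_
      rw [List.map_cons, List.sum_cons]
      calc |r' - t| = |(r' - r) + (r - t)| := by ring_nf
        _ ≤ |r' - r| + |r - t| := abs_add_le _ _
        _ ≤ _ := by linarith
    rw [diffOps_cons, List.map_cons, List.prod_cons]
    refine norm_diffOp_le (hL d List.mem_cons_self) fun ξ => ?_
    have hconv : Convex ℝ (Set.Icc (t - b * |d.2|) (t + b * |d.2|)) := convex_Icc _ _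
    have hx : t ∈ Set.Icc (t - b * |d.2|) (t + b * |d.2|) := by
      have : 0 ≤ (b : ℝ) * |d.2| := by positivity
      constructor <;> linarith
    have hξ := abs_le.1 (val_mul_abs_le ξ d.2)
    have hy : t + ξ.val * d.2 ∈ Set.Icc (t - b * |d.2|) (t + b * |d.2|) := by
      constructor <;> linarith [hξ.1, hξ.2]
    -- The mean value inequality trades the outermost difference for one derivative and one factor
    -- of the step. Derivatives commute with the remaining differences, so the induction hypothesis
    -- bounds this derivative.
    have := hconv.norm_image_sub_le_of_norm_hasDerivWithin_le
      (fun r _ => (hasDerivAt_diffOps L (hF 0 (by simp)) r).hasDerivWithinAt)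
      (fun r hr => hder r (abs_le.2 ⟨by linarith [hr.1], by linarith [hr.2]⟩)) hx hy
    refine this.trans ?_
    rw [add_sub_cancel_left, Real.norm_eq_abs, mul_comm, mul_assoc]
    rw [mul_comm] at h0
    calc _ ≤ b * |d.2| * (M * (L.map fun d => (b : ℝ) * |d.2|).prod) := by
          rw [mul_comm _ M]
          exact mul_le_mul_of_nonneg_right (val_mul_abs_le ξ d.2) h0
      _ = _ := by ring

end DiffOp

/-! ### Sums against characters as sums of differences -/

section Transfer

variable {b n : ℕ} [hb : Fact b.Prime]

/-- The weight `b^{-(i+1)}` of the digit at position `i`. -/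
noncomputable def digitStep (b : ℕ) {n : ℕ} (i : Fin n) : ℝ := ((b : ℝ) ^ ((i : ℕ) + 1))⁻¹

/-- The digit vector `x` with the digits at the positions in `T` replaced by zero. -/
def clearDigits (T : List (Fin n)) (x : Fin n → ZMod b) : Fin n → ZMod b :=
  fun i => if i ∈ T then 0 else x i

/-- The difference operator in the digit `i` belonging to the frequency `k`. -/
noncomputable def walshDiff (k : Fin n → ZMod b) (i : Fin n) : (ZMod b → ℂ) × ℝ :=
  (fun ξ => ZMod.stdAddChar (k i * ξ), digitStep b i)

theorem digitStep_pos (i : Fin n) : 0 < digitStep b i := by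
  have : (0 : ℝ) < b := by exact_mod_cast hb.out.pos
  unfold digitStep
  positivity

theorem digitStep_le_one (i : Fin n) : digitStep b i ≤ 1 :=
  inv_le_one_of_one_le₀ (one_le_pow₀ (by exact_mod_cast hb.out.one_lt.le))

theorem isDifference_walshDiff {k : Fin n → ZMod b} {i : Fin n} (hi : k i ≠ 0) :
    IsDifference (walshDiff k i) := by
  refine ⟨?_, fun ξ => (AddChar.norm_apply _ _).le⟩
  have := AddChar.sum_mulShift (k i) (ZMod.isPrimitive_stdAddChar b)
  simpa [walshDiff, mul_comm (k i), hi] using this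

theorem clearDigits_nil (x : Fin n → ZMod b) : clearDigits [] x = x := by
  funext i
  simp [clearDigits]

/-- A zero digit at `i` excludes reduction modulo `b`, so the point moves by precisely `ξ.val`
steps. This is why digits are cleared before differencing. -/
theorem gridPoint_add_single {x : Fin n → ZMod b} {i : Fin n} (hx : x i = 0) (ξ : ZMod b) :
    gridPoint (x + Pi.single i ξ) = gridPoint x + ξ.val * digitStep b i := by
  have h : ∀ l : Fin n, (((x + Pi.single i ξ : Fin n → ZMod b) l).val : ℝ) / (b : ℝ) ^ ((l : ℕ) + 1)
      = ((x l).val : ℝ) / (b : ℝ) ^ ((l : ℕ) + 1)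
        + if l = i then ξ.val * digitStep b i else 0 := fun l => by
    by_cases hl : l = i
    · subst hl
      simp [hx, digitStep, div_eq_mul_inv]
    · simp [hl]
  simp only [gridPoint, h, Finset.sum_add_distrib, Finset.sum_ite_eq', Finset.mem_univ, if_true]

theorem walsh_single (k : Fin n → ZMod b) (i : Fin n) (ξ : ZMod b) :
    walsh k (Pi.single i ξ) = ZMod.stdAddChar (k i * ξ) := by
  rw [walsh, dotProduct_single]

theorem sum_eq_sum_update (F : (Fin n → ZMod b) → ℂ) (i : Fin n) :
    ∑ x, F x = ∑ x, (b : ℂ)⁻¹ * ∑ ξ, F (Function.update x i ξ) := by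
  have hb0 : (b : ℂ) ≠ 0 := by exact_mod_cast hb.out.ne_zero
  have h1 : ∀ x : Fin n → ZMod b, ∑ ξ, F (Function.update x i ξ)
      = ∑ ξ, F (x + Pi.single i ξ) := fun x => by
    refine (Fintype.sum_equiv (Equiv.addLeft (x i)) _ _ fun ξ => ?_).symm
    congr 1
    funext l
    by_cases hl : l = i
    · subst hl
      simp
    · simp [hl]
  have h2 : ∀ ξ : ZMod b, ∑ x, F (x + Pi.single i ξ) = ∑ x, F x := fun ξ =>
    Fintype.sum_equiv (Equiv.addRight (Pi.single i ξ)) _ _ fun x => rfl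
  simp only [h1]
  rw [← Finset.mul_sum, Finset.sum_comm]
  simp only [h2, Finset.sum_const, Finset.card_univ, ZMod.card, nsmul_eq_mul]
  field_simp

/-- Averaging over the digit at `i` first splits off the factor `stdAddChar (k i * ξ)`, which is the
weight of a difference operator in that digit. Repeating this over `T` composes the operators. -/
theorem sum_walsh_eq_sum_diffOps (k : Fin n → ZMod b) {T : List (Fin n)} (hT : T.Nodup)
    (f : ℝ → ℂ) :
    ∑ x, f (gridPoint x) * walsh k x = ∑ x, diffOps (T.map (walshDiff k)) f
      (gridPoint (clearDigits T x)) * walsh k (clearDigits T x) := by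
  induction T with
  | nil => simp [diffOps, clearDigits_nil]
  | cons i T ih =>
    obtain ⟨hi, hT⟩ := List.nodup_cons.1 hT
    rw [ih hT, sum_eq_sum_update _ i]
    refine Finset.sum_congr rfl fun x _ => ?_
    have h1 : ∀ ξ, clearDigits T (Function.update x i ξ)
        = clearDigits (i :: T) x + Pi.single i ξ := fun ξ => by
      funext l
      by_cases hl : l = i
      · subst hl
        simp [clearDigits, hi]
      · simp [clearDigits, hl]
    have h2 : clearDigits (i :: T) x i = 0 := by simp [clearDigits]
    rw [List.map_cons, diffOps_cons, diffOp, mul_assoc, Finset.sum_mul]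
    congr 1
    refine Finset.sum_congr rfl fun ξ _ => ?_
    rw [h1, gridPoint_add_single h2, walsh_add_right, walsh_single]
    simp only [walshDiff]
    ring

theorem norm_sum_walsh_le (k : Fin n → ZMod b) {T : List (Fin n)} (hT : T.Nodup) (f : ℝ → ℂ) :
    ‖∑ x, f (gridPoint x) * walsh k x‖ ≤ ∑ x : Fin n → ZMod b,
      ‖diffOps (T.map (walshDiff k)) f (gridPoint (clearDigits T x))‖ := by
  rw [sum_walsh_eq_sum_diffOps k hT f]
  refine (norm_sum_le _ _).trans (Finset.sum_le_sum fun x _ => ?_)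
  rw [norm_mul, norm_walsh, mul_one]

/-- The difference operators in both variables of a kernel `g(x - y)`. -/
noncomputable def walshDiffs (k : Fin n → ZMod b) (T : List (Fin n)) : List ((ZMod b → ℂ) × ℝ) :=
  T.flatMap fun i => [((walshDiff k i).1, -digitStep b i), walshDiff (-k) i]

/-- The digit transfer is applied in `x` and then in `y`. The variable `y` enters `g` with a minus
sign, hence the negated steps, and commutativity merges the operators into one list with two
differences per digit. -/
theorem norm_sum_sum_walsh_le (k : Fin n → ZMod b) {T : List (Fin n)} (hT : T.Nodup) (g : ℝ → ℂ) :
    ‖∑ x, ∑ y, g (gridPoint x - gridPoint y) * walsh (-k) x * walsh k y‖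
      ≤ ∑ x : Fin n → ZMod b, ∑ y : Fin n → ZMod b, ‖diffOps (walshDiffs k T) g
          (gridPoint (clearDigits T x) - gridPoint (clearDigits T y))‖ := by
  have hperm : (walshDiffs k T).Perm
      ((T.map (walshDiff k)).map (fun d => (d.1, -d.2)) ++ T.map (walshDiff (-k))) := by
    rw [walshDiffs, List.map_map]
    clear hT
    induction T with
    | nil => simp
    | cons i T ih =>
      rw [List.flatMap_cons, List.map_cons, List.map_cons]
      refine (List.Perm.cons _ ((List.Perm.cons _ ih).trans ?_))
      exact List.perm_middle.symm
  have h1 : ∀ y : Fin n → ZMod b,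
      ∑ x, g (gridPoint x - gridPoint y) * walsh (-k) x * walsh k y
      = ∑ x, diffOps (T.map (walshDiff (-k))) g (gridPoint (clearDigits T x) - gridPoint y)
        * walsh (-k) (clearDigits T x) * walsh k y := fun y => by
    rw [← Finset.sum_mul, ← Finset.sum_mul,
      sum_walsh_eq_sum_diffOps (-k) hT (fun t => g (t - gridPoint y)), diffOps_comp_sub]
  have h2 : ∀ x : Fin n → ZMod b, ∑ y,
      diffOps (T.map (walshDiff (-k))) g (gridPoint (clearDigits T x) - gridPoint y)
        * walsh (-k) (clearDigits T x) * walsh k y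
      = (∑ y, diffOps (T.map (walshDiff (-k))) g (gridPoint (clearDigits T x) - gridPoint y)
         * walsh k y) * walsh (-k) (clearDigits T x) := fun x => by
    rw [Finset.sum_mul]
    exact Finset.sum_congr rfl fun y _ => by ring
  rw [Finset.sum_comm]
  simp only [h1]
  rw [Finset.sum_comm]
  simp only [h2]
  refine (norm_sum_le _ _).trans (Finset.sum_le_sum fun x _ => ?_)
  rw [norm_mul, norm_walsh, mul_one]
  refine (norm_sum_walsh_le k hT (fun t => diffOps (T.map (walshDiff (-k))) g
    (gridPoint (clearDigits T x) - t))).trans (Finset.sum_le_sum fun y _ => ?_)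
  rw [diffOps_comp_const_sub, diffOps_perm hperm, diffOps_append]

/-! ### Counting close pairs of grid points -/

theorem gridPoint_injective : Function.Injective (gridPoint : (Fin n → ZMod b) → ℝ) := by
  intro x y hxy
  funext i
  have h1 := digits_gridPoint n x i
  rw [hxy, digits_gridPoint n y i] at h1
  simp only [Fin.is_lt, dite_true] at h1
  exact (ZMod.val_injective b h1).symm

/-- After multiplication by `b^n` the grid points are distinct integers, to be counted in an
interval of length `2 R b^n`. -/
theorem card_gridPoint_le (y : ℝ) {R : ℝ} (hR : 0 ≤ R) :
    ((Finset.univ.filter fun x : Fin n → ZMod b => |gridPoint x - y| ≤ R).card : ℝ)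
      ≤ 2 * R * (b : ℝ) ^ n + 1 := by
  have hpos : (0 : ℝ) < (b : ℝ) ^ n := pow_pos (by exact_mod_cast hb.out.pos) n
  choose κ hκ using fun x : Fin n → ZMod b => sum_digit_finite n x
  have hκ' : ∀ x, gridPoint x * (b : ℝ) ^ n = κ x := fun x => by
    rw [gridPoint, (hκ x).2]
    field_simp
  have hle : (Finset.univ.filter fun x : Fin n → ZMod b => |gridPoint x - y| ≤ R).card
      ≤ (Finset.Icc ⌈(y - R) * (b : ℝ) ^ n⌉ ⌊(y + R) * (b : ℝ) ^ n⌋).card := by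
    refine Finset.card_le_card_of_injOn (fun x => (κ x : ℤ)) ?_ ?_
    · intro x hx
      have hx' := abs_le.1 (Finset.mem_filter.1 hx).2
      rw [Finset.mem_coe, Finset.mem_Icc, Int.ceil_le, Int.le_floor]
      push_cast
      rw [← hκ' x]
      constructor <;> refine mul_le_mul_of_nonneg_right ?_ hpos.le <;> linarith [hx'.1, hx'.2]
    · intro x _ x' _ h
      have h' : (κ x : ℝ) = κ x' := by
        dsimp only at h
        exact_mod_cast h
      rw [← hκ', ← hκ'] at h'
      exact gridPoint_injective (mul_right_cancel₀ hpos.ne' h')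
  refine (Nat.cast_le.2 hle).trans ?_
  rw [Int.card_Icc]
  have h1 := Int.floor_le ((y + R) * (b : ℝ) ^ n)
  have h2 := Int.le_ceil ((y - R) * (b : ℝ) ^ n)
  have h3 : (((⌊(y + R) * (b : ℝ) ^ n⌋ + 1 - ⌈(y - R) * (b : ℝ) ^ n⌉).toNat : ℤ) : ℝ)
      ≤ max ((⌊(y + R) * (b : ℝ) ^ n⌋ : ℝ) + 1 - ⌈(y - R) * (b : ℝ) ^ n⌉) 0 := by
    rw [Int.toNat_eq_max]
    push_cast
    rfl
  refine h3.trans (max_le ?_ (by positivity))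
  nlinarith

/-- Differences are evaluated at cleared points, whereas close pairs are counted among all grid
points. This bounds the discrepancy between the two. -/
theorem abs_gridPoint_sub_clearDigits_le {T : List (Fin n)} {h : ℝ}
    (hT : ∀ i ∈ T, digitStep b i ≤ h) (hT' : T.Nodup) (x : Fin n → ZMod b) :
    |gridPoint x - gridPoint (clearDigits T x)| ≤ T.length * (b * h) := by
  have h1 : gridPoint x - gridPoint (clearDigits T x)
      = ∑ i ∈ T.toFinset, ((x i).val : ℝ) * digitStep b i := by
    rw [gridPoint, gridPoint, ← Finset.sum_sub_distrib, ← Finset.sum_filter_add_sum_filter_not _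
      (fun i => i ∈ T.toFinset), Finset.filter_mem_eq_inter, Finset.univ_inter]
    have h2 : ∀ i ∈ Finset.univ.filter (fun i => ¬ i ∈ T.toFinset),
        ((x i).val : ℝ) / (b : ℝ) ^ ((i : ℕ) + 1)
          - ((clearDigits T x i).val : ℝ) / (b : ℝ) ^ ((i : ℕ) + 1) = 0 := fun i hi => by
      have : i ∉ T := by simpa using hi
      simp [clearDigits, this]
    rw [Finset.sum_eq_zero h2, add_zero]
    refine Finset.sum_congr rfl fun i hi => ?_
    have : i ∈ T := by simpa using hi
    simp [clearDigits, this, digitStep, div_eq_mul_inv]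
  rw [h1]
  refine (Finset.abs_sum_le_sum_abs _ _).trans ((Finset.sum_le_card_nsmul _ _ (b * h)
    fun i hi => ?_).trans ?_)
  · refine (val_mul_abs_le _ _).trans ?_
    rw [abs_of_pos (digitStep_pos i)]
    exact mul_le_mul_of_nonneg_left (hT i (by simpa using hi)) (Nat.cast_nonneg b)
  · rw [List.toFinset_card_of_nodup hT', nsmul_eq_mul]

end Transfer

/-! ### Coefficients of polynomials -/

section Coefficients

open Polynomial

variable {b : ℕ} [hb : Fact b.Prime]

theorem prod_map_walshDiff {n : ℕ} (k : Fin n → ZMod b) (T : List (Fin n)) :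
    ((T.map (walshDiff k)).map fun d => (b : ℝ) * |d.2|).prod
      = (b : ℝ) ^ T.length * (T.map (digitStep b)).prod := by
  induction T with
  | nil => simp
  | cons i T ih =>
    simp only [List.map_cons, List.prod_cons, List.length_cons, ih]
    simp only [walshDiff, abs_of_pos (digitStep_pos i)]
    ring

theorem sum_map_walshDiff_le {n : ℕ} (k : Fin n → ZMod b) (T : List (Fin n)) :
    ((T.map (walshDiff k)).map fun d => (b : ℝ) * |d.2|).sum ≤ T.length * b := by
  induction T with
  | nil => simp
  | cons i T ih =>
    simp only [List.map_cons, List.sum_cons, List.length_cons]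
    have h1 : (b : ℝ) * |(walshDiff k i).2| ≤ b := by
      simp only [walshDiff, abs_of_pos (digitStep_pos i)]
      exact mul_le_of_le_one_right (Nat.cast_nonneg b) (digitStep_le_one i)
    push_cast
    linarith

theorem prod_map_walshDiffs {n : ℕ} (k : Fin n → ZMod b) (T : List (Fin n)) :
    ((walshDiffs k T).map fun d => (b : ℝ) * |d.2|).prod
      = (b : ℝ) ^ (2 * T.length) * (T.map (digitStep b)).prod ^ 2 := by
  induction T with
  | nil => simp [walshDiffs]
  | cons i T ih =>
    rw [walshDiffs] at ih ⊢
    rw [List.flatMap_cons, List.map_append, List.prod_append, ih]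
    simp only [List.map_cons, List.map_nil, List.prod_cons, List.prod_nil, List.length_cons,
      walshDiff, abs_neg, abs_of_pos (digitStep_pos i)]
    ring

theorem sum_map_walshDiffs_le {n : ℕ} (k : Fin n → ZMod b) (T : List (Fin n)) {h : ℝ}
    (hT : ∀ i ∈ T, digitStep b i ≤ h) :
    ((walshDiffs k T).map fun d => (b : ℝ) * |d.2|).sum ≤ 2 * T.length * (b * h) := by
  induction T with
  | nil => simp [walshDiffs]
  | cons i T ih =>
    have h1 := ih fun i hi => hT i (List.mem_cons_of_mem _ hi)
    have h2 : (b : ℝ) * digitStep b i ≤ b * h :=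
      mul_le_mul_of_nonneg_left (hT i List.mem_cons_self) (Nat.cast_nonneg b)
    rw [walshDiffs] at h1 ⊢
    rw [List.flatMap_cons, List.map_append, List.sum_append]
    simp only [List.map_cons, List.map_nil, List.sum_cons, List.sum_nil, List.length_cons,
      walshDiff, abs_neg, abs_of_pos (digitStep_pos i)] at h1 ⊢
    push_cast
    linarith

theorem length_walshDiffs {n : ℕ} (k : Fin n → ZMod b) (T : List (Fin n)) :
    (walshDiffs k T).length = 2 * T.length := by
  induction T with
  | nil => rfl
  | cons i T ih =>
    rw [walshDiffs] at ih ⊢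
    rw [List.flatMap_cons, List.length_append, ih]
    simp
    ring

theorem isDifference_of_mem_walshDiffs {n : ℕ} {k : Fin n → ZMod b} {T : List (Fin n)}
    (hT : ∀ i ∈ T, k i ≠ 0) : ∀ d ∈ walshDiffs k T, IsDifference d := by
  intro d hd
  rw [walshDiffs, List.mem_flatMap] at hd
  obtain ⟨i, hi, hd⟩ := hd
  have h1 := isDifference_walshDiff (hT i hi)
  have h2 : IsDifference (walshDiff (-k) i) := isDifference_walshDiff (by simpa using hT i hi)
  rcases List.mem_cons.1 hd with rfl | hd
  · exact ⟨h1.1, h1.2⟩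
  · rw [List.mem_singleton.1 hd]
    exact h2

theorem exists_abs_eval_le (p : ℝ[X]) (R : ℝ) : ∃ M : ℝ, 0 ≤ M ∧ ∀ t, |t| ≤ R → |p.eval t| ≤ M := by
  obtain ⟨M, hM⟩ := (isCompact_Icc (a := -R) (b := R)).exists_bound_of_continuousOn
    p.continuous.continuousOn
  refine ⟨max M 0, le_max_right _ _, fun t ht => (hM t (abs_le.1 ht)).trans (le_max_left _ _)⟩

theorem sum_le_of_card_le {ι : Type*} (s : Finset ι) (c : ℝ) (hc : (s.card : ℝ) ≤ c)
    (f : ι → ℝ) {M : ℝ} (hM : 0 ≤ M) (hf : ∀ i ∈ s, f i ≤ M) : ∑ i ∈ s, f i ≤ c * M := by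
  refine (Finset.sum_le_card_nsmul _ _ M hf).trans ?_
  rw [nsmul_eq_mul]
  exact mul_le_mul_of_nonneg_right hc hM

theorem abs_gridPoint_le_one {n : ℕ} (x : Fin n → ZMod b) : |gridPoint x| ≤ 1 := by
  have := gridPoint_mem_Ico x
  exact abs_le.2 ⟨by linarith [this.1], this.2.le⟩

/-- Each digit in `T` costs one derivative of `p` and gains one factor `digitStep`. Summing the
constants over all lengths up to `w` makes the bound uniform in `T`. -/
theorem exists_polynomial_coeff_le (p : ℝ[X]) (w : ℕ) : ∃ C : ℝ, 0 ≤ C ∧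
    ∀ (n : ℕ) (k : Fin n → ZMod b) (T : List (Fin n)), T.Nodup → (∀ i ∈ T, k i ≠ 0) →
      T.length ≤ w →
      ‖((b : ℂ) ^ n)⁻¹ * ∑ x, ((p.eval (gridPoint x) : ℝ) : ℂ) * walsh k x‖
        ≤ C * (T.map (digitStep b)).prod := by
  -- A grid point lies in `[0, 1)`, and `v` differences move it by at most `v * b`.
  choose M hM0 hM using fun v : ℕ => exists_abs_eval_le (derivative^[v] p) (1 + v * b)
  refine ⟨∑ v ∈ Finset.range (w + 1), (b : ℝ) ^ v * M v,
    Finset.sum_nonneg fun v _ => mul_nonneg (by positivity) (hM0 v), ?_⟩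
  intro n k T hT hk hw
  have hpos : (0 : ℝ) < (b : ℝ) ^ n := pow_pos (by exact_mod_cast hb.out.pos) n
  have hprod : 0 ≤ (T.map (digitStep b)).prod := List.prod_nonneg fun a ha => by
    obtain ⟨i, -, rfl⟩ := List.mem_map.1 ha
    exact (digitStep_pos i).le
  have hbound : ∀ x : Fin n → ZMod b,
      ‖diffOps (T.map (walshDiff k)) (fun t => ((p.eval t : ℝ) : ℂ)) (gridPoint (clearDigits T x))‖
      ≤ (b : ℝ) ^ T.length * (T.map (digitStep b)).prod * M T.length := fun x => by
    rw [← prod_map_walshDiff k T]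
    refine norm_diffOps_le _ ?_ (fun j t => (((derivative^[j] p).eval t : ℝ) : ℂ)) ?_ fun r hr => ?_
    · intro d hd
      obtain ⟨i, hi, rfl⟩ := List.mem_map.1 hd
      exact isDifference_walshDiff (hk i hi)
    · intro j _ t
      rw [Function.iterate_succ_apply']
      exact (Polynomial.hasDerivAt _ t).ofReal_comp
    · rw [Complex.norm_real, List.length_map]
      refine hM _ r ?_
      have h1 := hr.trans (sum_map_walshDiff_le k T)
      have h2 := abs_gridPoint_le_one (clearDigits T x)
      calc |r| = |(r - gridPoint (clearDigits T x)) + gridPoint (clearDigits T x)| := by ring_nf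
        _ ≤ _ := abs_add_le _ _
        _ ≤ _ := by linarith
  have hMle : (b : ℝ) ^ T.length * M T.length ≤ ∑ v ∈ Finset.range (w + 1), (b : ℝ) ^ v * M v :=
    Finset.single_le_sum (f := fun v => (b : ℝ) ^ v * M v)
      (fun v _ => mul_nonneg (by positivity) (hM0 v)) (Finset.mem_range.2 (by omega))
  rw [norm_mul, norm_inv, norm_pow, Complex.norm_natCast, inv_mul_le_iff₀ hpos]
  refine (norm_sum_walsh_le k hT (fun t => ((p.eval t : ℝ) : ℂ))).trans
    (sum_le_of_card_le _ _ ?_ _ (mul_nonneg ?_ hprod) fun x _ => (hbound x).trans ?_)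
  · simp [ZMod.card]
  · exact Finset.sum_nonneg fun v _ => mul_nonneg (by positivity) (hM0 v)
  · calc _ = (b : ℝ) ^ T.length * M T.length * (T.map (digitStep b)).prod := by ring
      _ ≤ _ := mul_le_mul_of_nonneg_right hMle hprod

/-! ### Coefficients of even extensions -/

/-- The `j`-th derivative of `t ↦ p(|t|)`, where it exists. -/
noncomputable def evenExtension (p : ℝ[X]) (j : ℕ) (t : ℝ) : ℝ :=
  if 0 ≤ t then (derivative^[j] p).eval t else (-1) ^ j * (derivative^[j] p).eval (-t)

theorem evenExtension_of_even (p : ℝ[X]) {j : ℕ} (hj : Even j) (t : ℝ) :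
    evenExtension p j t = (derivative^[j] p).eval |t| := by
  unfold evenExtension
  split_ifs with h
  · rw [abs_of_nonneg h]
  · rw [abs_of_neg (not_le.1 h), hj.neg_one_pow, one_mul]

/-- The branches at zero agree automatically in even order. In odd order they differ by a sign, so
they agree when that derivative of `p` vanishes at zero. -/
theorem hasDerivAt_evenExtension (p : ℝ[X]) {j : ℕ}
    (hj : Odd j → (derivative^[j] p).eval 0 = 0)
    (hj1 : Odd (j + 1) → (derivative^[j + 1] p).eval 0 = 0) (t : ℝ) :
    HasDerivAt (evenExtension p j) (evenExtension p (j + 1) t) t := by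
  have hr : ∀ t, HasDerivAt (fun t => (derivative^[j] p).eval t) ((derivative^[j + 1] p).eval t) t :=
    fun t => by
      rw [Function.iterate_succ_apply']
      exact Polynomial.hasDerivAt _ t
  have hl : ∀ t, HasDerivAt (fun t => (-1) ^ j * (derivative^[j] p).eval (-t))
      ((-1) ^ (j + 1) * (derivative^[j + 1] p).eval (-t)) t := fun t => by
    have := ((hr (-t)).comp t (hasDerivAt_neg t)).const_mul ((-1 : ℝ) ^ j)
    exact this.congr_deriv (by ring)
  have h0 : ∀ i, (Odd i → (derivative^[i] p).eval 0 = 0) →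
      (-1) ^ i * (derivative^[i] p).eval 0 = (derivative^[i] p).eval 0 := fun i hi => by
    rcases Nat.even_or_odd i with h | h
    · rw [h.neg_one_pow, one_mul]
    · rw [hi h, mul_zero]
  rcases lt_trichotomy t 0 with ht | rfl | ht
  · have h1 : evenExtension p (j + 1) t = (-1) ^ (j + 1) * (derivative^[j + 1] p).eval (-t) :=
      if_neg (not_le.2 ht)
    rw [h1]
    refine (hl t).congr_of_eventuallyEq ?_
    filter_upwards [Iio_mem_nhds ht] with r hr
    exact if_neg (not_le.2 hr)
  · have h1 : evenExtension p (j + 1) 0 = (derivative^[j + 1] p).eval 0 := if_pos le_rfl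
    have h2 : evenExtension p j 0 = (derivative^[j] p).eval 0 := if_pos le_rfl
    rw [h1, ← hasDerivWithinAt_univ, ← Set.Iic_union_Ici (a := (0 : ℝ))]
    refine HasDerivWithinAt.union ?_ ?_
    · have := (hl 0).hasDerivWithinAt (s := Set.Iic 0)
      rw [neg_zero, h0 _ hj1] at this
      refine this.congr (fun r hr => ?_) ?_
      · rcases eq_or_lt_of_le (Set.mem_Iic.1 hr) with rfl | hr'
        · rw [h2, neg_zero, h0 _ hj]
        · exact if_neg (not_le.2 hr')
      · rw [h2, neg_zero, h0 _ hj]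
    · exact (hr 0).hasDerivWithinAt.congr (fun r hr => if_pos hr) h2
  · have h1 : evenExtension p (j + 1) t = (derivative^[j + 1] p).eval t := if_pos ht.le
    rw [h1]
    refine (hr t).congr_of_eventuallyEq ?_
    filter_upwards [Ioi_mem_nhds ht] with r hr
    exact if_pos (le_of_lt hr)

/-- Two differences of step `h` of a function `c (t² - |t| + 1/6)` are `O(h²)` away from the kink
and `O(h)` near it. -/
theorem exists_norm_diffOps_kink_le (q : ℝ → ℝ) (c : ℝ)
    (hq : ∀ t, q t = c * (t ^ 2 - |t| + 6⁻¹)) :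
    ∃ C : ℝ, 0 ≤ C ∧ ∀ (h : ℝ) (d d' : (ZMod b → ℂ) × ℝ), 0 < h → h ≤ 1 → IsDifference d →
      IsDifference d' → |d.2| = h → |d'.2| = h → ∀ r,
      ‖diffOps [d, d'] (fun t => (q t : ℂ)) r‖ ≤ C * (h ^ 2 + if |r| ≤ 2 * b * h then h else 0) := by
  have hb0 : (0 : ℝ) < b := by exact_mod_cast hb.out.pos
  refine ⟨|c| * (2 * b ^ 2) + |c| * ((7 * b + 1) * b), by positivity, ?_⟩
  intro h d d' hh hh1 hd hd' hdh hdh' r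
  have hstep : ∀ ξ : ZMod b, |(ξ.val : ℝ) * d.2| ≤ b * h := fun ξ => hdh ▸ val_mul_abs_le ξ d.2
  have hstep' : ∀ ξ : ZMod b, |(ξ.val : ℝ) * d'.2| ≤ b * h :=
    fun ξ => hdh' ▸ val_mul_abs_le ξ d'.2
  split_ifs with hr
  · have h1 : ‖diffOps [d, d'] (fun t => (q t : ℂ)) r‖ ≤ |c| * ((7 * b + 1) * b) * h := by
      -- Near the kink one difference is merely averaged away, and the other gains a factor `h` from
      -- the Lipschitz continuity of `q`.
      refine norm_diffOp_le_of_norm_le hd fun ξ => norm_diffOp_le hd' fun η => ?_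
      have e1 := hstep ξ
      have e2 := hstep' η
      set a := r + (ξ.val : ℝ) * d.2 with ha
      set e := (η.val : ℝ) * d'.2 with he
      have ha' : |a| ≤ 3 * (b * h) := (abs_add_le _ _).trans (by linarith)
      change ‖((q (a + e) : ℝ) : ℂ) - (q a : ℂ)‖ ≤ _
      rw [← Complex.ofReal_sub, Complex.norm_real, hq, hq, ← mul_sub, Real.norm_eq_abs, abs_mul,
        mul_assoc]
      refine mul_le_mul_of_nonneg_left ?_ (abs_nonneg c)
      have h3 : (a + e) ^ 2 - |a + e| + 6⁻¹ - (a ^ 2 - |a| + 6⁻¹)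
          = e * (2 * a + e) + (|a| - |a + e|) := by ring
      have h4 : |(|a| - |a + e|)| ≤ |e| := by
        refine (abs_abs_sub_abs_le_abs_sub _ _).trans ?_
        rw [sub_add_cancel_left, abs_neg]
      have h5 : |2 * a + e| ≤ 7 * b := by
        have : |2 * a + e| ≤ 2 * |a| + |e| := by
          refine (abs_add_le _ _).trans ?_
          rw [abs_mul, abs_two]
        nlinarith
      rw [h3]
      refine (abs_add_le _ _).trans ?_
      rw [abs_mul]
      have h6 : |e| * |2 * a + e| ≤ (b * h) * (7 * b) :=
        mul_le_mul e2 h5 (abs_nonneg _) (by positivity)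
      nlinarith
    refine h1.trans ?_
    have : 0 ≤ |c| * (2 * (b : ℝ) ^ 2) * (h ^ 2 + h) := by positivity
    have h2 : 0 ≤ |c| * ((7 * (b : ℝ) + 1) * b) * h ^ 2 := by positivity
    nlinarith
  · have hr' : 2 * b * h < |r| := not_le.1 hr
    -- Away from the kink no evaluation point crosses zero, since two differences reach at most `2 *
    -- b * h`. There `q` coincides with a quadratic polynomial whose second derivative is `2 * c`.
    have key : ∀ ε : ℝ, (∀ t, |t - r| ≤ 2 * b * h → |t| = ε * t) →
        ‖diffOps [d, d'] (fun t => (q t : ℂ)) r‖ ≤ |c| * (2 * b ^ 2) * h ^ 2 := by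
      intro ε hε
      let p : ℝ[X] := C c * (X ^ 2 - C ε * X + C 6⁻¹)
      have hcongr : diffOps [d, d'] (fun t => (q t : ℂ)) r
          = diffOps [d, d'] (fun t => ((p.eval t : ℝ) : ℂ)) r := by
        simp only [diffOps_cons, diffOp]
        congr 1
        refine Finset.sum_congr rfl fun ξ _ => ?_
        congr 2
        refine Finset.sum_congr rfl fun η _ => ?_
        congr 1
        simp only [diffOps, List.foldr_nil]
        rw [hq, hε]
        · simp [p]
        · have : r + (ξ.val : ℝ) * d.2 + η.val * d'.2 - r = ξ.val * d.2 + η.val * d'.2 := by ring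
          rw [this]
          exact (abs_add_le _ _).trans (by linarith [hstep ξ, hstep' η])
      rw [hcongr]
      have := norm_diffOps_le [d, d'] (by simp [hd, hd'])
        (fun j t => (((derivative^[j] p).eval t : ℝ) : ℂ)) (t := r) (M := |c| * 2) (fun j _ t => by
          rw [Function.iterate_succ_apply']
          exact (Polynomial.hasDerivAt _ t).ofReal_comp) (fun t _ => by
          have h2 : derivative^[2] p = C (c * 2) := by
            simp only [p, Function.iterate_succ, Function.iterate_zero, Function.comp_apply]
            simp [derivative_mul, one_add_one_eq_two, map_ofNat]
          rw [List.length_cons, List.length_cons, List.length_nil, zero_add, one_add_one_eq_two, h2,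
            Complex.norm_real]
          simp)
      refine this.trans (le_of_eq ?_)
      simp only [List.map_cons, List.map_nil, List.prod_cons, List.prod_nil, hdh, hdh']
      ring
    have hfin : ‖diffOps [d, d'] (fun t => (q t : ℂ)) r‖ ≤ |c| * (2 * b ^ 2) * h ^ 2 := by
      rcases le_total 0 r with hr0 | hr0
      · rw [abs_of_nonneg hr0] at hr'
        refine key 1 fun t ht => ?_
        rw [one_mul, abs_of_nonneg (by linarith [(abs_le.1 ht).1])]
      · rw [abs_of_nonpos hr0] at hr'
        refine key (-1) fun t ht => ?_
        rw [abs_of_nonpos (by linarith [(abs_le.1 ht).2])]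
        ring
    refine hfin.trans ?_
    have h2 : 0 ≤ |c| * ((7 * (b : ℝ) + 1) * b) * h ^ 2 := by positivity
    nlinarith

end Coefficients

/-! ### Decay of the Walsh coefficients of the Sobolev kernel -/

section KernelCoefficients

open Polynomial

variable {b : ℕ} [hb : Fact b.Prime]

theorem prod_digitStep_nonneg {n : ℕ} (T : List (Fin n)) : 0 ≤ (T.map (digitStep b)).prod :=
  List.prod_nonneg fun a ha => by
    obtain ⟨i, -, rfl⟩ := List.mem_map.1 ha
    exact (digitStep_pos i).le

/-- Fewer differences than the smoothness of `p(|·|)` allows. -/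
theorem exists_evenExtension_coeff_le (p : ℝ[X]) (w : ℕ)
    (hp : ∀ j < 2 * w, Odd j → (derivative^[j] p).eval 0 = 0) : ∃ C : ℝ, 0 ≤ C ∧
    ∀ (n : ℕ) (k : Fin n → ZMod b) (T : List (Fin n)), T.Nodup → (∀ i ∈ T, k i ≠ 0) →
      T.length = w →
      ‖∑ x, ∑ y, ((evenExtension p 0 (gridPoint x - gridPoint y) : ℝ) : ℂ) * walsh (-k) x
        * walsh k y‖ ≤ ((b : ℝ) ^ n) ^ 2 * (C * (T.map (digitStep b)).prod ^ 2) := by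
  obtain ⟨M, hM0, hM⟩ := exists_abs_eval_le (derivative^[2 * w] p) (2 + 2 * w * b)
  refine ⟨(b : ℝ) ^ (2 * w) * M, by positivity, ?_⟩
  intro n k T hT hk hw
  have hprod := prod_digitStep_nonneg (b := b) T
  have hbound : ∀ x y : Fin n → ZMod b, ‖diffOps (walshDiffs k T)
      (fun t => ((evenExtension p 0 t : ℝ) : ℂ))
        (gridPoint (clearDigits T x) - gridPoint (clearDigits T y))‖
      ≤ (b : ℝ) ^ (2 * w) * M * (T.map (digitStep b)).prod ^ 2 := fun x y => by
    have := norm_diffOps_le (walshDiffs k T) (isDifference_of_mem_walshDiffs hk)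
      (fun j t => ((evenExtension p j t : ℝ) : ℂ)) (M := M)
      (t := gridPoint (clearDigits T x) - gridPoint (clearDigits T y)) (fun j hj t => by
        rw [length_walshDiffs, hw] at hj
        refine (hasDerivAt_evenExtension p (hp j hj) (fun hj1 => hp (j + 1) ?_ hj1) t).ofReal_comp
        obtain ⟨a, ha⟩ := hj1
        omega) (fun r hr => by
        rw [Complex.norm_real, length_walshDiffs, hw,
          evenExtension_of_even p (even_two_mul w)]
        refine hM _ ?_
        rw [abs_abs]
        have h1 := hr.trans (sum_map_walshDiffs_le k T fun i _ => digitStep_le_one i)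
        have h2 := gridPoint_mem_Ico (clearDigits T x)
        have h3 := gridPoint_mem_Ico (clearDigits T y)
        rw [hw, mul_one] at h1
        have h4 := abs_le.1 h1
        refine abs_le.2 ⟨?_, ?_⟩ <;> linarith [h2.1, h2.2, h3.1, h3.2, h4.1, h4.2])
    rw [prod_map_walshDiffs, hw] at this
    refine this.trans (le_of_eq (by ring))
  refine (norm_sum_sum_walsh_le k hT (fun t => ((evenExtension p 0 t : ℝ) : ℂ))).trans ?_
  refine (Finset.sum_le_sum fun x _ => Finset.sum_le_sum fun y _ => hbound x y).trans ?_
  simp only [Finset.sum_const, Finset.card_univ, Fintype.card_pi, ZMod.card, Finset.prod_const,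
    Fintype.card_fin, nsmul_eq_mul]
  push_cast
  exact le_of_eq (by ring)

/-- As many differences as the smoothness of `p(|·|)` allows, where the derivative that they lead
to has a kink. -/
theorem exists_evenExtension_coeff_le_kink (p : ℝ[X]) (w : ℕ) (c : ℝ)
    (hp : ∀ j < 2 * w, Odd j → (derivative^[j] p).eval 0 = 0)
    (hpw : ∀ t, (derivative^[2 * w] p).eval t = c * (t ^ 2 - t + 6⁻¹)) : ∃ C : ℝ, 0 ≤ C ∧
    ∀ (n : ℕ) (k : Fin n → ZMod b) (i : Fin n) (T : List (Fin n)), (i :: T).Nodup →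
      (∀ l ∈ i :: T, k l ≠ 0) → (∀ l ∈ T, digitStep b l ≤ digitStep b i) → T.length = w →
      ‖∑ x, ∑ y, ((evenExtension p 0 (gridPoint x - gridPoint y) : ℝ) : ℂ) * walsh (-k) x
        * walsh k y‖ ≤ ((b : ℝ) ^ n) ^ 2 * (C * ((i :: T).map (digitStep b)).prod ^ 2) := by
  have hb0 : (0 : ℝ) < b := by exact_mod_cast hb.out.pos
  obtain ⟨D, hD0, hD⟩ := exists_norm_diffOps_kink_le (b := b) (evenExtension p (2 * w)) c fun t => by
    rw [evenExtension_of_even p (even_two_mul w), hpw, sq_abs]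
  -- `A * h` is the kink zone `2 * b * h` enlarged by the reach of the other `2 * w` differences.
  -- `A'` adds the effect of clearing `w + 1` digits in each of the two points.
  set A : ℝ := 2 * b + 2 * w * b with hA
  set A' : ℝ := A + 2 * ((w + 1 : ℕ) * b) with hA'
  have hA0 : 0 ≤ A := by positivity
  have hA'0 : 0 ≤ A' := by positivity
  refine ⟨(b : ℝ) ^ (2 * w) * D * (1 + (2 * A' + 1)), by positivity, ?_⟩
  intro n k i T hT hk hi hw
  have hpos : (0 : ℝ) < (b : ℝ) ^ n := pow_pos hb0 n
  set h := digitStep b i with hh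
  have hh0 : 0 < h := digitStep_pos i
  have hh1 : h ≤ 1 := digitStep_le_one i
  -- The step is at least the mesh, so the additive one in the count of close points is absorbed
  -- into a multiple of `h * b ^ n`.
  have hhn : 1 ≤ h * (b : ℝ) ^ n := by
    rw [hh, digitStep, ← div_eq_inv_mul, one_le_div (by positivity)]
    exact pow_le_pow_right₀ (by exact_mod_cast hb.out.one_lt.le) i.2
  set π := (T.map (digitStep b)).prod with hπ
  have hπ0 : 0 ≤ π := prod_digitStep_nonneg T
  set g : ℝ → ℂ := fun t => ((evenExtension p 0 t : ℝ) : ℂ) with hg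
  set d : (ZMod b → ℂ) × ℝ := ((walshDiff k i).1, -digitStep b i) with hd
  set d' : (ZMod b → ℂ) × ℝ := walshDiff (-k) i with hd'
  have hall : ∀ l ∈ i :: T, digitStep b l ≤ h := fun l hl => by
    rcases List.mem_cons.1 hl with rfl | hl
    · exact le_rfl
    · exact hi l hl
  have hdiff : ∀ t, ‖diffOps (walshDiffs k (i :: T)) g t‖
      ≤ (b : ℝ) ^ (2 * w) * π ^ 2 * (D * (h ^ 2 + if |t| ≤ A * h then h else 0)) := fun t => by
    have hperm : (walshDiffs k (i :: T)).Perm (walshDiffs k T ++ [d, d']) := by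
      rw [walshDiffs, List.flatMap_cons]
      exact List.perm_append_comm
    rw [diffOps_perm hperm, diffOps_append]
    have hdd : IsDifference d ∧ IsDifference d' :=
      ⟨isDifference_of_mem_walshDiffs hk d (by simp [walshDiffs, hd]),
        isDifference_of_mem_walshDiffs hk d' (by simp [walshDiffs, hd'])⟩
    -- The `2 * w` differences from `T` are spent on derivatives. The two from `i` stay in front and
    -- finally act on the derivative that has the kink.
    have := norm_diffOps_le (walshDiffs k T)
      (isDifference_of_mem_walshDiffs fun l hl => hk l (List.mem_cons_of_mem _ hl))
      (fun j => diffOps [d, d'] fun t => ((evenExtension p j t : ℝ) : ℂ))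
      (M := D * (h ^ 2 + if |t| ≤ A * h then h else 0)) (t := t) (fun j hj t => by
        rw [length_walshDiffs, hw] at hj
        refine hasDerivAt_diffOps _ (fun t => ?_) t
        refine (hasDerivAt_evenExtension p (hp j hj) (fun hj1 => hp (j + 1) ?_ hj1) t).ofReal_comp
        obtain ⟨a, ha⟩ := hj1
        omega) (fun r hr => by
        rw [length_walshDiffs, hw]
        refine (hD h d d' hh0 hh1 hdd.1 hdd.2 (by simp [hd, abs_of_pos hh0, ← hh])
          (by simp [hd', walshDiff, abs_of_pos hh0, ← hh]) r).trans ?_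
        refine mul_le_mul_of_nonneg_left (add_le_add_right ?_ _) hD0
        by_cases h1 : |r| ≤ 2 * b * h
        · have h2 := hr.trans (sum_map_walshDiffs_le k T hi)
          rw [hw, abs_sub_comm] at h2
          have h3 : |t| ≤ A * h := by
            calc |t| = |(t - r) + r| := by ring_nf
              _ ≤ _ := abs_add_le _ _
              _ ≤ 2 * w * (b * h) + 2 * b * h := add_le_add h2 h1
              _ = A * h := by rw [hA]; ring
          rw [if_pos h1, if_pos h3]
        · rw [if_neg h1]
          split_ifs
          · exact hh0.le
          · exact le_rfl)
    rw [prod_map_walshDiffs, hw] at this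
    exact this
  have hclose : ∀ x y : Fin n → ZMod b,
      |gridPoint (clearDigits (i :: T) x) - gridPoint (clearDigits (i :: T) y)| ≤ A * h →
      |gridPoint x - gridPoint y| ≤ A' * h := fun x y hxy => by
    have h1 := abs_le.1 (abs_gridPoint_sub_clearDigits_le hall hT x)
    have h2 := abs_le.1 (abs_gridPoint_sub_clearDigits_le hall hT y)
    have h3 := abs_le.1 hxy
    rw [List.length_cons, hw] at h1 h2
    have h4 : A' * h = A * h + 2 * ((w + 1 : ℕ) * (b * h)) := by
      rw [hA']
      ring
    rw [h4]
    refine abs_le.2 ⟨?_, ?_⟩ <;> linarith [h1.1, h1.2, h2.1, h2.2, h3.1, h3.2]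
  -- Only a proportion `O(h)` of the points is near the kink, where the bound is `O(h)`. On average
  -- the bound is thus `O(h ^ 2)`, as it is away from the kink.
  have hcount : ∀ y : Fin n → ZMod b,
      ∑ x : Fin n → ZMod b, (if |gridPoint x - gridPoint y| ≤ A' * h then h else 0)
      ≤ (b : ℝ) ^ n * ((2 * A' + 1) * h ^ 2) := fun y => by
    rw [← Finset.sum_filter, Finset.sum_const, nsmul_eq_mul]
    have h1 := card_gridPoint_le (b := b) (n := n) (gridPoint y) (mul_nonneg hA'0 hh0.le)
    calc _ ≤ (2 * (A' * h) * (b : ℝ) ^ n + h * (b : ℝ) ^ n) * h :=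
          mul_le_mul_of_nonneg_right (h1.trans (by linarith)) hh0.le
      _ = _ := by ring
  have hpt : ∀ x y : Fin n → ZMod b, ‖diffOps (walshDiffs k (i :: T)) g
      (gridPoint (clearDigits (i :: T) x) - gridPoint (clearDigits (i :: T) y))‖
      ≤ (b : ℝ) ^ (2 * w) * π ^ 2 * (D * (h ^ 2 +
        if |gridPoint x - gridPoint y| ≤ A' * h then h else 0)) := fun x y => by
    refine (hdiff _).trans (mul_le_mul_of_nonneg_left (mul_le_mul_of_nonneg_left
      (add_le_add_right ?_ _) hD0) (by positivity))
    by_cases h1 : |gridPoint (clearDigits (i :: T) x) - gridPoint (clearDigits (i :: T) y)| ≤ A * h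
    · rw [if_pos h1, if_pos (hclose x y h1)]
    · rw [if_neg h1]
      split_ifs
      · exact hh0.le
      · exact le_rfl
  refine (norm_sum_sum_walsh_le k hT g).trans ?_
  refine (Finset.sum_le_sum fun x _ => Finset.sum_le_sum fun y _ => hpt x y).trans ?_
  rw [Finset.sum_comm]
  simp only [← Finset.mul_sum, Finset.sum_add_distrib]
  have hsum : ∑ y : Fin n → ZMod b, ∑ x : Fin n → ZMod b,
      (if |gridPoint x - gridPoint y| ≤ A' * h then h else 0)
      ≤ ((b : ℝ) ^ n) ^ 2 * ((2 * A' + 1) * h ^ 2) := by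
    refine (Finset.sum_le_sum fun y _ => hcount y).trans (le_of_eq ?_)
    simp only [Finset.sum_const, Finset.card_univ, Fintype.card_pi, ZMod.card, Finset.prod_const,
      Fintype.card_fin, nsmul_eq_mul]
    push_cast
    ring
  simp only [Finset.sum_const, Finset.card_univ, Fintype.card_pi, ZMod.card, Finset.prod_const,
    Fintype.card_fin, nsmul_eq_mul]
  push_cast
  rw [List.map_cons, List.prod_cons, ← hh, ← hπ]
  calc _ ≤ (b : ℝ) ^ (2 * w) * π ^ 2 * (D * ((b : ℝ) ^ n * ((b : ℝ) ^ n * h ^ 2)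
        + ((b : ℝ) ^ n) ^ 2 * ((2 * A' + 1) * h ^ 2))) :=
        mul_le_mul_of_nonneg_left (mul_le_mul_of_nonneg_left (by linarith) hD0) (by positivity)
    _ = _ := by ring

/-- The Bernoulli polynomial over the reals. -/
noncomputable def realBernoulli (k : ℕ) : ℝ[X] := (Polynomial.bernoulli k).map (algebraMap ℚ ℝ)

theorem realBernoulli_eval (k : ℕ) (t : ℝ) : (realBernoulli k).eval t = bernoulliFun k t := rfl

theorem iterate_derivative_realBernoulli (k j : ℕ) (hj : j ≤ k) :
    derivative^[j] (realBernoulli k) = C (k.descFactorial j : ℝ) * realBernoulli (k - j) := by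
  induction j with
  | zero => simp
  | succ j ih =>
    rw [Function.iterate_succ_apply', ih (by omega), derivative_C_mul, realBernoulli,
      derivative_map, Polynomial.derivative_bernoulli, Nat.descFactorial_succ]
    simp only [Polynomial.map_mul, Polynomial.map_natCast, realBernoulli, Nat.sub_add_eq]
    push_cast
    simp only [map_mul, map_natCast]
    ring

/-- The value is a multiple of the Bernoulli number with odd index `k - j`. The hypothesis `j + 1 <
k` excludes index one, the only odd index with a nonzero Bernoulli number. -/
theorem eval_zero_iterate_derivative_realBernoulli {k j : ℕ} (hk : Even k) (hj : Odd j)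
    (hjk : j + 1 < k) : (derivative^[j] (realBernoulli k)).eval 0 = 0 := by
  rw [iterate_derivative_realBernoulli k j (by omega), eval_mul, realBernoulli_eval,
    bernoulliFun_eval_zero, bernoulli_eq_zero_of_odd (Nat.Even.sub_odd (by omega) hk hj) (by omega)]
  simp

/-- Fewer than `α` digits need at most `2 * α - 2` derivatives of `B_{2α}(|t|)`, all of which exist.
Exactly `α` digits lead to a multiple of `B_2(|t|) = t² - |t| + 1/6`, where the kink estimate takes
over. -/
theorem exists_bernoulli_coeff_le {α : ℕ} (hα : 1 ≤ α) : ∃ C : ℝ, 0 ≤ C ∧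
    ∀ (n : ℕ) (k : Fin n → ZMod b) (T : List (Fin n)), T.Nodup → (∀ i ∈ T, k i ≠ 0) →
      T.length ≤ α →
      ‖∑ x, ∑ y, ((bernoulliFun (2 * α) |gridPoint x - gridPoint y| : ℝ) : ℂ) * walsh (-k) x
        * walsh k y‖ ≤ ((b : ℝ) ^ n) ^ 2 * (C * (T.map (digitStep b)).prod ^ 2) := by
  set p := realBernoulli (2 * α) with hp
  have hodd : ∀ w < α, ∀ j < 2 * w, Odd j → (derivative^[j] p).eval 0 = 0 := fun w hw j hj hj' =>
    eval_zero_iterate_derivative_realBernoulli (even_two_mul α) hj' (by omega)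
  have hex : ∀ w, ∃ C : ℝ, 0 ≤ C ∧ (w < α →
    ∀ (n : ℕ) (k : Fin n → ZMod b) (T : List (Fin n)), T.Nodup → (∀ i ∈ T, k i ≠ 0) →
      T.length = w →
      ‖∑ x, ∑ y, ((evenExtension p 0 (gridPoint x - gridPoint y) : ℝ) : ℂ) * walsh (-k) x
        * walsh k y‖ ≤ ((b : ℝ) ^ n) ^ 2 * (C * (T.map (digitStep b)).prod ^ 2)) := fun w => by
    by_cases hw : w < α
    · obtain ⟨C, hC0, hC⟩ := exists_evenExtension_coeff_le (b := b) p w (hodd w hw)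
      exact ⟨C, hC0, fun _ => hC⟩
    · exact ⟨0, le_rfl, fun h => absurd h hw⟩
  choose C hC0 hC using hex
  obtain ⟨D, hD0, hD⟩ := exists_evenExtension_coeff_le_kink (b := b) p (α - 1)
    ((2 * α).descFactorial (2 * (α - 1)) : ℝ) (hodd (α - 1) (by omega)) fun t => by
      rw [hp, iterate_derivative_realBernoulli _ _ (by omega), eval_mul, eval_C,
        realBernoulli_eval]
      have : 2 * α - 2 * (α - 1) = 2 := by omega
      rw [this, bernoulliFun_two]
  have hsum0 : 0 ≤ ∑ w ∈ Finset.range α, C w := Finset.sum_nonneg fun w _ => hC0 w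
  refine ⟨∑ w ∈ Finset.range α, C w + D, by positivity, ?_⟩
  intro n k T hT hk hTα
  have hrw : ∀ x y : Fin n → ZMod b, bernoulliFun (2 * α) |gridPoint x - gridPoint y|
      = evenExtension p 0 (gridPoint x - gridPoint y) := fun x y => by
    rw [evenExtension_of_even p (by simp)]
    rfl
  simp only [hrw]
  have hprod : 0 ≤ (T.map (digitStep b)).prod ^ 2 := by positivity
  rcases lt_or_eq_of_le hTα with hlt | heq
  · refine (hC T.length hlt n k T hT hk rfl).trans ?_
    have : C T.length ≤ ∑ w ∈ Finset.range α, C w :=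
      Finset.single_le_sum (fun w _ => hC0 w) (Finset.mem_range.2 hlt)
    gcongr
    linarith
  · have hne : T.toFinset.Nonempty := by
      rw [List.toFinset_nonempty_iff]
      rintro rfl
      simp at heq
      omega
    -- The smallest position has the largest step. Reserving it for the kink keeps the displacements
    -- by all other differences comparable to `h`.
    obtain ⟨i, hi, hmin⟩ := T.toFinset.exists_min_image id hne
    have hperm : T.Perm (i :: T.erase i) := List.perm_cons_erase (by simpa using hi)
    have hmem : ∀ l ∈ i :: T.erase i, l ∈ T := fun l hl => hperm.mem_iff.2 hl
    have := hD n k i (T.erase i) (hperm.nodup_iff.1 hT) (fun l hl => hk l (hmem l hl))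
      (fun l hl => ?_) (by rw [List.length_erase_of_mem (by simpa using hi), heq])
    · rw [← (hperm.map (digitStep b)).prod_eq] at this
      refine this.trans ?_
      gcongr
      linarith
    · have h1 : i ≤ l := hmin l (by simpa using hmem l (List.mem_cons_of_mem _ hl))
      refine inv_anti₀ (pow_pos (by exact_mod_cast hb.out.pos) _)
        (pow_le_pow_right₀ (by exact_mod_cast hb.out.one_lt.le) ?_)
      have : (i : ℕ) ≤ l := h1
      omega

/-- The Walsh coefficients of the kernel decay with the largest positions of nonzero digits. -/
theorem exists_walshCoeff_le (b : ℕ) [hb : Fact b.Prime] {α : ℕ} (hα : 1 ≤ α) : ∃ C : ℝ, 0 ≤ C ∧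
    ∀ (n : ℕ) (k : Fin n → ZMod b) (T : List (Fin n)), T.Nodup → (∀ i ∈ T, k i ≠ 0) →
      T.length ≤ α →
      ‖walshCoeff (sobolevKernelOne α) k‖ ≤ C * (T.map (digitStep b)).prod ^ 2 := by
  choose A hA0 hA using fun r : ℕ => exists_polynomial_coeff_le (b := b) (realBernoulli r) α
  obtain ⟨B, hB0, hB⟩ := exists_bernoulli_coeff_le (b := b) hα
  refine ⟨∑ r ∈ Finset.Icc 1 α, A r ^ 2 + B, add_nonneg (Finset.sum_nonneg fun r _ => by positivity)
    hB0, ?_⟩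
  intro n k T hT hk hTα
  have hbn : (0 : ℝ) < (b : ℝ) ^ n := pow_pos (by exact_mod_cast hb.out.pos) n
  set S : ℂ := ∑ x : Fin n → ZMod b, ∑ y : Fin n → ZMod b,
    ((bernoulliFun (2 * α) |gridPoint x - gridPoint y| : ℝ) : ℂ) * walsh (-k) x * walsh k y with hS
  let β : ℕ → (Fin n → ZMod b) → ℂ := fun r k =>
    ((b : ℂ) ^ n)⁻¹ * ∑ x, (((realBernoulli r).eval (gridPoint x) : ℝ) : ℂ) * walsh k x
  -- The rank-one terms factor into products of two one-dimensional polynomial coefficients; the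
  -- term in `|x - y|` stays a double sum.
  have hQ : walshCoeff (sobolevKernelOne α) k
      = ∑ r ∈ Finset.Icc 1 α, (((r.factorial : ℂ)) ^ 2)⁻¹ * (β r (-k) * β r k)
        + (((b : ℂ) ^ n)⁻¹) ^ 2 * ((-1) ^ (α + 1) * ((2 * α).factorial : ℂ)⁻¹ * S) := by
    have h1 : ∀ x y : Fin n → ZMod b,
        (sobolevKernelOne α (gridPoint x) (gridPoint y) : ℂ) * walsh (-k) x * walsh k y
        = ∑ r ∈ Finset.Icc 1 α, (((r.factorial : ℂ)) ^ 2)⁻¹ *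
          (((((realBernoulli r).eval (gridPoint x) : ℝ) : ℂ) * walsh (-k) x) *
          ((((realBernoulli r).eval (gridPoint y) : ℝ) : ℂ) * walsh k y))
          + (-1) ^ (α + 1) * ((2 * α).factorial : ℂ)⁻¹ *
          (((bernoulliFun (2 * α) |gridPoint x - gridPoint y| : ℝ) : ℂ) * walsh (-k) x
            * walsh k y) := fun x y => by
      simp only [sobolevKernelOne, realBernoulli_eval]
      push_cast
      rw [add_mul, add_mul, Finset.sum_mul, Finset.sum_mul]
      congr 1
      · exact Finset.sum_congr rfl fun r _ => by ring
      · ring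
    rw [walshCoeff]
    simp only [h1, Finset.sum_add_distrib, ← Finset.mul_sum]
    rw [mul_add]
    congr 1
    simp only [β]
    have h2 : ∀ x : Fin n → ZMod b, ∑ y : Fin n → ZMod b, ∑ r ∈ Finset.Icc 1 α,
        (((r.factorial : ℂ)) ^ 2)⁻¹ *
          (((((realBernoulli r).eval (gridPoint x) : ℝ) : ℂ) * walsh (-k) x) *
          ((((realBernoulli r).eval (gridPoint y) : ℝ) : ℂ) * walsh k y))
        = ∑ r ∈ Finset.Icc 1 α, ∑ y : Fin n → ZMod b, (((r.factorial : ℂ)) ^ 2)⁻¹ *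
          (((((realBernoulli r).eval (gridPoint x) : ℝ) : ℂ) * walsh (-k) x) *
          ((((realBernoulli r).eval (gridPoint y) : ℝ) : ℂ) * walsh k y)) :=
      fun x => Finset.sum_comm
    simp only [h2]
    rw [Finset.sum_comm, Finset.mul_sum]
    refine Finset.sum_congr rfl fun r _ => ?_
    simp only [← Finset.mul_sum, ← Finset.sum_mul]
    ring
  have hk' : ∀ i ∈ T, (-k) i ≠ 0 := fun i hi => by simpa using hk i hi
  have hprod := prod_digitStep_nonneg (b := b) T
  have hfac : ∀ r : ℕ, ‖((r.factorial : ℂ))⁻¹‖ ≤ 1 := fun r => by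
    rw [norm_inv, Complex.norm_natCast]
    exact inv_le_one_of_one_le₀ (by exact_mod_cast Nat.one_le_iff_ne_zero.2 r.factorial_ne_zero)
  rw [hQ, add_mul, Finset.sum_mul]
  refine (norm_add_le _ _).trans (add_le_add ((norm_sum_le _ _).trans
    (Finset.sum_le_sum fun r _ => ?_)) ?_)
  · rw [norm_mul, ← inv_pow, norm_pow, norm_mul]
    have h1 := hA r n (-k) T hT hk' hTα
    have h2 := hA r n k T hT hk hTα
    have h3 : ‖β r (-k)‖ * ‖β r k‖ ≤ (A r * (T.map (digitStep b)).prod) *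
        (A r * (T.map (digitStep b)).prod) :=
      mul_le_mul h1 h2 (norm_nonneg _) (mul_nonneg (hA0 r) hprod)
    calc _ ≤ 1 * (‖β r (-k)‖ * ‖β r k‖) :=
          mul_le_mul_of_nonneg_right (pow_le_one₀ (norm_nonneg _) (hfac r)) (by positivity)
      _ ≤ _ := by rw [one_mul]; exact h3.trans (le_of_eq (by ring))
  · have h1 := hB n k T hT hk hTα
    rw [norm_mul, norm_mul, norm_mul, norm_pow, norm_pow, norm_inv, norm_pow, Complex.norm_natCast,
      norm_neg, norm_one, one_pow, one_mul, inv_pow, inv_mul_le_iff₀ (by positivity)]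
    refine (mul_le_of_le_one_left (norm_nonneg _) (hfac _)).trans h1

end KernelCoefficients

/-! ### The zero frequency -/

section ZeroFrequency

open Polynomial

variable {b : ℕ} [hb : Fact b.Prime]

theorem exists_abs_bernoulliFun_le (k : ℕ) :
    ∃ M : ℝ, 0 ≤ M ∧ ∀ t ∈ Set.Icc (0 : ℝ) 1, |bernoulliFun k t| ≤ M := by
  obtain ⟨M, hM0, hM⟩ := exists_abs_eval_le (realBernoulli k) 1
  exact ⟨M, hM0, fun t ht => hM t (abs_le.2 ⟨by linarith [ht.1], ht.2⟩)⟩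

theorem exists_lipschitz_bernoulliFun (k : ℕ) : ∃ L : ℝ, 0 ≤ L ∧ ∀ t ∈ Set.Icc (0 : ℝ) 1,
    ∀ r ∈ Set.Icc (0 : ℝ) 1, |bernoulliFun k t - bernoulliFun k r| ≤ L * |t - r| := by
  obtain ⟨M, hM0, hM⟩ := exists_abs_eval_le (derivative (realBernoulli k)) 1
  refine ⟨M, hM0, fun t ht r hr => ?_⟩
  exact (convex_Icc (0 : ℝ) 1).norm_image_sub_le_of_norm_hasDerivWithin_le
    (fun t _ => (Polynomial.hasDerivAt (realBernoulli k) t).hasDerivWithinAt)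
    (fun t ht => hM t (abs_le.2 ⟨by linarith [ht.1], ht.2⟩)) hr ht

theorem abs_sub_mem_Icc {x y : ℝ} (hx : x ∈ Set.Icc (0 : ℝ) 1) (hy : y ∈ Set.Icc (0 : ℝ) 1) :
    |x - y| ∈ Set.Icc (0 : ℝ) 1 :=
  ⟨abs_nonneg _, abs_le.2 ⟨by linarith [hx.1, hy.2], by linarith [hx.2, hy.1]⟩⟩

theorem exists_lipschitz_sobolevKernelOne (α : ℕ) : ∃ L : ℝ, 0 ≤ L ∧ ∀ x ∈ Set.Icc (0 : ℝ) 1,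
    ∀ t ∈ Set.Icc (0 : ℝ) 1, ∀ r ∈ Set.Icc (0 : ℝ) 1,
      |sobolevKernelOne α x t - sobolevKernelOne α x r| ≤ L * |t - r| := by
  choose L hL0 hL using exists_lipschitz_bernoulliFun
  choose M hM0 hM using exists_abs_bernoulliFun_le
  refine ⟨∑ r ∈ Finset.Icc 1 α, M r * L r / (r.factorial : ℝ) ^ 2
    + L (2 * α) / ((2 * α).factorial : ℝ), ?_, fun x hx t ht r hr => ?_⟩
  · refine add_nonneg (Finset.sum_nonneg fun r _ => ?_) (div_nonneg (hL0 _) (by positivity))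
    exact div_nonneg (mul_nonneg (hM0 r) (hL0 r)) (by positivity)
  · rw [sobolevKernelOne, sobolevKernelOne, add_sub_add_comm, ← Finset.sum_sub_distrib, add_mul,
      Finset.sum_mul]
    refine (abs_add_le _ _).trans (add_le_add ((Finset.abs_sum_le_sum_abs _ _).trans
      (Finset.sum_le_sum fun i _ => ?_)) ?_)
    · rw [← sub_div, ← mul_sub, abs_div, abs_mul, abs_of_nonneg (by positivity :
        (0 : ℝ) ≤ (i.factorial : ℝ) ^ 2), div_mul_eq_mul_div, mul_assoc]
      exact div_le_div_of_nonneg_right (mul_le_mul (hM i x hx) (hL i t ht r hr) (abs_nonneg _)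
        (hM0 i)) (by positivity)
    · rw [← sub_div, ← mul_sub, abs_div, abs_mul, abs_pow, abs_neg, abs_one, one_pow, one_mul,
        Nat.abs_cast, div_mul_eq_mul_div]
      refine div_le_div_of_nonneg_right ((hL _ _ (abs_sub_mem_Icc hx ht) _
        (abs_sub_mem_Icc hx hr)).trans (mul_le_mul_of_nonneg_left ?_ (hL0 _))) (by positivity)
      refine (abs_abs_sub_abs_le_abs_sub _ _).trans ?_
      rw [sub_sub_sub_cancel_left, abs_sub_comm]

theorem abs_riemann_sum_sub_integral_le {f : ℝ → ℝ} (hf : Continuous f) {L : ℝ} (hL0 : 0 ≤ L)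
    (hL : ∀ t ∈ Set.Icc (0 : ℝ) 1, ∀ r ∈ Set.Icc (0 : ℝ) 1, |f t - f r| ≤ L * |t - r|) {N : ℕ}
    (hN : 0 < N) :
    |(N : ℝ)⁻¹ * ∑ i ∈ Finset.range N, f (i / N) - ∫ t in (0 : ℝ)..1, f t| ≤ L * (N : ℝ)⁻¹ := by
  have hN0 : (0 : ℝ) < N := by exact_mod_cast hN
  have h1 : ∫ t in (0 : ℝ)..1, f t
      = ∑ i ∈ Finset.range N, ∫ t in ((i : ℕ) / N : ℝ)..((i + 1 : ℕ) / N : ℝ), f t := by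
    rw [intervalIntegral.sum_integral_adjacent_intervals (a := fun i : ℕ => (i / N : ℝ))
      fun i _ => hf.intervalIntegrable _ _]
    simp [hN0.ne']
  have h2 : ∀ i ∈ Finset.range N, |(N : ℝ)⁻¹ * f (i / N)
      - ∫ t in ((i : ℕ) / N : ℝ)..((i + 1 : ℕ) / N : ℝ), f t| ≤ L * (N : ℝ)⁻¹ * (N : ℝ)⁻¹ := by
    intro i hi
    have hlen : ((i + 1 : ℕ) / N : ℝ) - (i : ℕ) / N = (N : ℝ)⁻¹ := by
      push_cast
      field_simp
      ring
    have hc : (N : ℝ)⁻¹ * f (i / N)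
        = ∫ t in ((i : ℕ) / N : ℝ)..((i + 1 : ℕ) / N : ℝ), f (i / N) := by
      rw [intervalIntegral.integral_const, hlen, smul_eq_mul]
    have hi1 : ((i + 1 : ℕ) / N : ℝ) ≤ 1 := by
      rw [div_le_one hN0]
      exact_mod_cast Finset.mem_range.1 hi
    have hi0 : (0 : ℝ) ≤ (i : ℕ) / N := by positivity
    have hle : ((i : ℕ) / N : ℝ) ≤ (i + 1 : ℕ) / N := by
      rw [← sub_nonneg, hlen]
      positivity
    rw [hc, ← intervalIntegral.integral_sub (continuous_const.intervalIntegrable _ _)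
      (hf.intervalIntegrable _ _)]
    have := intervalIntegral.norm_integral_le_of_norm_le_const (a := ((i : ℕ) / N : ℝ))
      (b := ((i + 1 : ℕ) / N : ℝ)) (f := fun t => f (i / N) - f t) (C := L * (N : ℝ)⁻¹)
      fun t ht => by
        rw [Set.uIoc_of_le hle] at ht
        refine (hL _ ⟨hi0, hle.trans hi1⟩ t ⟨hi0.trans ht.1.le, ht.2.trans hi1⟩).trans
          (mul_le_mul_of_nonneg_left ?_ hL0)
        rw [abs_sub_comm, abs_of_nonneg (by linarith [ht.1])]
        linarith [ht.2]
    rwa [hlen, abs_of_pos (inv_pos.2 hN0)] at this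
  rw [h1, Finset.mul_sum, ← Finset.sum_sub_distrib]
  refine (Finset.abs_sum_le_sum_abs _ _).trans ((Finset.sum_le_card_nsmul _ _ _ h2).trans
    (le_of_eq ?_))
  rw [Finset.card_range, nsmul_eq_mul]
  field_simp

theorem sum_gridPoint {n : ℕ} (f : ℝ → ℝ) :
    ∑ x : Fin n → ZMod b, f (gridPoint x)
      = ∑ i ∈ Finset.range (b ^ n), f (i / (b ^ n : ℕ)) := by
  choose κ hκ using fun x : Fin n → ZMod b => sum_digit_finite n x
  have hκ' : ∀ x, gridPoint x = κ x / (b ^ n : ℕ) := fun x => by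
    rw [gridPoint, (hκ x).2]
    push_cast
    rfl
  rw [Finset.sum_range]
  refine Fintype.sum_bijective (fun x => (⟨κ x, (hκ x).1⟩ : Fin (b ^ n))) ?_ _ _ fun x => by
    rw [hκ']
  rw [Fintype.bijective_iff_injective_and_card]
  refine ⟨fun x y hxy => gridPoint_injective ?_, by simp [ZMod.card]⟩
  rw [hκ', hκ', Fin.mk.inj hxy]

/-- The kernel has integral zero in its second variable and is Lipschitz there, so its mean over the
grid is a Riemann sum of size `O(b^{-n})`. -/
theorem exists_walshCoeff_zero_le (b : ℕ) [hb : Fact b.Prime] {α : ℕ} (hα : 1 ≤ α) :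
    ∃ C : ℝ, 0 ≤ C ∧ ∀ n : ℕ,
      ‖walshCoeff (sobolevKernelOne α) (0 : Fin n → ZMod b)‖ ≤ C * ((b : ℝ) ^ n)⁻¹ := by
  obtain ⟨L, hL0, hL⟩ := exists_lipschitz_sobolevKernelOne α
  refine ⟨L, hL0, fun n => ?_⟩
  have hbn : (0 : ℝ) < (b : ℝ) ^ n := pow_pos (by exact_mod_cast hb.out.pos) n
  have h1 : ∀ x : Fin n → ZMod b, |((b : ℝ) ^ n)⁻¹ * ∑ y : Fin n → ZMod b,
      sobolevKernelOne α (gridPoint x) (gridPoint y)| ≤ L * ((b : ℝ) ^ n)⁻¹ := fun x => by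
    have hx := gridPoint_mem_Ico x
    have := abs_riemann_sum_sub_integral_le (f := sobolevKernelOne α (gridPoint x))
      ((continuous_sobolevKernelOne α).comp (continuous_const.prodMk continuous_id)) hL0
      (hL _ ⟨hx.1, hx.2.le⟩) (pow_pos hb.out.pos n)
    rw [integral_sobolevKernelOne hα hx, sub_zero, ← sum_gridPoint] at this
    push_cast at this
    exact this
  have h2 : walshCoeff (sobolevKernelOne α) (0 : Fin n → ZMod b)
      = ((((b : ℝ) ^ n)⁻¹ * ∑ x : Fin n → ZMod b, (((b : ℝ) ^ n)⁻¹ * ∑ y : Fin n → ZMod b,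
        sobolevKernelOne α (gridPoint x) (gridPoint y)) : ℝ) : ℂ) := by
    have hw : ∀ x : Fin n → ZMod b, walsh 0 x = 1 := fun x => by simp [walsh]
    simp only [walshCoeff, neg_zero, hw, mul_one]
    push_cast
    rw [← Finset.mul_sum]
    ring
  rw [h2, Complex.norm_real, norm_mul, norm_inv, Real.norm_of_nonneg hbn.le,
    inv_mul_le_iff₀ hbn]
  refine (norm_sum_le _ _).trans ((Finset.sum_le_card_nsmul _ _ _ fun x _ => h1 x).trans
    (le_of_eq ?_))
  simp [ZMod.card]

end ZeroFrequency

/-! ### Positions of nonzero digits -/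

theorem prod_map_digitStep {b n : ℕ} (L : List (Fin n)) :
    (L.map (digitStep b)).prod = ((b : ℝ) ^ (L.map fun i : Fin n => i.val + 1).sum)⁻¹ := by
  induction L with
  | nil => simp
  | cons i L ih =>
    rw [List.map_cons, List.prod_cons, ih, List.map_cons, List.sum_cons, pow_add, mul_inv]
    rfl

section Positions

variable {b n : ℕ} [hb : Fact b.Prime]

/-- The positions of the nonzero digits of `k` in decreasing order. -/
noncomputable def supportList (k : Fin n → ZMod b) : List (Fin n) :=
  (Finset.univ.filter fun i => k i ≠ 0).sort (· ≥ ·)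

/-- The `l`-th largest position (counted from one) of a nonzero digit of `k`, or zero. -/
noncomputable def topPosition (k : Fin n → ZMod b) (l : ℕ) : ℕ :=
  ((supportList k).map fun i : Fin n => i.val + 1).getD l 0

/-- The sum of the `w` largest positions of nonzero digits of `k`. -/
noncomputable def topSum (w : ℕ) (k : Fin n → ZMod b) : ℕ := ∑ l ∈ Finset.range w, topPosition k l

theorem mem_supportList {k : Fin n → ZMod b} {i : Fin n} : i ∈ supportList k ↔ k i ≠ 0 := by
  simp [supportList]

theorem nodup_supportList (k : Fin n → ZMod b) : (supportList k).Nodup := Finset.sort_nodup _ _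

theorem strictAnti_supportList (k : Fin n → ZMod b) : StrictAnti (supportList k).get :=
  (Finset.sortedGT_sort _).strictAnti_get

theorem topPosition_of_lt (k : Fin n → ZMod b) {l : ℕ} (hl : l < (supportList k).length) :
    topPosition k l = ((supportList k).get ⟨l, hl⟩ : ℕ) + 1 := by
  simp [topPosition, hl]

theorem topPosition_of_le (k : Fin n → ZMod b) {l : ℕ} (hl : (supportList k).length ≤ l) :
    topPosition k l = 0 := by
  simp [topPosition, hl]

theorem antitone_topPosition (k : Fin n → ZMod b) : Antitone (topPosition k) := by
  intro l l' hll
  rcases lt_or_ge l' (supportList k).length with h | h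
  · rw [topPosition_of_lt k h, topPosition_of_lt k (hll.trans_lt h)]
    have : (supportList k).get ⟨l', h⟩ ≤ (supportList k).get ⟨l, hll.trans_lt h⟩ :=
      (strictAnti_supportList k).antitone hll
    exact Nat.succ_le_succ this
  · rw [topPosition_of_le k h]
    exact Nat.zero_le _

theorem topPosition_zero_le_iff (k : Fin n → ZMod b) (e : ℕ) :
    topPosition k 0 ≤ e ↔ ∀ i, k i ≠ 0 → (i : ℕ) + 1 ≤ e := by
  constructor
  · intro h i hi
    obtain ⟨l, hl⟩ := List.get_of_mem (mem_supportList.2 hi)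
    have h1 := antitone_topPosition k (Nat.zero_le l)
    rw [topPosition_of_lt k l.2] at h1
    rw [← hl]
    exact h1.trans h
  · intro h
    rcases Nat.eq_zero_or_pos (supportList k).length with h0 | h0
    · rw [topPosition_of_le k h0.le]
      exact Nat.zero_le _
    · rw [topPosition_of_lt k h0]
      exact h _ (mem_supportList.1 (List.get_mem _ _))

theorem topPosition_zero_le (k : Fin n → ZMod b) : topPosition k 0 ≤ n :=
  (topPosition_zero_le_iff k n).2 fun i _ => i.2

theorem topPosition_eq_zero_iff (k : Fin n → ZMod b) : topPosition k 0 = 0 ↔ k = 0 := by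
  rw [← Nat.le_zero, topPosition_zero_le_iff]
  constructor
  · intro h
    funext i
    by_contra hi
    have := h i hi
    omega
  · rintro rfl i hi
    exact absurd rfl hi

theorem topSum_le (w : ℕ) (k : Fin n → ZMod b) : topSum w k ≤ w * topPosition k 0 := by
  refine (Finset.sum_le_card_nsmul _ _ _ fun l _ =>
    antitone_topPosition k (Nat.zero_le l)).trans ?_
  simp

theorem topPosition_le_topSum {w : ℕ} (hw : 1 ≤ w) (k : Fin n → ZMod b) :
    topPosition k 0 ≤ topSum w k :=
  Finset.single_le_sum (f := topPosition k) (fun _ _ => Nat.zero_le _)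
    (Finset.mem_range.2 (by omega))

/-- The sum of the `α` largest positions dominates an average of the largest position and of the
sum of the `β` largest positions. -/
theorem topSum_interpolation {α β : ℕ} (hα : 1 ≤ α) (hβ : α ≤ β) (k : Fin n → ZMod b) :
    (β - α) * topPosition k 0 + (α - 1) * topSum β k ≤ (β - 1) * topSum α k := by
  obtain ⟨a, rfl⟩ : ∃ a, α = a + 1 := ⟨α - 1, by omega⟩
  obtain ⟨c, rfl⟩ := Nat.exists_eq_add_of_le hβ
  -- With `a = α - 1` and `c = β - α`, both `h1` and `h2` compare with the `α`-th largest position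
  -- `topPosition k a`. The combination `c * h1 + a * h2` eliminates it.
  have h1 : topPosition k 0 + a * topPosition k a ≤ topSum (a + 1) k := by
    rw [topSum, Finset.sum_range_succ', add_comm]
    refine add_le_add ?_ le_rfl
    have := Finset.card_nsmul_le_sum (Finset.range a) (fun l => topPosition k (l + 1))
      (topPosition k a) fun l hl => antitone_topPosition k (by simpa using hl)
    simpa using this
  have h2 : topSum (a + 1 + c) k ≤ topSum (a + 1) k + c * topPosition k a := by
    rw [topSum, Finset.sum_range_add]
    refine add_le_add le_rfl ?_
    refine (Finset.sum_le_card_nsmul _ _ (topPosition k a) fun l _ =>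
      antitone_topPosition k (by omega)).trans ?_
    simp
  have e1 : a + 1 + c - (a + 1) = c := by omega
  have e2 : a + 1 - 1 = a := by omega
  have e3 : a + 1 + c - 1 = a + c := by omega
  rw [e1, e2, e3]
  nlinarith [Nat.mul_le_mul_left c h1, Nat.mul_le_mul_left a h2]

theorem sum_range_getD (L : List ℕ) (w : ℕ) :
    ∑ l ∈ Finset.range w, L.getD l 0 = (L.take w).sum := by
  induction w generalizing L with
  | zero => simp
  | succ w ih =>
    cases L with
    | nil => simp
    | cons a L =>
      rw [Finset.sum_range_succ', List.take_succ_cons, List.sum_cons, ← ih L, add_comm]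
      simp

theorem prod_take_supportList (k : Fin n → ZMod b) (w : ℕ) :
    (((supportList k).take w).map (digitStep b)).prod = ((b : ℝ) ^ topSum w k)⁻¹ := by
  rw [prod_map_digitStep, topSum]
  simp only [topPosition, sum_range_getD, List.map_take]

/-- The decay bound is applied to the `α` largest positions of nonzero digits, or to all of them if
there are fewer. -/
theorem exists_walshCoeff_le_topSum (b : ℕ) [hb : Fact b.Prime] {α : ℕ} (hα : 1 ≤ α) :
    ∃ C : ℝ, 0 ≤ C ∧ ∀ (n : ℕ) (k : Fin n → ZMod b),
      ‖walshCoeff (sobolevKernelOne α) k‖ ≤ C * (((b : ℝ) ^ topSum α k)⁻¹) ^ 2 := by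
  obtain ⟨C, hC0, hC⟩ := exists_walshCoeff_le b hα
  refine ⟨C, hC0, fun n k => ?_⟩
  rw [← prod_take_supportList]
  exact hC n k _ ((nodup_supportList k).sublist (List.take_sublist _ _))
    (fun i hi => mem_supportList.1 (List.mem_of_mem_take hi)) (List.length_take_le _ _)

/-! ### The dual of a digital net -/

/-- Nonzero elements of the dual of an order `β` net have large positions of nonzero digits. -/
theorem IsOrderDigitalNet.eq_zero_of_topSum_le {s m β t : ℕ}
    {C : Fin s → Matrix (Fin n) (Fin m) (ZMod b)} (hC : IsOrderDigitalNet β t C)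
    {k : Fin s → Fin n → ZMod b} (hk : ∑ j, k j ᵥ* C j = 0)
    (hle : ∑ j, topSum β (k j) ≤ β * m - t) : k = 0 := by
  have hsum : ∀ j, ∑ l : Fin (supportList (k j)).length,
      (if (l : ℕ) < β then ((supportList (k j)).get l : ℕ) + 1 else 0) = topSum β (k j) := by
    intro j
    have h1 : ∀ l : Fin (supportList (k j)).length,
        (if (l : ℕ) < β then ((supportList (k j)).get l : ℕ) + 1 else 0)
        = (fun l : ℕ => if l < β then topPosition (k j) l else 0) l := fun l => by
      simp only [topPosition_of_lt (k j) l.2]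
    rw [Finset.sum_congr rfl fun l _ => h1 l, Fin.sum_univ_eq_sum_range
      (fun l : ℕ => if l < β then topPosition (k j) l else 0), ← Finset.sum_filter, topSum]
    refine Finset.sum_subset (fun l hl => ?_) fun l hl hl' => ?_
    · simpa using (Finset.mem_filter.1 hl).2
    · refine topPosition_of_le _ (not_lt.1 fun h => hl' ?_)
      simpa [h] using hl
  have hind := hC.2.2 (fun j => (supportList (k j)).length) (fun j => (supportList (k j)).get)
    (fun j => strictAnti_supportList (k j)) (by simpa only [hsum] using hle)
  rw [Fintype.linearIndependent_iff] at hind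
  -- The dual equation is a linear relation among the rows at the nonzero digits of `k`, with these
  -- digits as coefficients. Independence forces them to vanish.
  have hzero := hind (fun p => k p.1 ((supportList (k p.1)).get p.2)) (by
    rw [Fintype.sum_sigma, ← hk]
    refine Finset.sum_congr rfl fun j _ => ?_
    rw [vecMul_eq_sum]
    have h1 : ∑ l : Fin (supportList (k j)).length,
        k j ((supportList (k j)).get l) • (C j).row ((supportList (k j)).get l)
        = ∑ i ∈ Finset.univ.filter (fun i => k j i ≠ 0), k j i • (C j).row i := by
      refine Finset.sum_bij (fun l _ => (supportList (k j)).get l) ?_ ?_ ?_ fun _ _ => rfl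
      · intro l _
        simpa using mem_supportList.1 (List.get_mem (supportList (k j)) l)
      · intro l _ l' _ h
        exact (strictAnti_supportList (k j)).injective h
      · intro i hi
        obtain ⟨l, hl⟩ := List.get_of_mem (mem_supportList.2 (Finset.mem_filter.1 hi).2)
        exact ⟨l, Finset.mem_univ _, hl⟩
    rw [h1]
    refine Finset.sum_subset (Finset.subset_univ _) fun i _ hi => ?_
    have : k j i = 0 := by simpa using hi
    rw [this, zero_smul])
  funext j i
  by_contra hi
  obtain ⟨l, hl⟩ := List.get_of_mem (mem_supportList.2 hi)
  have := hzero ⟨j, l⟩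
  simp only [hl] at this
  exact hi this

/-! ### Counting and geometric sums over frequencies far from zero -/

theorem exists_le_sum_eq {ι : Type*} [Fintype ι] (d : ι → ℕ) (c : ℕ) (hc : c ≤ ∑ j, d j) :
    ∃ e : ι → ℕ, (∀ j, e j ≤ d j) ∧ ∑ j, e j = c := by
  classical
  induction c with
  | zero => exact ⟨0, fun j => Nat.zero_le _, by simp⟩
  | succ c ih =>
    obtain ⟨e, he, hs⟩ := ih (by omega)
    obtain ⟨j, hj⟩ : ∃ j, e j < d j := by
      by_contra! h
      have := Finset.sum_le_sum fun j (_ : j ∈ Finset.univ) => h j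
      omega
    refine ⟨fun l => e l + if l = j then 1 else 0, fun l => ?_, ?_⟩
    · dsimp only
      split_ifs with h
      · subst h
        exact hj
      · exact he l
    · rw [Finset.sum_add_distrib, hs]
      simp

/-- A subgroup of frequencies that meets small boxes only in zero has few elements in large
boxes. -/
theorem card_topPosition_le {ι : Type*} [Fintype ι] [DecidableEq ι]
    (D : AddSubgroup (ι → Fin n → ZMod b)) [DecidablePred (· ∈ D)] (w : ℕ)
    (hD : ∀ k ∈ D, ∑ j, topPosition (k j) 0 ≤ w → k = 0) (d : ι → ℕ) :
    (Finset.univ.filter fun k : ι → Fin n → ZMod b =>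
      k ∈ D ∧ ∀ j, topPosition (k j) 0 ≤ d j).card ≤ b ^ (∑ j, d j - w) := by
  -- Forgetting the `e j` leading positions is injective on the box: two frequencies with the same
  -- image differ by an element of `D` supported on a box of total size at most `w`.
  obtain ⟨e, he, hs⟩ := exists_le_sum_eq d (min w (∑ j, d j)) (min_le_right _ _)
  have hcard : Fintype.card ((j : ι) → Fin (d j - e j) → ZMod b) = b ^ (∑ j, d j - w) := by
    rw [Fintype.card_pi]
    simp only [Fintype.card_fun, ZMod.card, Fintype.card_fin]
    rw [Finset.prod_pow_eq_pow_sum, Finset.sum_tsub_distrib _ fun j _ => he j, hs]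
    congr 1
    omega
  rw [← hcard, ← Finset.card_univ]
  refine Finset.card_le_card_of_injOn (fun k j l => if h : e j + l < n then k j ⟨e j + l, h⟩ else 0)
    (fun _ _ => Finset.mem_coe.2 (Finset.mem_univ _)) ?_
  intro k hk k' hk' hkk
  rw [Finset.mem_coe, Finset.mem_filter] at hk hk'
  rw [← sub_eq_zero]
  refine hD _ (D.sub_mem hk.2.1 hk'.2.1) ?_
  refine (Finset.sum_le_sum fun j _ => ?_).trans (hs.le.trans (min_le_left _ _))
  rw [topPosition_zero_le_iff]
  intro i hi
  by_contra! hlt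
  have hid : (i : ℕ) < d j := by
    by_contra! hge
    have h1 : k j i = 0 := by
      by_contra h
      have := (topPosition_zero_le_iff _ _).1 (hk.2.2 j) i h
      omega
    have h2 : k' j i = 0 := by
      by_contra h
      have := (topPosition_zero_le_iff _ _).1 (hk'.2.2 j) i h
      omega
    exact hi (by simp [h1, h2])
  have := congrFun (congrFun hkk j) ⟨i - e j, by omega⟩
  have h3 : e j + (i - e j) = (i : ℕ) := by omega
  simp only [h3, i.2, dite_true] at this
  exact hi (by simp [this])

/-- One coordinate is determined by the prescribed sum and the others. This is the source of the
exponent `|u| - 1` of the logarithm. -/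
theorem card_sum_eq_le {ι : Type*} [Fintype ι] [DecidableEq ι] [Nonempty ι] (N z : ℕ) :
    ((Fintype.piFinset fun _ : ι => Finset.range N).filter fun d => ∑ j, d j = z).card
      ≤ (z + 1) ^ (Fintype.card ι - 1) := by
  obtain ⟨j₀⟩ := ‹Nonempty ι›
  have hcard : (Fintype.piFinset fun _ : {j : ι // j ≠ j₀} => Finset.range (z + 1)).card
      = (z + 1) ^ (Fintype.card ι - 1) := by
    simp
  rw [← hcard]
  have hsplit : ∀ d : ι → ℕ, ∑ j, d j = d j₀ + ∑ j : {j : ι // j ≠ j₀}, d j := fun d => by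
    rw [← Finset.add_sum_erase _ _ (Finset.mem_univ j₀)]
    congr 1
    rw [← Finset.sum_subtype]
    intro j
    simp
  refine Finset.card_le_card_of_injOn (fun d j => d j) ?_ ?_
  · intro d hd
    rw [Finset.mem_coe, Finset.mem_filter] at hd
    rw [Finset.mem_coe, Fintype.mem_piFinset]
    intro j
    have := Finset.single_le_sum (f := d) (fun _ _ => Nat.zero_le _) (Finset.mem_univ j.1)
    have hj : d j.1 < z + 1 := by omega
    exact Finset.mem_range.2 hj
  · intro d hd d' hd' h
    rw [Finset.mem_coe, Finset.mem_filter] at hd hd'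
    have hr : ∀ j, j ≠ j₀ → d j = d' j := fun j hj => congrFun h ⟨j, hj⟩
    funext j
    by_cases hj : j = j₀
    · subst hj
      have h1 := hd.2
      have h2 := hd'.2
      rw [hsplit] at h1 h2
      have h3 : ∑ i : {i : ι // i ≠ j}, d i = ∑ i : {i : ι // i ≠ j}, d' i :=
        Finset.sum_congr rfl fun i _ => hr i i.2
      omega
    · exact hr j hj

/-- Geometric sums over a subgroup of frequencies that meets small boxes only in zero. -/
theorem sum_pow_topPosition_le {ι : Type*} [Fintype ι] [DecidableEq ι] [Nonempty ι]
    (D : AddSubgroup (ι → Fin n → ZMod b)) [DecidablePred (· ∈ D)] (w : ℕ)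
    (hD : ∀ k ∈ D, ∑ j, topPosition (k j) 0 ≤ w → k = 0) {x : ℝ} (hx : 0 < x)
    (hx1 : b * x < 1) :
    ∑ k : ι → Fin n → ZMod b with k ∈ D ∧ ∀ j, k j ≠ 0, x ^ (∑ j, topPosition (k j) 0)
      ≤ x ^ w * ((w + 1 : ℝ) ^ (Fintype.card ι - 1) *
        ∑' v : ℕ, (v + 1 : ℝ) ^ (Fintype.card ι - 1) * (b * x) ^ v) := by
  set S := Fintype.card ι - 1
  set y : ℝ := b * x with hy
  have hy' : 0 < y := mul_pos (by exact_mod_cast hb.out.pos) hx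
  have hy0 := hy'.le
  have hsummable : Summable fun v : ℕ => (v + 1 : ℝ) ^ S * y ^ v := by
    have h1 := summable_pow_mul_geometric_of_norm_lt_one S (r := y)
      (by rwa [Real.norm_of_nonneg hy0])
    have h2 := ((summable_nat_add_iff 1).2 h1).mul_left y⁻¹
    refine h2.congr fun v => ?_
    push_cast
    field_simp
    ring
  set P := Fintype.piFinset fun _ : ι => Finset.range (n + 1) with hP
  set A := Finset.univ.filter fun k : ι → Fin n → ZMod b => k ∈ D ∧ ∀ j, k j ≠ 0 with hA
  have hmaps : ∀ k ∈ A, (fun j => topPosition (k j) 0) ∈ P := fun k _ => by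
    rw [Fintype.mem_piFinset]
    intro j
    have := topPosition_zero_le (k j)
    rw [Finset.mem_range]
    omega
  -- Frequencies are grouped by their vector `d` of largest positions. A group is empty if `∑ d < w`
  -- and otherwise has at most `b ^ (∑ d - w)` members.
  have hfib : ∀ d ∈ P, ∑ k ∈ A with (fun j => topPosition (k j) 0) = d,
      x ^ (∑ j, topPosition (k j) 0)
      ≤ if w ≤ ∑ j, d j then x ^ w * y ^ (∑ j, d j - w) else 0 := by
    intro d _
    have h1 : ∀ k ∈ A.filter (fun k => (fun j => topPosition (k j) 0) = d),
        x ^ (∑ j, topPosition (k j) 0) = x ^ (∑ j, d j) := fun k hk => by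
      rw [← (Finset.mem_filter.1 hk).2]
    rw [Finset.sum_congr rfl h1, Finset.sum_const, nsmul_eq_mul]
    split_ifs with hw
    · have h2 : (A.filter (fun k => (fun j => topPosition (k j) 0) = d)).card
          ≤ b ^ (∑ j, d j - w) := by
        refine (Finset.card_le_card fun k hk => ?_).trans (card_topPosition_le D w hD d)
        rw [Finset.mem_filter] at hk ⊢
        refine ⟨Finset.mem_univ _, (Finset.mem_filter.1 hk.1).2.1, fun j => ?_⟩
        rw [← hk.2]
      calc _ ≤ (b : ℝ) ^ (∑ j, d j - w) * x ^ (∑ j, d j) :=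
            mul_le_mul_of_nonneg_right (by exact_mod_cast h2) (by positivity)
        _ = _ := by
          obtain ⟨c, hc⟩ := Nat.exists_eq_add_of_le hw
          rw [hc, Nat.add_sub_cancel_left, hy, pow_add, mul_pow]
          ring
    · rw [Finset.card_eq_zero.2, Nat.cast_zero, zero_mul]
      rw [Finset.filter_eq_empty_iff]
      intro k hk hkd
      obtain ⟨-, hkD, hk0⟩ := Finset.mem_filter.1 hk
      have : k = 0 := hD k hkD (by
        rw [← hkd] at hw
        exact (not_le.1 hw).le)
      exact hk0 (Classical.arbitrary ι) (by rw [this]; rfl)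
  rw [← Finset.sum_fiberwise_of_maps_to hmaps]
  refine (Finset.sum_le_sum hfib).trans ?_
  set Z := Finset.range (Fintype.card ι * (n + 1) + 1) with hZ
  have hmaps' : ∀ d ∈ P, ∑ j, d j ∈ Z := fun d hd => by
    rw [Fintype.mem_piFinset] at hd
    have : ∑ j, d j ≤ Fintype.card ι * (n + 1) := by
      refine (Finset.sum_le_card_nsmul _ _ (n + 1) fun j _ => ?_).trans ?_
      · exact (Finset.mem_range.1 (hd j)).le
      · simp
    rw [Finset.mem_range]
    omega
  rw [← Finset.sum_fiberwise_of_maps_to hmaps']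
  have hfib' : ∀ z ∈ Z, ∑ d ∈ P with ∑ j, d j = z,
      (if w ≤ ∑ j, d j then x ^ w * y ^ (∑ j, d j - w) else 0)
      ≤ if w ≤ z then x ^ w * ((w + 1 : ℝ) ^ S * (((z - w : ℕ) + 1 : ℝ) ^ S * y ^ (z - w)))
        else 0 := by
    intro z _
    have h1 : ∀ d ∈ P.filter (fun d => ∑ j, d j = z),
        (if w ≤ ∑ j, d j then x ^ w * y ^ (∑ j, d j - w) else 0)
        = if w ≤ z then x ^ w * y ^ (z - w) else 0 := fun d hd => by
      rw [(Finset.mem_filter.1 hd).2]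
    rw [Finset.sum_congr rfl h1, Finset.sum_const, nsmul_eq_mul]
    split_ifs with hw
    · have h2 : ((P.filter (fun d => ∑ j, d j = z)).card : ℝ) ≤ (z + 1 : ℝ) ^ S := by
        exact_mod_cast card_sum_eq_le (n + 1) z
      -- The product form moves the dependence on `w` out of the series, leaving a series
      -- independent of `w` and `n`.
      have h3 : (z + 1 : ℝ) ^ S ≤ (w + 1 : ℝ) ^ S * ((z - w : ℕ) + 1 : ℝ) ^ S := by
        rw [← mul_pow]
        refine pow_le_pow_left₀ (by positivity) ?_ _
        obtain ⟨c, rfl⟩ := Nat.exists_eq_add_of_le hw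
        rw [Nat.add_sub_cancel_left]
        push_cast
        nlinarith [(Nat.cast_nonneg w : (0 : ℝ) ≤ w), (Nat.cast_nonneg c : (0 : ℝ) ≤ c)]
      calc _ ≤ ((w + 1 : ℝ) ^ S * ((z - w : ℕ) + 1 : ℝ) ^ S) * (x ^ w * y ^ (z - w)) :=
            mul_le_mul_of_nonneg_right (h2.trans h3) (by positivity)
        _ = _ := by ring
    · rw [mul_zero]
  refine (Finset.sum_le_sum hfib').trans ?_
  rw [← Finset.sum_filter, ← Finset.mul_sum, ← Finset.mul_sum]
  refine mul_le_mul_of_nonneg_left (mul_le_mul_of_nonneg_left ?_ (by positivity)) (by positivity)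
  have himg : ∑ z ∈ Z.filter (fun z => w ≤ z), ((z - w : ℕ) + 1 : ℝ) ^ S * y ^ (z - w)
      = ∑ v ∈ (Z.filter (fun z => w ≤ z)).image (fun z => z - w), (v + 1 : ℝ) ^ S * y ^ v := by
    rw [Finset.sum_image]
    intro z hz z' hz' h
    have h1 := (Finset.mem_filter.1 hz).2
    have h2 := (Finset.mem_filter.1 hz').2
    dsimp only at h
    omega
  rw [himg]
  exact hsummable.sum_le_tsum _ fun v _ => by positivity

end Positions

/-! ### Sums over the dual net -/

section DualSums

variable {b n : ℕ} [hb : Fact b.Prime]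

/-- The frequencies in the dual of the digital net with generating matrices `C`. -/
def dualNet {m : ℕ} {ι : Type*} [Fintype ι] (C : ι → Matrix (Fin n) (Fin m) (ZMod b)) :
    AddSubgroup (ι → Fin n → ZMod b) where
  carrier := {k | ∑ j, k j ᵥ* C j = 0}
  add_mem' {k k'} hk hk' := by
    rw [Set.mem_ofPred_eq] at *
    simp only [Pi.add_apply, add_vecMul, Finset.sum_add_distrib, hk, hk', add_zero]
  zero_mem' := by simp
  neg_mem' {k} hk := by
    rw [Set.mem_ofPred_eq] at *
    simp only [Pi.neg_apply, neg_vecMul, Finset.sum_neg_distrib, hk, neg_zero]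

theorem mem_dualNet {m : ℕ} {ι : Type*} [Fintype ι] {C : ι → Matrix (Fin n) (Fin m) (ZMod b)}
    {k : ι → Fin n → ZMod b} : k ∈ dualNet C ↔ ∑ j, k j ᵥ* C j = 0 := Iff.rfl

theorem topSum_zero (w : ℕ) : topSum w (0 : Fin n → ZMod b) = 0 := by
  have h1 := topSum_le w (0 : Fin n → ZMod b)
  rw [(topPosition_eq_zero_iff _).2 rfl] at h1
  simpa using h1

/-- Extending by zero outside `u` changes neither the dual equation nor the sum of positions, so
projections inherit the property. -/
theorem IsOrderDigitalNet.eq_zero_of_mem_dualNet {s m β t : ℕ}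
    {C : Fin s → Matrix (Fin n) (Fin m) (ZMod b)} (hC : IsOrderDigitalNet β t C)
    (u : Finset (Fin s)) {k : u → Fin n → ZMod b} (hk : k ∈ dualNet fun j : u => C j)
    (hle : ∑ j, topSum β (k j) ≤ β * m - t) : k = 0 := by
  let k' : Fin s → Fin n → ZMod b := fun j => if h : j ∈ u then k ⟨j, h⟩ else 0
  have hk' : ∀ j : u, k' j = k j := fun j => by simp [k']
  have hk0 : ∀ j, j ∉ u → k' j = 0 := fun j hj => by simp [k', hj]
  have h1 : ∑ j, k' j ᵥ* C j = 0 := by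
    rw [← mem_dualNet.1 hk, ← Finset.sum_subset (Finset.subset_univ u) fun j _ hj => by
      rw [hk0 j hj, zero_vecMul], ← Finset.sum_coe_sort u]
    exact Finset.sum_congr rfl fun j _ => by rw [hk']
  have h2 : ∑ j, topSum β (k' j) = ∑ j, topSum β (k j) := by
    rw [← Finset.sum_subset (Finset.subset_univ u) fun j _ hj => by
      rw [hk0 j hj, topSum_zero], ← Finset.sum_coe_sort u]
    exact Finset.sum_congr rfl fun j _ => by rw [hk']
  have h3 := hC.eq_zero_of_topSum_le h1 (h2 ▸ hle)
  funext j
  rw [← hk', h3]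
  rfl

/-- A top `β` sum is at most `β` times the largest position, so the order `β` property implies the
order one property with the same `t`. -/
theorem IsOrderDigitalNet.eq_zero_of_topPosition_le {s m β t : ℕ} (hβ : 1 ≤ β)
    {C : Fin s → Matrix (Fin n) (Fin m) (ZMod b)} (hC : IsOrderDigitalNet β t C)
    (u : Finset (Fin s)) {k : u → Fin n → ZMod b} (hk : k ∈ dualNet fun j : u => C j)
    (hle : ∑ j, topPosition (k j) 0 ≤ m - t) : k = 0 := by
  refine hC.eq_zero_of_mem_dualNet u hk ?_
  calc ∑ j, topSum β (k j) ≤ ∑ j, β * topPosition (k j) 0 :=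
        Finset.sum_le_sum fun j _ => topSum_le β (k j)
    _ = β * ∑ j, topPosition (k j) 0 := by rw [Finset.mul_sum]
    _ ≤ β * (m - t) := Nat.mul_le_mul_left _ hle
    _ = β * m - β * t := Nat.mul_sub _ _ _
    _ ≤ β * m - t := Nat.sub_le_sub_left (Nat.le_mul_of_pos_left t hβ) _

/-- Interpolation splits the exponent between the top `β` sum, bounded below on the dual, and the
largest positions, summed geometrically. The two gains together give the full power `N^{-2α}`. -/
theorem sum_dualNet_topSum_le {s m α β t : ℕ} (hα : 1 ≤ α) (hβ : 2 * α ≤ β) (hm : 1 ≤ m)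
    {C : Fin s → Matrix (Fin n) (Fin m) (ZMod b)} (hC : IsOrderDigitalNet β t C)
    {u : Finset (Fin s)} (hu : u.Nonempty) {x : ℝ}
    (hx : x = (b : ℝ) ^ (-(2 * ((β : ℝ) - α) / (β - 1)))) :
    ∑ k : u → Fin n → ZMod b with ∑ j : u, k j ᵥ* C j = 0 ∧ ∀ j, k j ≠ 0,
      ∏ j, (((b : ℝ) ^ topSum α (k j))⁻¹) ^ 2
      ≤ (((((b : ℝ) ^ m) ^ α)⁻¹) ^ 2 * (m : ℝ) ^ (u.card - 1)) * ((b : ℝ) ^ (2 * t) *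
        (2 ^ (u.card - 1) * ∑' v : ℕ, (v + 1 : ℝ) ^ (u.card - 1) * (b * x) ^ v)) := by
  classical
  have hb1 : (1 : ℝ) < b := by exact_mod_cast hb.out.one_lt
  have hb0 : (0 : ℝ) < b := by linarith
  have : Nonempty u := hu.to_subtype
  have hα' : (1 : ℝ) ≤ α := by exact_mod_cast hα
  have hβ' : 2 * (α : ℝ) ≤ β := by exact_mod_cast hβ
  have hβ1 : (0 : ℝ) < β - 1 := by linarith
  -- `lam` and `κ` are twice the interpolation weights. The assumption `2 * α ≤ β` gives `lam > 1`,
  -- hence `b * x < 1`: the decay beats the growth of the number of dual points.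
  set lam : ℝ := 2 * ((β : ℝ) - α) / (β - 1) with hlam
  set κ : ℝ := 2 * ((α : ℝ) - 1) / (β - 1) with hκ
  have hlam0 : 0 ≤ lam := div_nonneg (by linarith) hβ1.le
  have hlam1 : 1 < lam := by
    rw [hlam, lt_div_iff₀ hβ1]
    linarith
  have hκ0 : 0 ≤ κ := div_nonneg (by linarith) hβ1.le
  have hx0 : 0 < x := hx ▸ Real.rpow_pos_of_pos hb0 _
  have hx1 : b * x < 1 := by
    rw [hx]
    nth_rewrite 1 [← Real.rpow_one (b : ℝ)]
    rw [← Real.rpow_add hb0]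
    exact Real.rpow_lt_one_of_one_lt_of_neg hb1 (by linarith)
  have hterm : ∀ k : u → Fin n → ZMod b, k ∈ dualNet (fun j : u => C j) → (∀ j, k j ≠ 0) →
      ∏ j, (((b : ℝ) ^ topSum α (k j))⁻¹) ^ 2
      ≤ (b : ℝ) ^ (-(κ * (β * m - t))) * x ^ (∑ j, topPosition (k j) 0) := by
    intro k hk hk0
    set S := ∑ j, topSum α (k j) with hS
    set V := ∑ j, topSum β (k j) with hV
    set U := ∑ j, topPosition (k j) 0 with hU
    have hprod : ∏ j, (((b : ℝ) ^ topSum α (k j))⁻¹) ^ 2 = (b : ℝ) ^ (-(2 * (S : ℝ))) := by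
      rw [Finset.prod_pow, Finset.prod_inv_distrib, Finset.prod_pow_eq_pow_sum, ← hS,
        Real.rpow_neg hb0.le, mul_comm, Real.rpow_mul hb0.le, Real.rpow_natCast, inv_pow]
      norm_cast
    have hxU : x ^ U = (b : ℝ) ^ (-lam * U) := by
      rw [hx, Real.rpow_mul hb0.le, Real.rpow_natCast]
    have hVle : β * m - t < V := by
      by_contra! h
      have := hC.eq_zero_of_mem_dualNet u hk h
      exact hk0 (Classical.arbitrary u) (by rw [this]; rfl)
    have hVle' : (β : ℝ) * m - t ≤ V := by
      have : β * m ≤ V + t := by omega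
      have : (β : ℝ) * m ≤ V + t := by exact_mod_cast this
      linarith
    have hint : (β - α) * U + (α - 1) * V ≤ (β - 1) * S := by
      rw [hS, hU, hV, Finset.mul_sum, Finset.mul_sum, Finset.mul_sum, ← Finset.sum_add_distrib]
      exact Finset.sum_le_sum fun j _ => topSum_interpolation hα (by omega) (k j)
    have hint' : ((β : ℝ) - α) * U + (α - 1) * V ≤ (β - 1) * S := by
      have h1 : ((β - α : ℕ) : ℝ) = β - α := Nat.cast_sub (by omega)
      have h2 : ((α - 1 : ℕ) : ℝ) = α - 1 := by rw [Nat.cast_sub hα, Nat.cast_one]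
      have h3 : ((β - 1 : ℕ) : ℝ) = β - 1 := by rw [Nat.cast_sub (by omega), Nat.cast_one]
      rw [← h1, ← h2, ← h3]
      exact_mod_cast hint
    have hmain : lam * U + κ * V ≤ 2 * S := by
      have h1 : lam * U + κ * V = 2 * (((β : ℝ) - α) * U + (α - 1) * V) / (β - 1) := by
        rw [hlam, hκ]
        ring
      rw [h1, div_le_iff₀ hβ1]
      linarith
    rw [hprod, hxU, ← Real.rpow_add hb0]
    refine Real.rpow_le_rpow_of_exponent_le hb1.le ?_
    have := mul_le_mul_of_nonneg_left hVle' hκ0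
    linarith
  have hsum := sum_pow_topPosition_le (dualNet fun j : u => C j) (m - t)
    (fun k hk hle => hC.eq_zero_of_topPosition_le (by omega) u hk hle) hx0 hx1
  rw [Fintype.card_coe] at hsum
  set Y := ∑' v : ℕ, (v + 1 : ℝ) ^ (u.card - 1) * (b * x) ^ v with hY
  have hY0 : 0 ≤ Y := tsum_nonneg fun v => by positivity
  -- On the left `m - t` is truncated, on the right it is real and possibly negative; for `t > m`
  -- the bound is merely weaker.
  have hxw : x ^ (m - t) ≤ (b : ℝ) ^ (-(lam * (m - t))) := by
    rw [hx, ← Real.rpow_natCast, ← Real.rpow_mul hb0.le]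
    refine Real.rpow_le_rpow_of_exponent_le hb1.le ?_
    have h1 : (m : ℝ) - t ≤ ((m - t : ℕ) : ℝ) := by
      have h2 : m ≤ m - t + t := by omega
      rw [sub_le_iff_le_add]
      exact_mod_cast h2
    have := mul_le_mul_of_nonneg_left h1 hlam0
    linarith
  have hpow : (((m - t : ℕ) : ℝ) + 1) ^ (u.card - 1) ≤ 2 ^ (u.card - 1) * (m : ℝ) ^ (u.card - 1) := by
    rw [← mul_pow]
    refine pow_le_pow_left₀ (by positivity) ?_ _
    have h1 : ((m - t : ℕ) : ℝ) ≤ m := by exact_mod_cast Nat.sub_le m t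
    have h2 : (1 : ℝ) ≤ m := by exact_mod_cast hm
    linarith
  -- The identities behind this are `κ * β + lam = 2 * α` and `κ + lam = 2`.
  have hexp : (b : ℝ) ^ (-(κ * (β * m - t))) * (b : ℝ) ^ (-(lam * (m - t)))
      = ((((b : ℝ) ^ m) ^ α)⁻¹) ^ 2 * (b : ℝ) ^ (2 * t) := by
    have h1 : ((((b : ℝ) ^ m) ^ α)⁻¹) ^ 2 = (b : ℝ) ^ (-(2 * (α : ℝ) * m)) := by
      rw [Real.rpow_neg hb0.le, inv_pow, ← pow_mul, ← pow_mul, ← Real.rpow_natCast]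
      congr 2
      push_cast
      ring
    rw [h1, ← Real.rpow_natCast (b : ℝ) (2 * t), ← Real.rpow_add hb0, ← Real.rpow_add hb0]
    congr 1
    rw [hlam, hκ]
    push_cast
    field_simp
    ring
  have hset : ∀ k : u → Fin n → ZMod b, (∑ j : u, k j ᵥ* C j = 0 ∧ ∀ j, k j ≠ 0)
      ↔ (k ∈ dualNet (fun j : u => C j) ∧ ∀ j, k j ≠ 0) := fun k => Iff.rfl
  calc _ = ∑ k : u → Fin n → ZMod b with k ∈ dualNet (fun j : u => C j) ∧ ∀ j, k j ≠ 0,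
        ∏ j, (((b : ℝ) ^ topSum α (k j))⁻¹) ^ 2 := by
        refine Finset.sum_congr ?_ fun _ _ => rfl
        ext k
        simp only [Finset.mem_filter, hset]
    _ ≤ ∑ k : u → Fin n → ZMod b with k ∈ dualNet (fun j : u => C j) ∧ ∀ j, k j ≠ 0,
        (b : ℝ) ^ (-(κ * (β * m - t))) * x ^ (∑ j, topPosition (k j) 0) :=
        Finset.sum_le_sum fun k hk => hterm k (Finset.mem_filter.1 hk).2.1
          (Finset.mem_filter.1 hk).2.2
    _ ≤ (b : ℝ) ^ (-(κ * (β * m - t))) * ((b : ℝ) ^ (-(lam * (m - t))) *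
        ((2 ^ (u.card - 1) * (m : ℝ) ^ (u.card - 1)) * Y)) := by
        rw [← Finset.mul_sum]
        refine mul_le_mul_of_nonneg_left (hsum.trans ?_) (Real.rpow_nonneg hb0.le _)
        gcongr
    _ = ((b : ℝ) ^ (-(κ * (β * m - t))) * (b : ℝ) ^ (-(lam * (m - t)))) *
        ((2 ^ (u.card - 1) * (m : ℝ) ^ (u.card - 1)) * Y) := by ring
    _ = _ := by
        rw [hexp]
        ring

/-- The geometric sum is used for one coordinate, the full group and `w = 0`: decay in the largest
position alone, with ratio `b^{-2}`, already gives absolute summability uniformly in `n`. -/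
theorem exists_sum_walshCoeff_le (b : ℕ) [hb : Fact b.Prime] {α : ℕ} (hα : 1 ≤ α) :
    ∃ M : ℝ, 0 ≤ M ∧ ∀ n : ℕ,
      ∑ k : Fin n → ZMod b, ‖walshCoeff (sobolevKernelOne α) k‖ ≤ M := by
  classical
  obtain ⟨C₀, hC₀, h₀⟩ := exists_walshCoeff_zero_le b hα
  obtain ⟨C₁, hC₁, h₁⟩ := exists_walshCoeff_le_topSum b hα
  have hb1 : (1 : ℝ) < b := by exact_mod_cast hb.out.one_lt
  have hb0 : (0 : ℝ) < b := by linarith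
  set x : ℝ := ((b : ℝ)⁻¹) ^ 2 with hx
  have hx1 : b * x < 1 := by
    have : b * x = (b : ℝ)⁻¹ := by
      rw [hx]
      field_simp
    rw [this]
    exact inv_lt_one_of_one_lt₀ hb1
  set Y := ∑' v : ℕ, (v + 1 : ℝ) ^ (Fintype.card Unit - 1) * (b * x) ^ v with hY
  have hY0 : 0 ≤ Y := tsum_nonneg fun v => by positivity
  refine ⟨C₀ + C₁ * Y, by positivity, fun n => ?_⟩
  have hbn : ((b : ℝ) ^ n)⁻¹ ≤ 1 := inv_le_one_of_one_le₀ (one_le_pow₀ hb1.le)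
  have hsum := sum_pow_topPosition_le (b := b) (n := n) (ι := Unit) ⊤ 0 (fun k _ hk => by
    funext j
    have : topPosition (k j) 0 = 0 := by simpa using hk
    rw [(topPosition_eq_zero_iff _).1 this]
    rfl) (x := x) (by positivity) hx1
  rw [← hY] at hsum
  have hnz : ∑ k ∈ Finset.univ.erase (0 : Fin n → ZMod b), x ^ topPosition k 0 ≤ Y := by
    refine le_trans (le_of_eq ?_) (hsum.trans (le_of_eq (by simp)))
    refine Finset.sum_bij (fun k _ _ => k) ?_ ?_ ?_ ?_
    · intro k hk
      simpa using hk
    · intro k _ k' _ h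
      exact congrFun h ()
    · intro k hk
      refine ⟨k (), ?_, rfl⟩
      simpa using (Finset.mem_filter.1 hk).2.2 ()
    · intro k _
      simp
  rw [← Finset.add_sum_erase _ _ (Finset.mem_univ (0 : Fin n → ZMod b))]
  refine add_le_add ((h₀ n).trans (mul_le_of_le_one_right hC₀ hbn)) ?_
  refine le_trans (Finset.sum_le_sum fun k _ => ?_)
    ((Finset.mul_sum _ _ _).symm.le.trans (mul_le_mul_of_nonneg_left hnz hC₁))
  refine (h₁ n k).trans (mul_le_mul_of_nonneg_left ?_ hC₁)
  have h2 : x ^ topPosition k 0 = (((b : ℝ) ^ topPosition k 0)⁻¹) ^ 2 := by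
    rw [hx, pow_right_comm, inv_pow]
  have h3 : ((b : ℝ) ^ topSum α k)⁻¹ ≤ ((b : ℝ) ^ topPosition k 0)⁻¹ :=
    inv_anti₀ (pow_pos hb0 _) (pow_le_pow_right₀ hb1.le (topPosition_le_topSum hα k))
  rw [h2]
  exact pow_le_pow_left₀ (inv_nonneg.2 (pow_nonneg hb0.le _)) h3 2

/-- A union bound over the vanishing coordinate `i`: fixing `k i = 0` leaves a product sum, with
factor `q 0` at `i` and at most `M` elsewhere. -/
theorem sum_prod_exists_zero_le {ι : Type*} [Fintype ι] [DecidableEq ι]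
    (q : (Fin n → ZMod b) → ℝ) (hq : ∀ k, 0 ≤ q k) {M : ℝ} (hM : ∑ k, q k ≤ M) :
    ∑ k : ι → Fin n → ZMod b with ∃ j, k j = (0 : Fin n → ZMod b), ∏ j, q (k j)
      ≤ Fintype.card ι * (q 0 * M ^ (Fintype.card ι - 1)) := by
  have hM0 : 0 ≤ M := (Finset.sum_nonneg fun k _ => hq k).trans hM
  have h1 : ∀ i : ι, ∑ k : ι → Fin n → ZMod b with k i = 0, ∏ j, q (k j)
      ≤ q 0 * M ^ (Fintype.card ι - 1) := fun i => by
    have h2 : ∑ k : ι → Fin n → ZMod b with k i = 0, ∏ j, q (k j)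
        = ∏ j, ∑ x : Fin n → ZMod b, if j = i then (if x = 0 then q x else 0) else q x := by
      rw [Fintype.prod_sum, Finset.sum_filter]
      refine Finset.sum_congr rfl fun k _ => ?_
      split_ifs with hk
      · refine Finset.prod_congr rfl fun j _ => ?_
        split_ifs with hj hj'
        · rfl
        · exact absurd (hj ▸ hk) hj'
        · rfl
      · refine (Finset.prod_eq_zero (Finset.mem_univ i) ?_).symm
        simp [hk]
    rw [h2, ← Finset.mul_prod_erase _ _ (Finset.mem_univ i)]
    refine mul_le_mul (le_of_eq (by simp)) ?_ (Finset.prod_nonneg fun j _ =>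
      Finset.sum_nonneg fun x _ => ?_) (hq 0)
    · rw [← Finset.card_univ, ← Finset.card_erase_of_mem (Finset.mem_univ i)]
      rw [← Finset.prod_const]
      refine Finset.prod_le_prod (fun j _ => Finset.sum_nonneg fun x _ => ?_) fun j hj => ?_
      · split_ifs <;> first | exact hq _ | exact le_rfl
      · simpa [(Finset.mem_erase.1 hj).1] using hM
    · split_ifs <;> first | exact hq _ | exact le_rfl
  calc _ ≤ ∑ i : ι, ∑ k : ι → Fin n → ZMod b with k i = 0, ∏ j, q (k j) := by
        simp only [Finset.sum_filter]
        rw [Finset.sum_comm]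
        refine Finset.sum_le_sum fun k _ => ?_
        have hp : 0 ≤ ∏ j, q (k j) := Finset.prod_nonneg fun j _ => hq _
        have h3 : ∀ i, 0 ≤ if k i = 0 then ∏ j, q (k j) else 0 := fun i => by
          split_ifs <;> first | exact hp | exact le_rfl
        split_ifs with h
        · obtain ⟨i, hi⟩ := h
          refine le_trans (le_of_eq ?_) (Finset.single_le_sum (fun i _ => h3 i) (Finset.mem_univ i))
          rw [if_pos hi]
        · exact Finset.sum_nonneg fun i _ => h3 i
    _ ≤ ∑ _i : ι, q 0 * M ^ (Fintype.card ι - 1) := Finset.sum_le_sum fun i _ => h1 i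
    _ = _ := by simp

end DualSums

/-! ### The dual sum and the final estimate -/

/-- Frequencies with all components nonzero fall under the geometric estimate. For the rest the dual
condition is dropped, since a zero component already supplies a factor `O(b^{-n})`. -/
theorem exists_dualNet_sum_le (b : ℕ) [hb : Fact b.Prime] (α β t : ℕ) (hα : 1 ≤ α)
    (hβ : 2 * α ≤ β) : ∃ A : ℕ → ℝ, (∀ c, 0 < A c) ∧ ∀ (s m n : ℕ), 1 ≤ m →
      ∀ C : Fin s → Matrix (Fin n) (Fin m) (ZMod b), IsOrderDigitalNet β t C →
      ∀ u : Finset (Fin s), u.Nonempty →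
      ∑ k : u → Fin n → ZMod b with ∑ j : u, k j ᵥ* C j = 0,
        ∏ j, ‖walshCoeff (sobolevKernelOne α) (k j)‖
      ≤ ((((b : ℝ) ^ m) ^ α)⁻¹) ^ 2 * (m : ℝ) ^ (u.card - 1) * A u.card := by
  obtain ⟨C₀, hC₀, h₀⟩ := exists_walshCoeff_zero_le b hα
  obtain ⟨C₁, hC₁, h₁⟩ := exists_walshCoeff_le_topSum b hα
  obtain ⟨M, hM, hsum⟩ := exists_sum_walshCoeff_le b hα
  have hb1 : (1 : ℝ) < b := by exact_mod_cast hb.out.one_lt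
  have hb0 : (0 : ℝ) < b := by linarith
  set x : ℝ := (b : ℝ) ^ (-(2 * ((β : ℝ) - α) / (β - 1))) with hx
  have hx0 : 0 ≤ x := Real.rpow_nonneg hb0.le _
  set Y : ℕ → ℝ := fun c => ∑' v : ℕ, (v + 1 : ℝ) ^ (c - 1) * (b * x) ^ v with hY
  have hY0 : ∀ c, 0 ≤ Y c := fun c => tsum_nonneg fun v => by positivity
  have hA1 : ∀ c, 0 ≤ C₁ ^ c * ((b : ℝ) ^ (2 * t) * (2 ^ (c - 1) * Y c)) := fun c =>
    mul_nonneg (by positivity) (mul_nonneg (by positivity) (mul_nonneg (by positivity) (hY0 c)))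
  refine ⟨fun c => C₁ ^ c * ((b : ℝ) ^ (2 * t) * (2 ^ (c - 1) * Y c)) + c * (C₀ * M ^ (c - 1)) + 1,
    fun c => by
      have := hA1 c
      positivity, ?_⟩
  intro s m n hm C hC u hu
  set R : ℝ := ((((b : ℝ) ^ m) ^ α)⁻¹) ^ 2 * (m : ℝ) ^ (u.card - 1) with hR
  have hm1 : (1 : ℝ) ≤ m := by exact_mod_cast hm
  have hR0 : 0 ≤ R := by positivity
  have hsplit : ∑ k : u → Fin n → ZMod b with ∑ j : u, k j ᵥ* C j = 0,
        ∏ j, ‖walshCoeff (sobolevKernelOne α) (k j)‖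
      ≤ ∑ k : u → Fin n → ZMod b with ∑ j : u, k j ᵥ* C j = 0 ∧ ∀ j, k j ≠ 0,
        ∏ j, ‖walshCoeff (sobolevKernelOne α) (k j)‖
      + ∑ k : u → Fin n → ZMod b with ∃ j, k j = (0 : Fin n → ZMod b),
        ∏ j, ‖walshCoeff (sobolevKernelOne α) (k j)‖ := by
    simp only [Finset.sum_filter]
    rw [← Finset.sum_add_distrib]
    refine Finset.sum_le_sum fun k _ => ?_
    have hp : 0 ≤ ∏ j, ‖walshCoeff (sobolevKernelOne α) (k j)‖ :=
      Finset.prod_nonneg fun j _ => norm_nonneg _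
    by_cases h1 : ∃ j, k j = (0 : Fin n → ZMod b)
    · rw [if_pos h1]
      split_ifs <;> linarith
    · have h2 : ∀ j, k j ≠ 0 := fun j hj => h1 ⟨j, hj⟩
      rw [if_neg h1, add_zero]
      refine le_of_eq (if_congr ⟨fun h => ⟨h, h2⟩, fun h => h.1⟩ rfl rfl)
  have hmain : ∑ k : u → Fin n → ZMod b with ∑ j : u, k j ᵥ* C j = 0 ∧ ∀ j, k j ≠ 0,
        ∏ j, ‖walshCoeff (sobolevKernelOne α) (k j)‖
      ≤ R * (C₁ ^ u.card * ((b : ℝ) ^ (2 * t) * (2 ^ (u.card - 1) * Y u.card))) := by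
    have h1 : ∀ k : u → Fin n → ZMod b, ∏ j, ‖walshCoeff (sobolevKernelOne α) (k j)‖
        ≤ C₁ ^ u.card * ∏ j, (((b : ℝ) ^ topSum α (k j))⁻¹) ^ 2 := fun k => by
      refine (Finset.prod_le_prod (fun j _ => norm_nonneg _) fun j _ => h₁ n (k j)).trans
        (le_of_eq ?_)
      rw [Finset.prod_mul_distrib, Finset.prod_const, Finset.card_univ, Fintype.card_coe]
    refine (Finset.sum_le_sum fun k _ => h1 k).trans ?_
    rw [← Finset.mul_sum]
    refine (mul_le_mul_of_nonneg_left (sum_dualNet_topSum_le hα hβ hm hC hu hx)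
      (by positivity)).trans (le_of_eq ?_)
    rw [hR, hY]
    ring
  have hzero : ∑ k : u → Fin n → ZMod b with ∃ j, k j = (0 : Fin n → ZMod b),
        ∏ j, ‖walshCoeff (sobolevKernelOne α) (k j)‖
      ≤ R * (u.card * (C₀ * M ^ (u.card - 1))) := by
    refine (sum_prod_exists_zero_le (fun k => ‖walshCoeff (sobolevKernelOne α) k‖)
      (fun k => norm_nonneg _) (hsum n)).trans ?_
    rw [Fintype.card_coe]
    -- Here `n ≥ β * m ≥ 2 * α * m` enters: the matrices have enough rows for the discretisation
    -- error to be negligible.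
    have h2 : ((b : ℝ) ^ n)⁻¹ ≤ R := by
      have h3 : ((b : ℝ) ^ n)⁻¹ ≤ ((((b : ℝ) ^ m) ^ α)⁻¹) ^ 2 := by
        rw [inv_pow, ← pow_mul, ← pow_mul]
        refine inv_anti₀ (by positivity) (pow_le_pow_right₀ hb1.le ?_)
        have := hC.1
        have h4 : m * (2 * α) ≤ m * β := Nat.mul_le_mul_left m hβ
        calc m * (α * 2) = m * (2 * α) := by ring
          _ ≤ m * β := h4
          _ = β * m := mul_comm _ _
          _ ≤ n := this
      refine h3.trans ?_
      exact le_mul_of_one_le_right (by positivity) (one_le_pow₀ hm1)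
    calc (u.card : ℝ) * (‖walshCoeff (sobolevKernelOne α) (0 : Fin n → ZMod b)‖
          * M ^ (u.card - 1)) ≤ u.card * ((C₀ * R) * M ^ (u.card - 1)) := by
          refine mul_le_mul_of_nonneg_left (mul_le_mul_of_nonneg_right ((h₀ n).trans
            (mul_le_mul_of_nonneg_left h2 hC₀)) (by positivity)) (by positivity)
      _ = _ := by ring
  refine hsplit.trans ((add_le_add hmain hzero).trans ?_)
  rw [← mul_add]
  exact mul_le_mul_of_nonneg_left (by linarith) hR0

theorem sqrt_sum_le {ι : Type*} (t : Finset ι) (f : ι → ℝ) (hf : ∀ i ∈ t, 0 ≤ f i) :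
    √(∑ i ∈ t, f i) ≤ ∑ i ∈ t, √(f i) := by
  refine Real.sqrt_le_iff.2 ⟨Finset.sum_nonneg fun i _ => Real.sqrt_nonneg _, ?_⟩
  calc ∑ i ∈ t, f i = ∑ i ∈ t, √(f i) ^ 2 :=
        Finset.sum_congr rfl fun i hi => (Real.sq_sqrt (hf i hi)).symm
    _ ≤ _ := Finset.sum_sq_le_sq_sum_of_nonneg fun i _ => Real.sqrt_nonneg _

end QMC

theorem corollary2 (b : ℕ) [Fact b.Prime] (α β t : ℕ) [Fact (2 ≤ α)]
    (hβ : 2 * α ≤ β) :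
    ∃ C : ℕ → ℝ, (∀ k, 0 < C k) ∧
      (∀ (s m n : ℕ), 1 ≤ s → 1 ≤ m →
        ∀ Cmat : Fin s → Matrix (Fin n) (Fin m) (ZMod b), QMC.IsOrderDigitalNet β t Cmat →
        ∀ γ : Finset (Fin s) → NNReal, ∃ σ : QMC.UnitCube s,
          QMC.worstCaseError (QMC.WeightedSobolev α γ)
              (QMC.digitalShift (QMC.digitalNet Cmat) (QMC.digitalNet_finite Cmat) σ) ≤
            ENNReal.ofReal ((((b : ℝ) ^ m) ^ α)⁻¹ *
              ∑ u ∈ (Finset.univ : Finset (Finset (Fin s))).filter (fun u => u.Nonempty),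
                Real.sqrt (γ u) * C u.card *
                  Real.log ((b : ℝ) ^ m) ^ (((u.card : ℝ) - 1) / 2))) ∧
      (∀ (s : ℕ), 1 ≤ s → ∀ γ : Finset (Fin s) → NNReal, ∃ c : ℝ, 0 < c ∧
        ∀ (m n : ℕ), 1 ≤ m →
        ∀ Cmat : Fin s → Matrix (Fin n) (Fin m) (ZMod b), QMC.IsOrderDigitalNet β t Cmat →
        ∃ σ : QMC.UnitCube s,
          QMC.worstCaseError (QMC.WeightedSobolev α γ)
              (QMC.digitalShift (QMC.digitalNet Cmat) (QMC.digitalNet_finite Cmat) σ) ≤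
            ENNReal.ofReal (c * (((b : ℝ) ^ m) ^ α)⁻¹ *
              Real.log ((b : ℝ) ^ m) ^ (((s : ℝ) - 1) / 2))) := by
  have hα : 1 ≤ α := one_le_two.trans (Fact.out : 2 ≤ α)
  have hb : b.Prime := Fact.out
  have hb1 : (1 : ℝ) < b := by exact_mod_cast hb.one_lt
  have hb0 : (0 : ℝ) < b := by linarith
  have hlog : 0 < Real.log b := Real.log_pos hb1
  obtain ⟨A, hA, hsum⟩ := QMC.exists_dualNet_sum_le b α β t hα hβ
  -- The inverse factor converts powers of `m` into powers of `log N = m * log b`.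
  set C : ℕ → ℝ := fun c => √(A c) * (Real.log b ^ (((c : ℝ) - 1) / 2))⁻¹ with hC
  have hC0 : ∀ c, 0 < C c := fun c =>
    mul_pos (Real.sqrt_pos.2 (hA c)) (inv_pos.2 (Real.rpow_pos_of_pos hlog _))
  have hmain : ∀ (s m n : ℕ), 1 ≤ m →
        ∀ Cmat : Fin s → Matrix (Fin n) (Fin m) (ZMod b), QMC.IsOrderDigitalNet β t Cmat →
        ∀ γ : Finset (Fin s) → NNReal, ∃ σ : QMC.UnitCube s,
          QMC.worstCaseError (QMC.WeightedSobolev α γ)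
              (QMC.digitalShift (QMC.digitalNet Cmat) (QMC.digitalNet_finite Cmat) σ) ≤
            ENNReal.ofReal ((((b : ℝ) ^ m) ^ α)⁻¹ *
              ∑ u ∈ (Finset.univ : Finset (Finset (Fin s))).filter (fun u => u.Nonempty),
                Real.sqrt (γ u) * C u.card *
                  Real.log ((b : ℝ) ^ m) ^ (((u.card : ℝ) - 1) / 2)) := by
    intro s m n hm Cmat hnet γ
    have hne : Nonempty (Fin (b ^ m)) := ⟨⟨0, pow_pos hb.pos m⟩⟩
    obtain ⟨σ, hσ⟩ := QMC.exists_shift_error_le α Cmat γ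
    refine ⟨σ, (QMC.worstCaseError_le γ _).trans (ENNReal.ofReal_le_ofReal ?_)⟩
    refine (Real.sqrt_le_sqrt (hσ.trans (Finset.sum_le_sum fun u hu =>
      mul_le_mul_of_nonneg_left (hsum s m n hm Cmat hnet u (Finset.mem_filter.1 hu).2)
        (γ u).2))).trans ?_
    refine (QMC.sqrt_sum_le _ _ fun u _ => mul_nonneg (γ u).2
      (mul_nonneg (by positivity) (hA _).le)).trans ?_
    rw [Finset.mul_sum]
    refine Finset.sum_le_sum fun u hu => le_of_eq ?_
    have hcard : 1 ≤ u.card := Finset.card_pos.2 (Finset.mem_filter.1 hu).2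
    have hsq : √((m : ℝ) ^ (u.card - 1)) = (m : ℝ) ^ (((u.card : ℝ) - 1) / 2) := by
      rw [Real.sqrt_eq_rpow, ← Real.rpow_natCast, ← Real.rpow_mul (Nat.cast_nonneg m),
        Nat.cast_sub hcard, Nat.cast_one]
      congr 1
      ring
    rw [Real.sqrt_mul (γ u).2, Real.sqrt_mul (by positivity), Real.sqrt_mul (by positivity),
      Real.sqrt_sq (by positivity), hsq, Real.log_pow,
      Real.mul_rpow (Nat.cast_nonneg m) hlog.le, hC]
    have := (Real.rpow_pos_of_pos hlog (((u.card : ℝ) - 1) / 2)).ne'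
    field_simp
    exact mul_comm _ _
  refine ⟨C, hC0, fun s m n _ => hmain s m n, fun s hs γ => ?_⟩
  -- `log N` may be less than one, so its powers need not increase with the exponent. Those of `m ≥
  -- 1` do, and the ratio of the powers of `log b` is put into the constant.
  set c : ℝ := ∑ u ∈ (Finset.univ : Finset (Finset (Fin s))).filter (fun u => u.Nonempty),
    √(γ u) * C u.card * (Real.log b ^ (((u.card : ℝ) - 1) / 2)
      * (Real.log b ^ (((s : ℝ) - 1) / 2))⁻¹) with hc
  have hc0 : 0 ≤ c := Finset.sum_nonneg fun u _ => mul_nonneg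
    (mul_nonneg (Real.sqrt_nonneg _) (hC0 _).le)
    (mul_nonneg (Real.rpow_nonneg hlog.le _) (inv_nonneg.2 (Real.rpow_nonneg hlog.le _)))
  -- The added one keeps the constant positive when all weights of nonempty sets vanish.
  refine ⟨c + 1, by linarith, fun m n hm Cmat hnet => ?_⟩
  obtain ⟨σ, hσ⟩ := hmain s m n hm Cmat hnet γ
  refine ⟨σ, hσ.trans (ENNReal.ofReal_le_ofReal ?_)⟩
  have hm1 : (1 : ℝ) ≤ m := by exact_mod_cast hm
  set L : ℝ := Real.log ((b : ℝ) ^ m) ^ (((s : ℝ) - 1) / 2) with hL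
  have hLs : L = (m : ℝ) ^ (((s : ℝ) - 1) / 2) * Real.log b ^ (((s : ℝ) - 1) / 2) := by
    rw [hL, Real.log_pow, Real.mul_rpow (by positivity) hlog.le]
  have hL0 : 0 ≤ L := by
    rw [hLs]
    positivity
  have hN0 : 0 ≤ (((b : ℝ) ^ m) ^ α)⁻¹ := by positivity
  have hterm : ∑ u ∈ (Finset.univ : Finset (Finset (Fin s))).filter (fun u => u.Nonempty),
      √(γ u) * C u.card * Real.log ((b : ℝ) ^ m) ^ (((u.card : ℝ) - 1) / 2) ≤ c * L := by
    rw [hc, Finset.sum_mul]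
    refine Finset.sum_le_sum fun u _ => ?_
    rw [mul_assoc (√(γ u) * C u.card)]
    refine mul_le_mul_of_nonneg_left ?_ (mul_nonneg (Real.sqrt_nonneg _) (hC0 _).le)
    have hus : (u.card : ℝ) ≤ s := by
      exact_mod_cast (Finset.card_le_univ u).trans_eq (Fintype.card_fin s)
    have h1 : (m : ℝ) ^ (((u.card : ℝ) - 1) / 2) ≤ (m : ℝ) ^ (((s : ℝ) - 1) / 2) :=
      Real.rpow_le_rpow_of_exponent_le hm1 (by linarith)
    have h2 := (Real.rpow_pos_of_pos hlog (((s : ℝ) - 1) / 2)).ne'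
    rw [hLs, Real.log_pow, Real.mul_rpow (by positivity) hlog.le]
    calc _ ≤ (m : ℝ) ^ (((s : ℝ) - 1) / 2) * Real.log b ^ (((u.card : ℝ) - 1) / 2) :=
          mul_le_mul_of_nonneg_right h1 (Real.rpow_nonneg hlog.le _)
      _ = _ := by field_simp
  calc _ ≤ (((b : ℝ) ^ m) ^ α)⁻¹ * (c * L) := mul_le_mul_of_nonneg_left hterm hN0
    _ ≤ (((b : ℝ) ^ m) ^ α)⁻¹ * ((c + 1) * L) :=
        mul_le_mul_of_nonneg_left (mul_le_mul_of_nonneg_right (by linarith) hL0) hN0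
    _ = _ := by ring
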